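/- **Setting.** Let $d\ge 2$, let $\Omega$ be $\mathbb R^d$ or a torus $\mathbb T^d=(\mathbb R/L\mathbb Z)^d$ with $L>0$, and write $\langle v\rangle=\sqrt{1+|v|^2}$ and $$\|g\|_{L^\infty_m}=\sup_{x\in\Omega,\,v\in\mathbb R^d}\langle v\rangle^m|g(x,v)| .$$ Consider the equation $(\partial_t+v\cdot\nabla_x)f=Q(f,f)$, where $Q$ acts in the variable $v$ and is one of the following operators. * *Landau*, with $\gamma\in[-d,1]$, and $\gamma>-2$ if $d=2$: $$Q(f,f)(v)=\nabla_v\cdot\int_{\mathbb R^d}|v-w|^{2+\gamma}\,\Pi(v-w)\,[f(w)\nabla f(v)-f(v)\nabla f(w)]\,dw,\qquad \Pi(z)=\mathrm{Id}-\frac{z\otimes z}{|z|^2},$$ where the integral is the limit as $R\to\infty$ of the integrals over $|v-w|<R$. * *Boltzmann*, with $\gamma>-d$: $$Q(f,f)(v)=\int_{\mathbb R^d}\int_{\mathbb S^{d-1}}|v-v_*|^\gamma\, b(\sin(\theta/2))\,[f(v')f(v_*')-f(v)f(v_*)]\,d\sigma\,dv_*,$$ where $v'=\frac{v+v_*}2+\frac{|v-v_*|}2\sigma$,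 $v_*'=\frac{v+v_*}2-\frac{|v-v_*|}2\sigma$, $\theta\in[0,\pi]$ is the angle between $\sigma$ and $v-v_*$, and $b\ge0$ is any measurable function with $\int_{\mathbb S^{d-1}}\sin^2(\theta/2)\,b(\sin(\theta/2))\,d\sigma<\infty$ (so the kernel may be cutoff or non-cutoff). The integral is the limit as $\varepsilon\to0^+$ of the integrals over $\sin(\theta/2)>\varepsilon$. **Solutions.** Given $m$ and $T>0$, a solution on $[0,T]$ with initial data $f_{\rm in}$ is a function $f:[0,T]\times\Omega\times\mathbb R^d\to[0,\infty)$ such that: $f$ is continuous, with $f(0,\cdot,\cdot)=f_{\rm in}$; for $0<t<T$, the function $f(t,x,\cdot)$ is $C^2$, the derivatives $D_v^2f$ and $(\partial_t+v\cdot\nabla_x)f$ (the latter as a derivative in the direction $(1,v)$ of space-time) exist and are continuous in $(t,x,v)$, and the equation holds; for some $\varepsilon>0$, $\langle v\rangle^{m+\varepsilon}f\to0$ as $|v|\to\infty$, uniformly in $(t,x)$; and, if $\Omega=\mathbb R^d$, $\langle v\rangle^m f\to0$ as $|x|\to\infty$, uniformly in $(t,v)$. **Theorem.** There is a number $m_0$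 depending only on $Q$ (that is, on $d$, $\gamma$ and, for Boltzmann, $b$), which for Landau is $m_0=d+2+\gamma$, such that for every $m>m_0$ there is a constant $C>0$ depending only on $m$ and $Q$ with the following property. For every $\Omega$ as above, every $T>0$, every $f_{\rm in}\in L^\infty_m$ and every solution $f$ on $[0,T]$ with initial data $f_{\rm in}$, the function $s\mapsto\|f(s)\|_{L^\infty_{d+\gamma}}$ is finite and integrable on $[0,T]$, and for all $t\in[0,T]$ $$\|f(t)\|_{L^\infty_m}\le\|f_{\rm in}\|_{L^\infty_m}\exp\left(C\int_0^t\|f(s)\|_{L^\infty_{d+\gamma}}\,ds\right).$$ -/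

import Mathlib

open Filter Topology MeasureTheory

noncomputable section

namespace Kinetic

/-- Velocity space `ℝ^d` with the Euclidean norm. -/
abbrev E (d : ℕ) : Type := EuclideanSpace ℝ (Fin d)

/-- The torus `(ℝ / L ℤ)^d`. -/
abbrev Torus (d : ℕ) (L : ℝ) : Type := Fin d → AddCircle L

/-- Translation of a point of the torus by a vector of `ℝ^d`. -/
def torusShift (d : ℕ) (L : ℝ) (x : Torus d L) (h : E d) : Torus d L :=
  fun i => x i + ((h i : ℝ) : AddCircle L)

/-- Translation of a point of `ℝ^d` by a vector of `ℝ^d`. -/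
def spaceShift (d : ℕ) (x h : E d) : E d := x + h

/-- The bracket `⟨v⟩ = (1 + |v|^2)^{1/2}`. -/
def bracket {d : ℕ} (v : E d) : ℝ := Real.sqrt (1 + ‖v‖ ^ 2)

/-- The weighted norm `‖g‖_{L^∞_m} = sup_{x, v} ⟨v⟩^m |g(x, v)|`, with values in `[0, ∞]`
(all functions to which it is applied are continuous, so the supremum is the essential one). -/
def wnorm {X : Type} {d : ℕ} (m : ℝ) (g : X → E d → ℝ) : ENNReal :=
  ⨆ (x : X) (v : E d), ENNReal.ofReal (bracket v ^ m * |g x v|)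

/-! The Landau operator -/

/-- `Π(z) u`, the orthogonal projection of `u` onto the hyperplane orthogonal to `z`. -/
def perpProj {d : ℕ} (z u : E d) : E d := u - (inner ℝ z u / ‖z‖ ^ 2) • z

/-- The Landau flux
`∫ |v - w|^{2+γ} Π(v - w) [g(w) ∇f(v) - f(v) ∇g(w)] dw`, restricted to `|v - w| < R`. -/
def landauFluxTrunc {d : ℕ} (γ : ℝ) (g f : E d → ℝ) (R : ℝ) (v : E d) : E d :=
  ∫ w in Metric.ball v R,
    (‖v - w‖ ^ (2 + γ)) • perpProj (v - w) (g w • gradient f v - f v • gradient g w)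

/-- `Q_L(f, f)(v)` is defined and equal to `q`: the flux integral converges (as an improper
integral, `R → ∞`) to a vector field `J`, which is differentiable at `v` with divergence `q`. No
decay of `∇f` is assumed, so the integral over the whole space need not converge absolutely;
where it does, the limit is that integral. -/
def IsLandauValue {d : ℕ} (γ : ℝ) (f : E d → ℝ) (v : E d) (q : ℝ) : Prop :=
  ∃ (J : E d → E d) (A : E d →L[ℝ] E d),
    (∀ u, Tendsto (fun R : ℝ => landauFluxTrunc γ f f R u) atTop (𝓝 (J u))) ∧
    HasFDerivAt J A v ∧
    ∑ i : Fin d, (A (EuclideanSpace.single i 1)) i = q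

/-! The Boltzmann operator -/

/-- Surface measure on the unit sphere of `ℝ^d`. -/
def sphereMeasure (d : ℕ) : Measure (Metric.sphere (0 : E d) 1) :=
  (volume : Measure (E d)).toSphere

/-- `sin (θ / 2)`, where `θ ∈ [0, π]` is the angle between `w` and `σ`. -/
def sinHalf {d : ℕ} (w σ : E d) : ℝ := Real.sin (InnerProductGeometry.angle w σ / 2)

/-- Admissible angular functions `b`: nonnegative, measurable, and
`∫ sin(θ/2)^2 b(sin(θ/2)) dσ < ∞` (for one, equivalently for every, polar axis `e`). -/
structure IsAngularKernel (d : ℕ) (b : ℝ → ℝ) : Prop where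
  measurable : Measurable b
  nonneg : ∀ s ∈ Set.Icc (0 : ℝ) 1, 0 ≤ b s
  integrable : ∀ e : E d, ‖e‖ = 1 →
    Integrable (fun σ : Metric.sphere (0 : E d) 1 =>
      sinHalf e (σ : E d) ^ 2 * b (sinHalf e (σ : E d))) (sphereMeasure d)

/-- The collision kernel `B(w, σ) = |w|^γ b(sin(θ/2))`. -/
def collisionKernel {d : ℕ} (γ : ℝ) (b : ℝ → ℝ) (w σ : E d) : ℝ :=
  ‖w‖ ^ γ * b (sinHalf w σ)

/-- `v' = (v + v_*)/2 + |v - v_*| σ / 2`. -/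
def vPrime {d : ℕ} (v vs σ : E d) : E d := (1 / 2 : ℝ) • (v + vs) + (‖v - vs‖ / 2) • σ

/-- `v_*' = (v + v_*)/2 - |v - v_*| σ / 2`. -/
def vsPrime {d : ℕ} (v vs σ : E d) : E d := (1 / 2 : ℝ) • (v + vs) - (‖v - vs‖ / 2) • σ

/-- The Boltzmann operator
`∫∫ B(v - v_*, σ) [f(v') g(v_*') - f(v) g(v_*)] dσ dv_*`, restricted to `sin(θ/2) > ε`. -/
def boltzmannTrunc {d : ℕ} (γ : ℝ) (b : ℝ → ℝ) (g f : E d → ℝ) (ε : ℝ) (v : E d) : ℝ :=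
  ∫ vs : E d, ∫ σ : Metric.sphere (0 : E d) 1,
    (if ε < sinHalf (v - vs) (σ : E d) then
      collisionKernel γ b (v - vs) (σ : E d) *
        (f (vPrime v vs (σ : E d)) * g (vsPrime v vs (σ : E d)) - f v * g vs)
    else 0) ∂(sphereMeasure d)

/-- `Q_B(f, f)(v)` is defined and equal to `q`. For a non-cutoff kernel the integral is not
absolutely convergent and is understood, as usual, as the limit of the operators with the grazing
angles removed; where it converges absolutely (in particular for a cutoff kernel and `f`
bounded with enough decay), the limit is that integral. -/
def IsBoltzmannValue {d : ℕ} (γ : ℝ) (b : ℝ → ℝ) (f : E d → ℝ) (v : E d) (q : ℝ) : Prop :=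
  Tendsto (fun ε : ℝ => boltzmannTrunc γ b f f ε v) (𝓝[>] 0) (𝓝 q)

/-! Solutions -/

/-- `f : [0, T] × X × ℝ^d → [0, ∞)` is a classical solution of `(∂_t + v · ∇_x) f = Q(f, f)` with
initial data `fin`. Here `X` is the spatial domain, `shift x h` is `x + h`, and `Q f v q` says
that `Q(f, f)(v)` is defined and equal to `q`. Only the values of `f` for times in `[0, T]`
matter. -/
structure IsSolution {X : Type} [TopologicalSpace X] {d : ℕ} (shift : X → E d → X)
    (Q : (E d → ℝ) → E d → ℝ → Prop) (m T : ℝ) (fin : X → E d → ℝ)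
    (f : ℝ → X → E d → ℝ) : Prop where
  nonneg : ∀ t ∈ Set.Icc 0 T, ∀ x v, 0 ≤ f t x v
  initial : ∀ x v, f 0 x v = fin x v
  /-- `f` is continuous up to the initial time. -/
  continuousOn : ContinuousOn (fun p : ℝ × X × E d => f p.1 p.2.1 p.2.2)
    (Set.Icc 0 T ×ˢ Set.univ)
  /-- `D_v^2 f` exists and is continuous. -/
  contDiff : ∀ t ∈ Set.Ioo 0 T, ∀ x, ContDiff ℝ 2 (f t x)
  continuousOn_hessian :
    ContinuousOn (fun p : ℝ × X × E d => iteratedFDeriv ℝ 2 (f p.1 p.2.1) p.2.2)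
      (Set.Ioo 0 T ×ˢ Set.univ)
  /-- The transport derivative `D = (∂_t + v · ∇_x) f`, which is the derivative of `f` in the
  direction `(1, v)` of space-time, exists, is continuous, and equals `Q(f, f)`. -/
  equation : ∃ D : ℝ → X → E d → ℝ,
    ContinuousOn (fun p : ℝ × X × E d => D p.1 p.2.1 p.2.2) (Set.Ioo 0 T ×ˢ Set.univ) ∧
    ∀ t ∈ Set.Ioo 0 T, ∀ x v,
      HasDerivAt (fun s : ℝ => f s (shift x ((s - t) • v)) v) (D t x v) t ∧
      Q (f t x) v (D t x v)
  /-- For some `ε > 0`, `⟨v⟩^{m+ε} f → 0` as `|v| → ∞`, uniformly in `(t, x)`. -/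
  decay_v : ∃ ε > 0, ∀ η > 0, ∃ R : ℝ, ∀ t ∈ Set.Icc 0 T, ∀ x, ∀ v : E d, R ≤ ‖v‖ →
    bracket v ^ (m + ε) * f t x v ≤ η
  /-- `⟨v⟩^m f → 0` as `x` leaves the compact subsets of `X`, uniformly in `(t, v)`. On the torus
  this is no condition. -/
  decay_x : ∀ η > 0, ∃ K : Set X, IsCompact K ∧ ∀ t ∈ Set.Icc 0 T, ∀ x ∉ K, ∀ v : E d,
    bracket v ^ m * f t x v ≤ η

/-- The a priori estimate with the constant `C`, for all solutions on the spatial domain `X`: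
`‖f(t)‖_{L^∞_m} ≤ ‖fin‖_{L^∞_m} exp (C ∫_0^t ‖f(s)‖_{L^∞_{d+γ}} ds)`,
where the integral is finite. -/
def AprioriEstimate {X : Type} [TopologicalSpace X] {d : ℕ} (shift : X → E d → X)
    (Q : (E d → ℝ) → E d → ℝ → Prop) (γ m C : ℝ) : Prop :=
  ∀ (T : ℝ) (fin : X → E d → ℝ) (f : ℝ → X → E d → ℝ), 0 < T →
    wnorm m fin < ⊤ → IsSolution shift Q m T fin f →
    (∀ s ∈ Set.Icc 0 T, wnorm (d + γ) (f s) < ⊤) ∧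
    IntervalIntegrable (fun s => (wnorm (d + γ) (f s)).toReal) volume 0 T ∧
    ∀ t ∈ Set.Icc 0 T,
      wnorm m (f t) ≤ wnorm m fin *
        ENNReal.ofReal (Real.exp (C * ∫ s in (0 : ℝ)..t, (wnorm (d + γ) (f s)).toReal))

end Kinetic

end

/-! The proof is a maximum principle for the weighted supremum. Let the barrier be `B t = (M 0 + κ)
* exp (C ∫ A + κ t)`, where `M` and `A` are the norms with weights `m` and `d + γ`. If `M` ever
reaches `B`, then at the first contact time there is a point where `f ≤ N⟨·⟩^(-m)` in velocity, with
`N = B t` and equality at `v`. Along the free-transport line through that point the weighted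
solution crosses the barrier from below, so its derivative is at least that of the barrier. A
contradiction follows from the pointwise bound `Q(g,g)(v) ≤ C ⟨v⟩^(d+γ) g(v)^2` for every `g`
touching `N⟨·⟩^(-m)` from below at `v` (`TouchingEstimate`): one factor `g(v)` is absorbed by `A`,
the other by `B`. The rest of the file proves this bound for both operators.

In both cases velocities `w` split into a near zone `⟨w⟩ < δ⟨v⟩` and the far zone. In the far zone
`g(w) ≤ N⟨w⟩^(-m)`, and the integral of `|v-w|^γ ⟨w⟩^(-m)` is at most a constant times
`⟨v⟩^(d+γ-m)`; multiplied by `N g(v)` this is `⟨v⟩^(d+γ) g(v)^2`. In the near zone a sign is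
available.

Landau: after integration by parts, `Q = a : D²g + c g`. At the contact point `D²g` is at most the
Hessian of the barrier. For `w` near, `|v-w|` is close to `⟨v⟩`, the diffusion contributes about
`-m(d-1)` and the reaction `(d-1)(d+γ)`, so the sum is nonpositive since `m > d+γ`
(`exists_landau_nearZone_nonpos`). The field `Π(z)e` is tangent to spheres, so integrating by parts
on balls gives no boundary term and needs no decay of `∇g`. The singularity of the kernel is removed
by a cutoff at scale `ε → 0`, which also treats the Coulomb case `γ = -d`.

Boltzmann: grazing angles are removed, and the estimate is uniform in the truncation. For fixed `σ`
the gain term is written in the variable `y = v - v_*'`; then `v' = v + h` with `h` orthogonal to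
`y`, and a reflection pairs `h` with `-h` (`lintegral_gain_le`). If `v_*'` is near, `⟨v ± h⟩` is
about `⟨v⟩/cos(θ/2)`, and the decay of the weight beats the Jacobian with a factor `cos²(θ/2)` to
spare (`near_pair_le`); the symmetric case, `v'` near, carries `sin²(θ/2)`, and the two add up to
the loss term. If both are far, the pair exceeds the loss only by `O(sin²(θ/2))`, which is
integrable against `b` (`exists_far_pair_le`). -/

open Filter Topology MeasureTheory

noncomputable section

namespace Kinetic

/-! ### Elementary properties of the weight. -/

section Bracket

variable {d : ℕ}

theorem bracket_sq (v : E d) : bracket v ^ 2 = 1 + ‖v‖ ^ 2 :=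
  Real.sq_sqrt (by positivity)

theorem one_le_bracket (v : E d) : 1 ≤ bracket v := by
  rw [bracket, Real.one_le_sqrt]
  nlinarith [sq_nonneg ‖v‖]

theorem bracket_pos (v : E d) : 0 < bracket v := one_pos.trans_le (one_le_bracket v)

theorem norm_le_bracket (v : E d) : ‖v‖ ≤ bracket v :=
  Real.le_sqrt_of_sq_le (by linarith)

theorem continuous_bracket : Continuous (bracket : E d → ℝ) := by
  unfold bracket
  fun_prop

theorem continuous_bracket_rpow (m : ℝ) : Continuous (fun v : E d => bracket v ^ m) :=
  continuous_bracket.rpow_const fun v => Or.inl (bracket_pos v).ne'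

theorem bracket_rpow_eq (v : E d) (m : ℝ) : bracket v ^ m = (1 + ‖v‖ ^ 2) ^ (m / 2) := by
  rw [← bracket_sq, ← Real.rpow_natCast, ← Real.rpow_mul (bracket_pos v).le]
  congr 1
  push_cast
  ring

end Bracket

/-! ### Convolutions of powers with the weight, restricted to the far zone. -/

section PowerIntegrals

/-- In polar coordinates the integrand is of order `y^(d-1+p)` at the origin and `y^(d-1+p-m)` at
infinity; the two hypotheses on the exponents are integrability at these two ends. -/
theorem integrable_norm_rpow_mul_one_add_norm {d : ℕ} (hd : 2 ≤ d) {p m : ℝ} (hp : -(d : ℝ) < p)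
    (hm : d + p < m) :
    Integrable (fun z : E d => ‖z‖ ^ p * (1 + ‖z‖) ^ (-m)) := by
  have : Nontrivial (E d) :=
    Module.nontrivial_of_finrank_pos (R := ℝ) (by rw [finrank_euclideanSpace_fin]; omega)
  rw [integrable_fun_norm_addHaar volume (f := fun y : ℝ => y ^ p * (1 + y) ^ (-m)),
    finrank_euclideanSpace_fin, ← Set.Ioc_union_Ioi_eq_Ioi zero_le_one, integrableOn_union]
  have hmeas : Measurable (fun y : ℝ => y ^ (d - 1) • (y ^ p * (1 + y) ^ (-m))) := by
    fun_prop
  have hpow : ∀ y : ℝ, 0 < y → y ^ (d - 1) * y ^ p = y ^ ((d : ℝ) - 1 + p) := by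
    intro y hy
    rw [← Real.rpow_natCast, ← Real.rpow_add hy, Nat.cast_sub (by omega), Nat.cast_one]
  have hm0 : 0 < m := by linarith
  constructor
  · have h : IntegrableOn (fun y : ℝ => y ^ ((d : ℝ) - 1 + p)) (Set.Ioc 0 1) := by
      rw [← intervalIntegrable_iff_integrableOn_Ioc_of_le zero_le_one]
      exact intervalIntegral.intervalIntegrable_rpow' (by linarith)
    refine Integrable.mono' h hmeas.aestronglyMeasurable ?_
    filter_upwards [ae_restrict_mem measurableSet_Ioc] with y hy
    have hy0 : 0 < y := hy.1
    rw [Real.norm_of_nonneg (by positivity), smul_eq_mul, ← mul_assoc, hpow y hy0]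
    refine mul_le_of_le_one_right (by positivity) ?_
    exact Real.rpow_le_one_of_one_le_of_nonpos (by linarith) (by linarith)
  · have h : IntegrableOn (fun y : ℝ => y ^ ((d : ℝ) - 1 + p - m)) (Set.Ioi 1) :=
      integrableOn_Ioi_rpow_of_lt (by linarith) one_pos
    refine Integrable.mono' h hmeas.aestronglyMeasurable ?_
    filter_upwards [ae_restrict_mem measurableSet_Ioi] with y hy
    have hy0 : 0 < y := one_pos.trans hy
    rw [Real.norm_of_nonneg (by positivity), smul_eq_mul, ← mul_assoc, hpow y hy0,
      sub_eq_add_neg _ m, Real.rpow_add hy0 _ (-m)]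
    gcongr ?_ * ?_
    exact Real.rpow_le_rpow_of_nonpos hy0 (by linarith) (by linarith)

/-- Scaling by `s`. With `s = bracket v` this produces the power of `bracket v` in the far-zone
bound. -/
theorem integral_norm_rpow_mul_add_norm {d : ℕ} {p m s : ℝ} (hs : 0 < s) :
    ∫ z : E d, ‖z‖ ^ p * (s + ‖z‖) ^ (-m) =
      s ^ (d + p - m) * ∫ z : E d, ‖z‖ ^ p * (1 + ‖z‖) ^ (-m) := by
  have h := Measure.integral_comp_smul (volume : Measure (E d))
    (fun z : E d => ‖z‖ ^ p * (s + ‖z‖) ^ (-m)) s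
  have h2 : ∀ z : E d, ‖s • z‖ ^ p * (s + ‖s • z‖) ^ (-m) =
      s ^ (p - m) * (‖z‖ ^ p * (1 + ‖z‖) ^ (-m)) := by
    intro z
    rw [norm_smul, Real.norm_of_nonneg hs.le, show s + s * ‖z‖ = s * (1 + ‖z‖) by ring,
      Real.mul_rpow hs.le (norm_nonneg _), Real.mul_rpow hs.le (by positivity), sub_eq_add_neg,
      Real.rpow_add hs]
    ring
  simp_rw [h2] at h
  rw [integral_const_mul, finrank_euclideanSpace_fin, smul_eq_mul,
    abs_of_nonneg (by positivity)] at h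
  have hsd : (s ^ d)⁻¹ * s ^ d = 1 := inv_mul_cancel₀ (by positivity)
  have h3 : s ^ (d + p - m) = s ^ d * s ^ (p - m) := by
    rw [← Real.rpow_natCast, ← Real.rpow_add hs]
    congr 1
    ring
  rw [h3, mul_assoc, h, ← mul_assoc, mul_comm (s ^ d), hsd, one_mul]

theorem integrable_norm_rpow_mul_add_norm {d : ℕ} (hd : 2 ≤ d) {p m s : ℝ} (hp : -(d : ℝ) < p)
    (hm : d + p < m) (hs : 0 < s) :
    Integrable (fun z : E d => ‖z‖ ^ p * (s + ‖z‖) ^ (-m)) := by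
  have h := integrable_norm_rpow_mul_one_add_norm hd hp hm
  rw [← integrable_comp_smul_iff volume _ hs.ne']
  refine (h.const_mul (s ^ (p - m))).congr (ae_of_all _ fun z => ?_)
  simp only
  rw [norm_smul, Real.norm_of_nonneg hs.le, show s + s * ‖z‖ = s * (1 + ‖z‖) by ring,
    Real.mul_rpow hs.le (norm_nonneg _), Real.mul_rpow hs.le (by positivity), sub_eq_add_neg,
    Real.rpow_add hs]
  ring

/-- The velocities `w` that are not small compared with `v`. -/
def farZone {d : ℕ} (δ : ℝ) (v : E d) : Set (E d) := {w | δ * bracket v ≤ bracket w}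

theorem measurableSet_farZone {d : ℕ} (δ : ℝ) (v : E d) : MeasurableSet (farZone δ v) :=
  measurableSet_le measurable_const continuous_bracket.measurable

/-- In the far zone `bracket w` controls `bracket v`, hence also `‖v - w‖`, so the weight can be
replaced by a function centred at `v`. -/
theorem bracket_rpow_neg_le_of_mem_farZone {d : ℕ} {m δ : ℝ} (hm : 0 ≤ m) (hδ : 0 < δ) {v w : E d}
    (hw : w ∈ farZone δ v) :
    bracket w ^ (-m) ≤ (2 / δ + 1) ^ m * (bracket v + ‖v - w‖) ^ (-m) := by
  have h1 : bracket v + ‖v - w‖ ≤ (2 / δ + 1) * bracket w := by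
    have h2 : bracket v ≤ bracket w / δ := by
      rw [le_div_iff₀ hδ, mul_comm]
      exact hw
    have h3 := norm_sub_le v w
    have h4 := norm_le_bracket v
    have h5 := norm_le_bracket w
    calc bracket v + ‖v - w‖ ≤ 2 * (bracket w / δ) + bracket w := by linarith
      _ = _ := by ring
  have hp : 0 < bracket v + ‖v - w‖ := by have := bracket_pos v; positivity
  have hw0 := bracket_pos w
  rw [Real.rpow_neg hw0.le, Real.rpow_neg hp.le, ← div_eq_mul_inv, inv_le_comm₀ (by positivity)
    (by positivity), inv_div, div_le_iff₀ (by positivity), mul_comm,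
    ← Real.mul_rpow (by positivity) hw0.le]
  exact Real.rpow_le_rpow hp.le h1 hm

/-- For `p = γ`, multiplying by `N * g v` with `g v = N * bracket v ^ (-m)` turns the right side
into `C * bracket v ^ (d + γ) * g v ^ 2`, the form required of a touching estimate. -/
theorem exists_integral_farZone_le {d : ℕ} (hd : 2 ≤ d) {p m δ : ℝ} (hp : -(d : ℝ) < p)
    (hm : d + p < m) (hδ : 0 < δ) :
    ∃ C : ℝ, 0 < C ∧ ∀ v : E d,
      IntegrableOn (fun w => ‖v - w‖ ^ p * bracket w ^ (-m)) (farZone δ v) ∧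
      ∫ w in farZone δ v, ‖v - w‖ ^ p * bracket w ^ (-m) ≤ C * bracket v ^ (d + p - m) := by
  set I := ∫ z : E d, ‖z‖ ^ p * (1 + ‖z‖) ^ (-m) with hI
  have hI0 : 0 ≤ I := integral_nonneg fun z => by positivity
  have hm0 : 0 ≤ m := by linarith
  set c := (2 / δ + 1) ^ m with hc
  have hc0 : 0 < c := by positivity
  refine ⟨c * I + 1, by positivity, fun v => ?_⟩
  have hv := bracket_pos v
  have hint : Integrable (fun w : E d => c * (‖v - w‖ ^ p * (bracket v + ‖v - w‖) ^ (-m))) :=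
    ((integrable_norm_rpow_mul_add_norm hd hp hm hv).comp_sub_left v).const_mul c
  have hle : ∀ w ∈ farZone δ v, ‖v - w‖ ^ p * bracket w ^ (-m) ≤
      c * (‖v - w‖ ^ p * (bracket v + ‖v - w‖) ^ (-m)) := by
    intro w hw
    have := bracket_rpow_neg_le_of_mem_farZone hm0 hδ hw
    calc _ ≤ ‖v - w‖ ^ p * (c * (bracket v + ‖v - w‖) ^ (-m)) := by gcongr
      _ = _ := by ring
  have hmeas : Measurable fun w : E d => ‖v - w‖ ^ p * bracket w ^ (-m) := by
    have := (continuous_bracket_rpow (d := d) (-m)).measurable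
    fun_prop
  have hfar : IntegrableOn (fun w => ‖v - w‖ ^ p * bracket w ^ (-m)) (farZone δ v) := by
    refine Integrable.mono' hint.integrableOn hmeas.aestronglyMeasurable ?_
    filter_upwards [ae_restrict_mem (measurableSet_farZone δ v)] with w hw
    rw [Real.norm_of_nonneg (by have := bracket_pos w; positivity)]
    exact hle w hw
  refine ⟨hfar, ?_⟩
  calc ∫ w in farZone δ v, ‖v - w‖ ^ p * bracket w ^ (-m)
      ≤ ∫ w in farZone δ v, c * (‖v - w‖ ^ p * (bracket v + ‖v - w‖) ^ (-m)) :=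
        setIntegral_mono_on hfar hint.integrableOn (measurableSet_farZone δ v) hle
    _ ≤ ∫ w : E d, c * (‖v - w‖ ^ p * (bracket v + ‖v - w‖) ^ (-m)) :=
        setIntegral_le_integral hint (ae_of_all _ fun w => by positivity)
    _ = c * (bracket v ^ (d + p - m) * I) := by
        rw [integral_const_mul,
          integral_sub_left_eq_self (fun z : E d => ‖z‖ ^ p * (bracket v + ‖z‖) ^ (-m)) volume v,
          integral_norm_rpow_mul_add_norm hv]
    _ ≤ (c * I + 1) * bracket v ^ (d + p - m) := by
        have : 0 < bracket v ^ (d + p - m) := by positivity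
        nlinarith

theorem integrable_norm_sub_rpow_mul_bracket {d : ℕ} (hd : 2 ≤ d) {p m : ℝ} (hp : -(d : ℝ) < p)
    (hm : d + p < m) (v : E d) :
    Integrable (fun w => ‖v - w‖ ^ p * bracket w ^ (-m)) := by
  -- With `δ = 1 / bracket v` the far zone is the whole space, since brackets are at least `1`.
  obtain ⟨C, -, h⟩ := exists_integral_farZone_le hd hp hm (inv_pos.2 (bracket_pos v))
  have := (h v).1
  rwa [show farZone (bracket v)⁻¹ v = Set.univ from Set.eq_univ_of_forall fun w => by
    simp only [farZone, Set.mem_ofPred_eq, inv_mul_cancel₀ (bracket_pos v).ne']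
    exact one_le_bracket w, integrableOn_univ] at this

end PowerIntegrals

/-! ### The maximum principle: from touching points to the a priori estimate. -/

section Comparison

theorem wnorm_le_ofReal_iff {X : Type} {d : ℕ} {k c : ℝ} (hc : 0 ≤ c) {g : X → E d → ℝ} :
    wnorm k g ≤ ENNReal.ofReal c ↔ ∀ x v, bracket v ^ k * |g x v| ≤ c := by
  simp only [wnorm, iSup_le_iff, ENNReal.ofReal_le_ofReal_iff hc]

theorem le_toReal_wnorm {X : Type} {d : ℕ} {k : ℝ} {g : X → E d → ℝ} (hg : wnorm k g < ⊤)
    (x : X) (v : E d) : bracket v ^ k * |g x v| ≤ (wnorm k g).toReal := by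
  refine (wnorm_le_ofReal_iff ENNReal.toReal_nonneg).1 ?_ x v
  rw [ENNReal.ofReal_toReal hg.ne]

/-- A family `f` of nonnegative functions, continuous on `[0, T]`, for which the weighted function
`⟨v⟩^k f` vanishes at infinity uniformly in time. -/
structure IsUniformlyVanishing {X : Type} [TopologicalSpace X] {d : ℕ} (k T : ℝ)
    (f : ℝ → X → E d → ℝ) : Prop where
  nonneg : ∀ t ∈ Set.Icc 0 T, ∀ x v, 0 ≤ f t x v
  continuousOn : ContinuousOn (fun p : ℝ × X × E d => bracket p.2.2 ^ k * f p.1 p.2.1 p.2.2)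
    (Set.Icc 0 T ×ˢ Set.univ)
  vanishing : ∀ η > 0, ∃ K : Set (X × E d), IsCompact K ∧ ∀ t ∈ Set.Icc 0 T, ∀ p ∉ K,
    bracket p.2 ^ k * f t p.1 p.2 ≤ η

variable {X : Type} [TopologicalSpace X] {d : ℕ}

theorem IsSolution.isUniformlyVanishing {shift : X → E d → X}
    {Q : (E d → ℝ) → E d → ℝ → Prop} {m T : ℝ} {fin : X → E d → ℝ} {f : ℝ → X → E d → ℝ}
    (hf : IsSolution shift Q m T fin f) {k : ℝ} (hk : k ≤ m) :
    IsUniformlyVanishing k T f where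
  nonneg := hf.nonneg
  continuousOn := by
    refine ContinuousOn.mul ?_ hf.continuousOn
    exact ((continuous_bracket_rpow k).comp (by fun_prop)).continuousOn
  vanishing := by
    intro η hη
    obtain ⟨ε, hε, h⟩ := hf.decay_v
    obtain ⟨R, hR⟩ := h η hη
    obtain ⟨K, hK, hKx⟩ := hf.decay_x η hη
    refine ⟨K ×ˢ Metric.closedBall 0 R, hK.prod (isCompact_closedBall _ _), ?_⟩
    rintro t ht ⟨x, v⟩ hp
    have hmono : ∀ k' : ℝ, k ≤ k' → bracket v ^ k' * f t x v ≤ η →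
        bracket v ^ k * f t x v ≤ η := by
      intro k' hk' h
      refine le_trans ?_ h
      exact mul_le_mul_of_nonneg_right (Real.rpow_le_rpow_of_exponent_le (one_le_bracket v) hk')
        (hf.nonneg t ht x v)
    by_cases hx : x ∈ K
    · have hv : v ∉ Metric.closedBall 0 R := fun hv => hp ⟨hx, hv⟩
      rw [mem_closedBall_zero_iff, not_le] at hv
      exact hmono _ (by linarith) (hR t ht x v hv.le)
    · exact hmono _ hk (hKx t ht x hx v)

namespace IsUniformlyVanishing

variable {k T : ℝ} {f : ℝ → X → E d → ℝ}

/-- Off a compact set both terms are at most `η` and nonnegative; on the compact set the tube lemma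
makes continuity in time uniform. -/
theorem eventually_forall_abs_sub_le (hf : IsUniformlyVanishing k T f) {t₀ : ℝ}
    (ht₀ : t₀ ∈ Set.Icc 0 T) {η : ℝ} (hη : 0 < η) :
    ∀ᶠ t in 𝓝[Set.Icc 0 T] t₀, ∀ x v,
      |bracket v ^ k * f t x v - bracket v ^ k * f t₀ x v| ≤ η := by
  obtain ⟨K, hK, hKη⟩ := hf.vanishing η hη
  have hcont : Continuous (fun q : Set.Icc (0 : ℝ) T × X × E d =>
      bracket q.2.2 ^ k * f q.1 q.2.1 q.2.2) :=
    hf.continuousOn.comp_continuous (f := fun q : Set.Icc (0 : ℝ) T × X × E d =>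
      ((q.1 : ℝ), q.2)) (by fun_prop) fun q => ⟨q.1.2, Set.mem_univ _⟩
  have hcont₀ : Continuous (fun q : Set.Icc (0 : ℝ) T × X × E d =>
      bracket q.2.2 ^ k * f t₀ q.2.1 q.2.2) :=
    hf.continuousOn.comp_continuous (f := fun q : Set.Icc (0 : ℝ) T × X × E d =>
      (t₀, q.2)) (by fun_prop) fun q => ⟨ht₀, Set.mem_univ _⟩
  have h := hK.eventually_forall_of_forall_eventually (x₀ := (⟨t₀, ht₀⟩ : Set.Icc (0 : ℝ) T))
    (P := fun t p => |bracket p.2 ^ k * f t p.1 p.2 - bracket p.2 ^ k * f t₀ p.1 p.2| < η)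
    (fun p _ => (hcont.sub hcont₀).abs.continuousAt.eventually_lt continuousAt_const (by
      simpa using hη))
  rw [nhdsWithin_eq_map_subtype_coe ht₀, eventually_map]
  filter_upwards [h] with t ht x v
  by_cases hp : (x, v) ∈ K
  · exact (ht (x, v) hp).le
  · have h1 := hKη t t.2 _ hp
    have h2 := hKη t₀ ht₀ _ hp
    have h3 := hf.nonneg t t.2 x v
    have h4 := hf.nonneg t₀ ht₀ x v
    have h5 : 0 < bracket v ^ k := Real.rpow_pos_of_pos (bracket_pos v) k
    rw [abs_sub_le_iff]
    constructor <;> nlinarith [mul_nonneg h5.le h3, mul_nonneg h5.le h4]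

theorem wnorm_lt_top (hf : IsUniformlyVanishing k T f) {t : ℝ} (ht : t ∈ Set.Icc 0 T) :
    wnorm k (f t) < ⊤ := by
  obtain ⟨K, hK, hKη⟩ := hf.vanishing 1 one_pos
  have hcont : Continuous (fun q : X × E d => bracket q.2 ^ k * f t q.1 q.2) :=
    hf.continuousOn.comp_continuous (f := fun q : X × E d => (t, q)) (by fun_prop)
      fun q => ⟨ht, Set.mem_univ _⟩
  obtain ⟨c, hc⟩ := (hK.image hcont).bddAbove
  refine lt_of_le_of_lt ((wnorm_le_ofReal_iff (c := max c 1) (by positivity)).2 ?_)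
    ENNReal.ofReal_lt_top
  intro x v
  rw [abs_of_nonneg (hf.nonneg t ht x v)]
  by_cases hp : (x, v) ∈ K
  · exact (hc ⟨_, hp, rfl⟩).trans (le_max_left _ _)
  · exact (hKη t ht _ hp).trans (le_max_right _ _)

theorem le_toReal_wnorm (hf : IsUniformlyVanishing k T f) {t : ℝ} (ht : t ∈ Set.Icc 0 T) (x : X)
    (v : E d) : bracket v ^ k * f t x v ≤ (wnorm k (f t)).toReal := by
  have := Kinetic.le_toReal_wnorm (hf.wnorm_lt_top ht) x v
  rwa [abs_of_nonneg (hf.nonneg t ht x v)] at this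

theorem toReal_wnorm_le (hf : IsUniformlyVanishing k T f) {t c : ℝ} (ht : t ∈ Set.Icc 0 T)
    (hc : 0 ≤ c) (h : ∀ x v, bracket v ^ k * f t x v ≤ c) : (wnorm k (f t)).toReal ≤ c := by
  refine ENNReal.toReal_le_of_le_ofReal hc ((wnorm_le_ofReal_iff hc).2 fun x v => ?_)
  rw [abs_of_nonneg (hf.nonneg t ht x v)]
  exact h x v

theorem continuousOn_toReal_wnorm (hf : IsUniformlyVanishing k T f) :
    ContinuousOn (fun t => (wnorm k (f t)).toReal) (Set.Icc 0 T) := by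
  intro t₀ ht₀
  refine Metric.tendsto_nhds.2 fun η hη => ?_
  filter_upwards [hf.eventually_forall_abs_sub_le ht₀ (half_pos hη), self_mem_nhdsWithin]
    with t ht htT
  rw [Real.dist_eq]
  refine lt_of_le_of_lt ?_ (half_lt_self hη)
  rw [abs_sub_le_iff, sub_le_iff_le_add, sub_le_iff_le_add]
  constructor
  · refine hf.toReal_wnorm_le htT (by positivity) fun x v => ?_
    have h1 := (abs_sub_le_iff.1 (ht x v)).1
    have h2 := hf.le_toReal_wnorm ht₀ x v
    linarith
  · refine hf.toReal_wnorm_le ht₀ (by positivity) fun x v => ?_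
    have h1 := (abs_sub_le_iff.1 (ht x v)).2
    have h2 := hf.le_toReal_wnorm htT x v
    linarith

/-- The weighted function is at most half the supremum off a compact set, so the supremum is a
maximum over that set. This supplies the contact point. -/
theorem exists_eq_toReal_wnorm (hf : IsUniformlyVanishing k T f) {t : ℝ} (ht : t ∈ Set.Icc 0 T)
    (hpos : 0 < (wnorm k (f t)).toReal) :
    ∃ x v, bracket v ^ k * f t x v = (wnorm k (f t)).toReal := by
  set B := (wnorm k (f t)).toReal with hB
  obtain ⟨K, hK, hKη⟩ := hf.vanishing (B / 2) (half_pos hpos)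
  have hcont : Continuous (fun q : X × E d => bracket q.2 ^ k * f t q.1 q.2) :=
    hf.continuousOn.comp_continuous (f := fun q : X × E d => (t, q)) (by fun_prop)
      fun q => ⟨ht, Set.mem_univ _⟩
  have hne : ∃ p : X × E d, B / 2 < bracket p.2 ^ k * f t p.1 p.2 := by
    by_contra! h
    have := hf.toReal_wnorm_le ht (half_pos hpos).le fun x v => h (x, v)
    linarith
  obtain ⟨p₀, hp₀⟩ := hne
  have hp₀K : p₀ ∈ K := by
    by_contra h
    exact absurd (hKη t ht p₀ h) (not_le.2 hp₀)
  obtain ⟨p, hp, hmax⟩ := hK.exists_isMaxOn ⟨p₀, hp₀K⟩ hcont.continuousOn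
  rw [isMaxOn_iff] at hmax
  refine ⟨p.1, p.2, le_antisymm (hf.le_toReal_wnorm ht _ _) ?_⟩
  have hp2 : B / 2 < bracket p.2 ^ k * f t p.1 p.2 := hp₀.trans_le (hmax p₀ hp₀K)
  refine hf.toReal_wnorm_le ht (by linarith) fun x v => ?_
  by_cases hq : (x, v) ∈ K
  · exact hmax (x, v) hq
  · exact (hKη t ht _ hq).trans hp2.le

end IsUniformlyVanishing

/-- The estimate of a collision operator at a point where `g` touches a multiple of `⟨·⟩^{-m}` from
below. -/
def TouchingEstimate {d : ℕ} (Q : (E d → ℝ) → E d → ℝ → Prop) (γ m C : ℝ) : Prop :=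
  ∀ (g : E d → ℝ) (N : ℝ) (v : E d) (q : ℝ), ContDiff ℝ 2 g → (∀ w, 0 ≤ g w) → 0 < N →
    (∀ w, g w ≤ N * bracket w ^ (-m)) → g v = N * bracket v ^ (-m) → Q g v q →
    q ≤ C * bracket v ^ (d + γ) * g v ^ 2

/-- Before a first contact time only earlier times are controlled, hence the left difference
quotients. -/
theorem deriv_nonneg_of_touching_left {u : ℝ → ℝ} {u' a t : ℝ} (hat : a < t)
    (hu : HasDerivAt u u' t) (h0 : u t = 0) (hle : ∀ s ∈ Set.Ioo a t, u s ≤ 0) : 0 ≤ u' := by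
  have h := (hasDerivAt_iff_tendsto_slope.1 hu).mono_left
    (nhdsWithin_mono t (show Set.Iio t ⊆ {t}ᶜ from fun s hs => ne_of_lt hs))
  refine ge_of_tendsto h ?_
  filter_upwards [Ioo_mem_nhdsLT hat] with s hs
  rw [slope_def_field, h0, sub_zero]
  exact div_nonneg_of_nonpos (hle s hs) (by linarith [hs.2])

/-- The slack `κ` has two roles: in the prefactor it puts the barrier strictly above the initial
norm, and in the exponent it makes the growth rate of the barrier strictly larger than `C * A` at
the contact time. The final time is excluded because the equation is only available in the open
interval. -/
theorem toReal_wnorm_lt_barrier {shift : X → E d → X}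
    (hshift : ∀ x, shift x 0 = x) {Q : (E d → ℝ) → E d → ℝ → Prop} {γ m C : ℝ} (hC : 0 < C)
    (hm : d + γ ≤ m) (hQ : TouchingEstimate Q γ m C) {T : ℝ} {fin : X → E d → ℝ}
    {f : ℝ → X → E d → ℝ} (hf : IsSolution shift Q m T fin f) {κ : ℝ} (hκ : 0 < κ) :
    ∀ t ∈ Set.Ico 0 T, (wnorm m (f t)).toReal < ((wnorm m (f 0)).toReal + κ) *
      Real.exp (C * (∫ s in (0 : ℝ)..t, (wnorm (d + γ) (f s)).toReal) + κ * t) := by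
  intro t₁ ht₁
  have hT0 : 0 < T := ht₁.1.trans_lt ht₁.2
  have hfm := hf.isUniformlyVanishing le_rfl
  have hfA := hf.isUniformlyVanishing hm
  set A : ℝ → ℝ := fun s => (wnorm (d + γ) (f s)).toReal with hA
  set M : ℝ → ℝ := fun s => (wnorm m (f s)).toReal with hM
  have hAc : ContinuousOn A (Set.Icc 0 T) := hfA.continuousOn_toReal_wnorm
  have hMc : ContinuousOn M (Set.Icc 0 T) := hfm.continuousOn_toReal_wnorm
  set B : ℝ → ℝ := fun t => (M 0 + κ) * Real.exp (C * (∫ s in (0 : ℝ)..t, A s) + κ * t) with hB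
  have hM0 : 0 ≤ M 0 := ENNReal.toReal_nonneg
  have hBpos : ∀ t, 0 < B t := fun t => by positivity
  have hBc : ContinuousOn B (Set.Icc 0 T) := by
    have h1 : ContinuousOn (fun t => ∫ s in (0 : ℝ)..t, A s) (Set.Icc 0 T) := by
      have := intervalIntegral.continuousOn_primitive_interval (μ := volume)
        (f := A) (a := 0) (b := T) (by
          rw [Set.uIcc_of_le hT0.le]
          exact hAc.integrableOn_Icc)
      rwa [Set.uIcc_of_le hT0.le] at this
    fun_prop
  change M t₁ < B t₁
  by_contra! hcon
  -- The contact times form a compact set; its least element is the first contact time.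
  set S : Set ℝ := {t ∈ Set.Icc 0 t₁ | B t ≤ M t} with hS
  have hsub : Set.Icc 0 t₁ ⊆ Set.Icc 0 T := Set.Icc_subset_Icc_right ht₁.2.le
  have hScl : IsClosed S :=
    isClosed_Icc.isClosed_le (hBc.mono hsub) (hMc.mono hsub)
  have hSc : IsCompact S := isCompact_Icc.of_isClosed_subset hScl fun t ht => ht.1
  obtain ⟨t₀, ht₀, hmin⟩ := hSc.exists_isLeast ⟨t₁, ⟨ht₁.1, le_rfl⟩, hcon⟩
  have hlt : ∀ t ∈ Set.Ico 0 t₀, M t < B t := by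
    intro t ht
    by_contra! h
    exact absurd (hmin ⟨⟨ht.1, ht.2.le.trans ht₀.1.2⟩, h⟩) (not_le.2 ht.2)
  have ht₀T : t₀ ∈ Set.Icc 0 T := hsub ht₀.1
  have h0lt : M 0 < B 0 := by simp [hB, hκ]
  have ht₀pos : 0 < t₀ := by
    rcases ht₀.1.1.eq_or_lt with h | h
    · exact absurd ht₀.2 (not_le.2 (h ▸ h0lt))
    · exact h
  have ht₀Ioo : t₀ ∈ Set.Ioo 0 T := ⟨ht₀pos, ht₀.1.2.trans_lt ht₁.2⟩
  have hMB : M t₀ = B t₀ := by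
    refine le_antisymm ?_ ht₀.2
    have hcl : t₀ ∈ closure (Set.Ico 0 t₀) := by
      rw [closure_Ico ht₀pos.ne]
      exact ⟨ht₀pos.le, le_rfl⟩
    have hss : Set.Ico 0 t₀ ⊆ Set.Icc 0 T := fun t ht => ⟨ht.1, ht.2.le.trans ht₀T.2⟩
    have := mem_closure_iff_nhdsWithin_neBot.1 hcl
    exact le_of_tendsto_of_tendsto ((hMc t₀ ht₀T).mono hss) ((hBc t₀ ht₀T).mono hss)
      (eventually_nhdsWithin_of_forall fun t ht => (hlt t ht).le)
  obtain ⟨x, v, hxv⟩ := hfm.exists_eq_toReal_wnorm ht₀T (by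
    change 0 < M t₀
    rw [hMB]; exact hBpos t₀)
  change bracket v ^ m * f t₀ x v = M t₀ at hxv
  rw [hMB] at hxv
  have hb := bracket_pos v
  have hinv : ∀ w : E d, bracket w ^ m * bracket w ^ (-m) = 1 := fun w => by
    rw [← Real.rpow_add (bracket_pos w), add_neg_cancel, Real.rpow_zero]
  obtain ⟨D, -, hD⟩ := hf.equation
  obtain ⟨hDeriv, hQv⟩ := hD t₀ ht₀Ioo x v
  have hval : f t₀ x v = B t₀ * bracket v ^ (-m) := by
    rw [← hxv, mul_right_comm, hinv, one_mul]
  have key := hQ (f t₀ x) (B t₀) v (D t₀ x v) (hf.contDiff t₀ ht₀Ioo x) (hf.nonneg t₀ ht₀T x)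
    (hBpos t₀) (fun w => by
      have h := hfm.le_toReal_wnorm ht₀T x w
      change _ ≤ M t₀ at h
      rw [hMB] at h
      have hw : 0 < bracket w ^ (-m) := Real.rpow_pos_of_pos (bracket_pos w) _
      calc f t₀ x w = (bracket w ^ m * f t₀ x w) * bracket w ^ (-m) := by
            rw [mul_right_comm, hinv, one_mul]
        _ ≤ B t₀ * bracket w ^ (-m) := by gcongr) hval hQv
  have hAt₀ : bracket v ^ (d + γ) * f t₀ x v ≤ A t₀ := hfA.le_toReal_wnorm ht₀T x v
  have hBderiv : HasDerivAt B (B t₀ * (C * A t₀ + κ)) t₀ := by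
    have hcA : ContinuousAt A t₀ := hAc.continuousAt (Icc_mem_nhds ht₀Ioo.1 ht₀Ioo.2)
    have h1 : HasDerivAt (fun t => ∫ s in (0 : ℝ)..t, A s) (A t₀) t₀ := by
      refine intervalIntegral.integral_hasDerivAt_right ?_ ?_ hcA
      · refine (hAc.mono ?_).intervalIntegrable
        rw [Set.uIcc_of_le ht₀pos.le]
        exact Set.Icc_subset_Icc_right ht₀T.2
      · exact (hAc.mono Set.Ioo_subset_Icc_self).stronglyMeasurableAtFilter isOpen_Ioo t₀ ht₀Ioo
    have h2 := (((h1.const_mul C).add ((hasDerivAt_id t₀).const_mul κ)).exp).const_mul (M 0 + κ)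
    refine h2.congr_deriv ?_
    simp only [hB, id, Pi.add_apply]
    ring
  -- Along free transport the velocity is fixed, so the weight is a constant factor and only the
  -- transport derivative appears.
  have hu := (hDeriv.const_mul (bracket v ^ m)).sub hBderiv
  have hnonneg := deriv_nonneg_of_touching_left ht₀pos hu (by
      simp only [Pi.sub_apply, sub_self, zero_smul, hshift]
      linarith) (by
      intro s hs
      have hsT : s ∈ Set.Icc 0 T := ⟨hs.1.le, hs.2.le.trans ht₀T.2⟩
      have h1 := hfm.le_toReal_wnorm hsT (shift x ((s - t₀) • v)) v
      have h2 := hlt s ⟨hs.1.le, hs.2⟩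
      simp only [Pi.sub_apply]
      change _ ≤ M s at h1
      linarith)
  -- Of the two factors `f t₀ x v`, one takes the weight `d + γ` and is bounded by `A t₀`; the other
  -- takes the weight `m` and equals the barrier.
  have h3 : bracket v ^ m * D t₀ x v ≤ C * A t₀ * B t₀ := by
    have hf0 := hf.nonneg t₀ ht₀T x v
    calc bracket v ^ m * D t₀ x v
        ≤ bracket v ^ m * (C * bracket v ^ (d + γ) * f t₀ x v ^ 2) := by gcongr
      _ = C * (bracket v ^ (d + γ) * f t₀ x v) * (bracket v ^ m * f t₀ x v) := by ring
      _ ≤ C * A t₀ * (bracket v ^ m * f t₀ x v) := by gcongr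
      _ = C * A t₀ * B t₀ := by rw [hxv]
  have h4 : 0 < κ * B t₀ := mul_pos hκ (hBpos t₀)
  nlinarith

/-- A maximum principle: an estimate at touching points implies the a priori estimate. -/
theorem aprioriEstimate_of_touchingEstimate {shift : X → E d → X} (hshift : ∀ x, shift x 0 = x)
    {Q : (E d → ℝ) → E d → ℝ → Prop} {γ m C : ℝ} (hC : 0 < C) (hm : d + γ ≤ m)
    (hQ : TouchingEstimate Q γ m C) : AprioriEstimate shift Q γ m C := by
  intro T fin f hT _ hf
  have hfm := hf.isUniformlyVanishing le_rfl
  have hfA := hf.isUniformlyVanishing hm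
  have hAc := hfA.continuousOn_toReal_wnorm
  have hMc := hfm.continuousOn_toReal_wnorm
  refine ⟨fun s hs => hfA.wnorm_lt_top hs, ?_, ?_⟩
  · refine ContinuousOn.intervalIntegrable ?_
    rwa [Set.uIcc_of_le hT.le]
  have hfin : fin = f 0 := by
    funext x v
    exact (hf.initial x v).symm
  have hprim : ContinuousOn (fun t => ∫ s in (0 : ℝ)..t, (wnorm (d + γ) (f s)).toReal)
      (Set.Icc 0 T) := by
    have := intervalIntegral.continuousOn_primitive_interval (μ := volume)
      (f := fun s => (wnorm (d + γ) (f s)).toReal) (a := 0) (b := T) (by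
        rw [Set.uIcc_of_le hT.le]
        exact hAc.integrableOn_Icc)
    rwa [Set.uIcc_of_le hT.le] at this
  have hIco : ∀ t ∈ Set.Ico 0 T, (wnorm m (f t)).toReal ≤ (wnorm m (f 0)).toReal *
      Real.exp (C * ∫ s in (0 : ℝ)..t, (wnorm (d + γ) (f s)).toReal) := by
    intro t ht
    have hlim : Tendsto (fun κ : ℝ => ((wnorm m (f 0)).toReal + κ) *
        Real.exp (C * (∫ s in (0 : ℝ)..t, (wnorm (d + γ) (f s)).toReal) + κ * t)) (𝓝[>] 0)
        (𝓝 (((wnorm m (f 0)).toReal + 0) *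
          Real.exp (C * (∫ s in (0 : ℝ)..t, (wnorm (d + γ) (f s)).toReal) + 0 * t))) := by
      refine Tendsto.mono_left ?_ nhdsWithin_le_nhds
      exact (by fun_prop : Continuous fun κ : ℝ => ((wnorm m (f 0)).toReal + κ) *
        Real.exp (C * (∫ s in (0 : ℝ)..t, (wnorm (d + γ) (f s)).toReal) + κ * t)).tendsto 0
    rw [add_zero, zero_mul, add_zero] at hlim
    refine ge_of_tendsto hlim ?_
    filter_upwards [self_mem_nhdsWithin] with κ hκ
    exact (toReal_wnorm_lt_barrier hshift hC hm hQ hf hκ t ht).le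
  -- The final time is recovered by continuity of both sides.
  have hIcc : ∀ t ∈ Set.Icc 0 T, (wnorm m (f t)).toReal ≤ (wnorm m (f 0)).toReal *
      Real.exp (C * ∫ s in (0 : ℝ)..t, (wnorm (d + γ) (f s)).toReal) := by
    intro t ht
    have hcl : t ∈ closure (Set.Ico 0 T) := by rwa [closure_Ico hT.ne]
    have := mem_closure_iff_nhdsWithin_neBot.1 hcl
    have hrhs : ContinuousOn (fun t => (wnorm m (f 0)).toReal *
      Real.exp (C * ∫ s in (0 : ℝ)..t, (wnorm (d + γ) (f s)).toReal)) (Set.Icc 0 T) := by fun_prop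
    exact le_of_tendsto_of_tendsto ((hMc t ht).mono Set.Ico_subset_Icc_self)
      ((hrhs t ht).mono Set.Ico_subset_Icc_self) (eventually_nhdsWithin_of_forall hIco)
  intro t ht
  have h0T : (0 : ℝ) ∈ Set.Icc 0 T := ⟨le_rfl, hT.le⟩
  rw [hfin, ← ENNReal.ofReal_toReal (hfm.wnorm_lt_top ht).ne,
    ← ENNReal.ofReal_toReal (hfm.wnorm_lt_top h0T).ne, ← ENNReal.ofReal_mul ENNReal.toReal_nonneg]
  exact ENNReal.ofReal_le_ofReal (hIcc t ht)

end Comparison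

/-! ### Traces and the polynomial projection `|z|² Π(z)`. -/

section TraceAndProjection

variable {d : ℕ}

/-- The trace of an endomorphism of `ℝ^d`. -/
def trc : (E d →L[ℝ] E d) →L[ℝ] ℝ :=
  ∑ i : Fin d, (EuclideanSpace.proj i : E d →L[ℝ] ℝ).comp
    (ContinuousLinearMap.apply ℝ (E d) (EuclideanSpace.single i 1 : E d))

theorem trc_apply (A : E d →L[ℝ] E d) :
    trc A = ∑ i : Fin d, (A (EuclideanSpace.single i 1)) i := by
  simp [trc]

theorem sum_smul_single (b : E d) : ∑ i : Fin d, b i • (EuclideanSpace.single i 1 : E d) = b := by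
  have := (EuclideanSpace.basisFun (Fin d) ℝ).sum_repr b
  simpa using this

theorem trc_smulRight (l : E d →L[ℝ] ℝ) (b : E d) : trc (l.smulRight b) = l b := by
  conv_rhs => rw [← sum_smul_single b, map_sum]
  rw [trc_apply]
  refine Finset.sum_congr rfl fun i _ => ?_
  simp [mul_comm]

theorem trc_id : trc (ContinuousLinearMap.id ℝ (E d)) = d := by
  simp [trc_apply]

theorem abs_trc_le (A : E d →L[ℝ] E d) : |trc A| ≤ d * ‖A‖ := by
  rw [trc_apply]
  refine (Finset.abs_sum_le_sum_abs _ _).trans ?_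
  have : ∀ i ∈ Finset.univ, |(A (EuclideanSpace.single i 1)) i| ≤ ‖A‖ := by
    intro i _
    have h1 := PiLp.norm_apply_le (A (EuclideanSpace.single i 1)) i
    have h2 := A.le_opNorm (EuclideanSpace.single i 1)
    rw [PiLp.norm_single, norm_one, mul_one] at h2
    exact h1.trans h2
  simpa using Finset.sum_le_sum this

theorem trc_eq_sum_inner (A : E d →L[ℝ] E d) :
    trc A = ∑ i : Fin d, inner ℝ (EuclideanSpace.single i 1 : E d) (A (EuclideanSpace.single i 1)) := by
  simp [trc_apply, EuclideanSpace.inner_single_left]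

/-- A Lagrange identity: the trace of `|z|² Π(z) A` is half the sum of the quadratic form of `A`
over the vectors `z_i e_j - z_j e_i`. Since `A` is not assumed symmetric, the symmetry of Hessians
is never needed. -/
theorem norm_sq_mul_trc_sub_inner (A : E d →L[ℝ] E d) (z : E d) :
    ‖z‖ ^ 2 * trc A - inner ℝ z (A z) = (1 / 2 : ℝ) * ∑ i : Fin d, ∑ j : Fin d,
      inner ℝ (z i • (EuclideanSpace.single j 1 : E d) - z j • (EuclideanSpace.single i 1 : E d))
        (A (z i • (EuclideanSpace.single j 1 : E d) - z j • (EuclideanSpace.single i 1 : E d))) := by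
  have hz : inner ℝ z (A z) = ∑ i : Fin d, ∑ j : Fin d, z i * (z j *
      inner ℝ (EuclideanSpace.single i 1 : E d) (A (EuclideanSpace.single j 1))) := by
    conv_lhs => rw [← sum_smul_single z]
    simp only [map_sum, map_smul, sum_inner, inner_sum, real_inner_smul_left, real_inner_smul_right]
    rw [Finset.sum_comm]
    refine Finset.sum_congr rfl fun i _ => Finset.sum_congr rfl fun j _ => ?_
    ring
  have hn : ‖z‖ ^ 2 * trc A = ∑ i : Fin d, ∑ j : Fin d, z i ^ 2 *
      inner ℝ (EuclideanSpace.single j 1 : E d) (A (EuclideanSpace.single j 1)) := by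
    rw [EuclideanSpace.norm_sq_eq, trc_eq_sum_inner, Finset.sum_mul_sum]
    simp
  have hn' := hn
  rw [Finset.sum_comm] at hn'
  have hz' := hz
  rw [Finset.sum_comm] at hz'
  have hsplit : ∀ i j : Fin d,
      inner ℝ (z i • (EuclideanSpace.single j 1 : E d) - z j • (EuclideanSpace.single i 1 : E d))
        (A (z i • (EuclideanSpace.single j 1 : E d) - z j • (EuclideanSpace.single i 1 : E d))) =
      (z i ^ 2 * inner ℝ (EuclideanSpace.single j 1 : E d) (A (EuclideanSpace.single j 1)) +
      z j ^ 2 * inner ℝ (EuclideanSpace.single i 1 : E d) (A (EuclideanSpace.single i 1))) -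
      (z i * (z j * inner ℝ (EuclideanSpace.single i 1 : E d) (A (EuclideanSpace.single j 1))) +
      z j * (z i * inner ℝ (EuclideanSpace.single j 1 : E d) (A (EuclideanSpace.single i 1)))) := by
    intro i j
    simp only [map_sub, map_smul, inner_sub_left, inner_sub_right, real_inner_smul_left,
      real_inner_smul_right]
    ring
  simp only [hsplit, Finset.sum_add_distrib, Finset.sum_sub_distrib]
  rw [← hn, ← hn', ← hz, ← hz']
  ring

theorem inner_le_norm_sq_mul_trc {A : E d →L[ℝ] E d} (hA : ∀ ξ, 0 ≤ inner ℝ ξ (A ξ)) (z : E d) :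
    inner ℝ z (A z) ≤ ‖z‖ ^ 2 * trc A := by
  rw [← sub_nonneg, norm_sq_mul_trc_sub_inner]
  exact mul_nonneg (by norm_num) (Finset.sum_nonneg fun i _ => Finset.sum_nonneg fun j _ => hA _)

/-- `|z|^2 Π(z)`, which is polynomial in `z`. -/
def projSq (z : E d) : E d →L[ℝ] E d :=
  ‖z‖ ^ 2 • ContinuousLinearMap.id ℝ (E d) - (innerSL ℝ z).smulRight z

theorem projSq_apply (z u : E d) : projSq z u = ‖z‖ ^ 2 • u - inner ℝ z u • z := by
  simp [projSq]

theorem inner_projSq (z u w : E d) : inner ℝ (projSq z u) w = inner ℝ u (projSq z w) := by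
  simp only [projSq_apply, inner_sub_left, inner_sub_right, real_inner_smul_left,
    real_inner_smul_right, real_inner_comm u z]
  ring

theorem inner_self_projSq (z u : E d) : inner ℝ z (projSq z u) = 0 := by
  simp only [projSq_apply, inner_sub_right, real_inner_smul_right, real_inner_self_eq_norm_sq]
  ring

theorem norm_projSq_apply_le (z u : E d) : ‖projSq z u‖ ≤ 2 * ‖z‖ ^ 2 * ‖u‖ := by
  rw [projSq_apply]
  refine (norm_sub_le _ _).trans ?_
  rw [norm_smul, norm_smul, Real.norm_of_nonneg (by positivity)]
  have := norm_inner_le_norm (𝕜 := ℝ) z u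
  nlinarith [norm_nonneg z]

theorem norm_projSq_le (z : E d) : ‖projSq z‖ ≤ 2 * ‖z‖ ^ 2 :=
  ContinuousLinearMap.opNorm_le_bound _ (by positivity) (norm_projSq_apply_le z)

theorem continuous_projSq : Continuous (projSq : E d → E d →L[ℝ] E d) := by
  unfold projSq
  have : Continuous fun z : E d => (innerSL ℝ z).smulRight z := by
    exact ((ContinuousLinearMap.smulRightL ℝ (E d) (E d)).continuous₂).comp
      ((innerSL ℝ).continuous.prodMk continuous_id)
  fun_prop

theorem trc_projSq_comp (z : E d) (A : E d →L[ℝ] E d) :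
    trc ((projSq z).comp A) = ‖z‖ ^ 2 * trc A - inner ℝ z (A z) := by
  have : (projSq z).comp A = ‖z‖ ^ 2 • A - ((innerSL ℝ z).comp A).smulRight z := by
    ext1 h
    simp [projSq_apply]
  rw [this, map_sub, map_smul, trc_smulRight]
  simp

theorem norm_rpow_smul_perpProj (γ : ℝ) {z : E d} (hz : z ≠ 0) (u : E d) :
    ‖z‖ ^ (2 + γ) • perpProj z u = ‖z‖ ^ γ • projSq z u := by
  have h0 : 0 < ‖z‖ := norm_pos_iff.2 hz
  rw [perpProj, projSq_apply, add_comm, Real.rpow_add h0, mul_smul, Real.rpow_two, smul_sub,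
    smul_smul, mul_div_cancel₀ _ (by positivity)]

end TraceAndProjection

/-! ### Second-order conditions at a touching point. -/

section Touching

/-- If `F''` were positive, `F'` would be positive just to the right of `0`, and the mean value
theorem would give a larger value of `F` at `δ / 2`. -/
theorem second_deriv_nonpos_of_max {F F' : ℝ → ℝ} {F'' : ℝ} (hF : ∀ s, HasDerivAt F (F' s) s)
    (hF' : HasDerivAt F' F'' 0) (hmax : ∀ s, F s ≤ F 0) : F'' ≤ 0 := by
  by_contra! hpos
  have h0 : F' 0 = 0 :=
    (IsLocalMax.hasDerivAt_eq_zero (Eventually.of_forall hmax) (hF 0))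
  have h := (hasDerivAt_iff_tendsto_slope.1 hF').mono_left
    (nhdsWithin_mono 0 (show Set.Ioi (0 : ℝ) ⊆ {0}ᶜ from fun s hs => ne_of_gt hs))
  have h1 := h.eventually (lt_mem_nhds hpos)
  obtain ⟨δ, hδ, hδs⟩ := mem_nhdsGT_iff_exists_Ioo_subset.1 h1
  have hδ0 : (0 : ℝ) < δ := hδ
  obtain ⟨c, hc, hslope⟩ := exists_hasDerivAt_eq_slope F F' (half_pos hδ0)
    (fun s _ => (hF s).continuousAt.continuousWithinAt) (fun s _ => hF s)
  have hc' : 0 < slope F' 0 c := hδs ⟨hc.1, hc.2.trans (half_lt_self hδ0)⟩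
  rw [slope_def_field, h0, sub_zero, sub_zero] at hc'
  have hcF : 0 < F' c := by
    have := mul_pos hc' hc.1
    rwa [div_mul_cancel₀ _ hc.1.ne'] at this
  rw [hslope, sub_zero] at hcF
  have := mul_pos hcF (half_pos hδ0)
  rw [div_mul_cancel₀ _ (half_pos hδ0).ne'] at this
  linarith [hmax (δ / 2)]

variable {d : ℕ}

theorem contDiff_gradient {f : E d → ℝ} (hf : ContDiff ℝ 2 f) : ContDiff ℝ 1 (gradient f) := by
  unfold gradient
  exact (InnerProductSpace.toDual ℝ (E d)).symm.contDiff.comp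
    (hf.fderiv_right (m := 1) (by norm_num))

theorem inner_gradient {f : E d → ℝ} (v h : E d) :
    inner ℝ (gradient f v) h = fderiv ℝ f v h := by
  rw [gradient, InnerProductSpace.toDual_symm_apply]

/-- Along the line `v + s ξ` the squared bracket is a quadratic polynomial `q` in `s`, so the
barrier is `N * q s ^ (-m / 2)`, and `f` minus the barrier has a maximum at `s = 0`. The right side
is the Hessian of the barrier in direction `ξ`. -/
theorem inner_hessian_le_of_touching {f : E d → ℝ} (hf : ContDiff ℝ 2 f) {N m : ℝ} {v : E d}
    (hle : ∀ w, f w ≤ N * bracket w ^ (-m)) (heq : f v = N * bracket v ^ (-m)) (ξ : E d) :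
    inner ℝ ξ (fderiv ℝ (gradient f) v ξ) ≤
      f v * (m * (m + 2) / bracket v ^ 4 * inner ℝ v ξ ^ 2 - m / bracket v ^ 2 * ‖ξ‖ ^ 2) := by
  set b : ℝ := inner ℝ v ξ with hb
  set q : ℝ → ℝ := fun s => bracket v ^ 2 + 2 * b * s + ‖ξ‖ ^ 2 * s ^ 2 with hq
  have hqeq : ∀ s : ℝ, bracket (v + s • ξ) ^ 2 = q s := by
    intro s
    rw [bracket_sq, hq, bracket_sq, norm_add_sq_real, real_inner_smul_right, norm_smul, mul_pow,
      Real.norm_eq_abs, sq_abs]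
    ring
  have hqpos : ∀ s : ℝ, 0 < q s := fun s => by
    rw [← hqeq]
    have := bracket_pos (v + s • ξ)
    positivity
  have hphi : ∀ s : ℝ, bracket (v + s • ξ) ^ (-m) = q s ^ (-m / 2) := by
    intro s
    rw [bracket_rpow_eq, ← bracket_sq, hqeq]
  have hqd : ∀ s, HasDerivAt q (2 * b + 2 * ‖ξ‖ ^ 2 * s) s := by
    intro s
    have h1 := ((hasDerivAt_id s).const_mul (2 * b)).const_add (bracket v ^ 2)
    have h2 := ((hasDerivAt_id s).pow 2).const_mul (‖ξ‖ ^ 2)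
    refine (h1.add h2).congr_deriv ?_
    simp only [id]
    norm_num
    ring
  have hline : ∀ s : ℝ, HasDerivAt (fun s : ℝ => v + s • ξ) ξ s := by
    intro s
    simpa using ((hasDerivAt_id s).smul_const ξ).const_add v
  have hG := contDiff_gradient hf
  have hF1 : ∀ s : ℝ, HasDerivAt (fun s : ℝ => f (v + s • ξ) - N * q s ^ (-m / 2))
      (inner ℝ ξ (gradient f (v + s • ξ)) -
        N * ((2 * b + 2 * ‖ξ‖ ^ 2 * s) * (-m / 2) * q s ^ (-m / 2 - 1))) s := by
    intro s
    have h1 : HasDerivAt (fun s : ℝ => f (v + s • ξ)) (fderiv ℝ f (v + s • ξ) ξ) s :=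
      ((hf.differentiable (by norm_num)) (v + s • ξ)).hasFDerivAt.comp_hasDerivAt s (hline s)
    rw [← inner_gradient, real_inner_comm] at h1
    exact h1.sub (((hqd s).rpow_const (Or.inl (hqpos s).ne')).const_mul N)
  have hF2 : HasDerivAt (fun s : ℝ => inner ℝ ξ (gradient f (v + s • ξ)) -
        N * ((2 * b + 2 * ‖ξ‖ ^ 2 * s) * (-m / 2) * q s ^ (-m / 2 - 1)))
      (inner ℝ ξ (fderiv ℝ (gradient f) v ξ) - N * (2 * ‖ξ‖ ^ 2 * (-m / 2) * q 0 ^ (-m / 2 - 1) +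
        2 * b * (-m / 2) * (2 * b * (-m / 2 - 1) * q 0 ^ (-m / 2 - 1 - 1)))) 0 := by
    have h1 : HasDerivAt (fun s : ℝ => gradient f (v + s • ξ)) (fderiv ℝ (gradient f) v ξ) 0 := by
      have h0 : HasFDerivAt (gradient f) (fderiv ℝ (gradient f) v) (v + (0 : ℝ) • ξ) := by
        rw [zero_smul, add_zero]
        exact (hG.differentiable one_ne_zero v).hasFDerivAt
      exact h0.comp_hasDerivAt 0 (hline 0)
    have h2 : HasDerivAt (fun s : ℝ => inner ℝ ξ (gradient f (v + s • ξ)))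
        (inner ℝ ξ (fderiv ℝ (gradient f) v ξ)) 0 :=
      (innerSL ℝ ξ).hasFDerivAt.comp_hasDerivAt 0 h1
    have h3 : HasDerivAt (fun s : ℝ => (2 * b + 2 * ‖ξ‖ ^ 2 * s) * (-m / 2))
        (2 * ‖ξ‖ ^ 2 * (-m / 2)) 0 := by
      have := (((hasDerivAt_id (0 : ℝ)).const_mul (2 * ‖ξ‖ ^ 2)).const_add (2 * b)).mul_const
        (-m / 2)
      simpa using this
    have h4 := (hqd 0).rpow_const (p := -m / 2 - 1) (Or.inl (hqpos 0).ne')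
    refine (h2.sub ((h3.mul h4).const_mul N)).congr_deriv ?_
    ring
  have hmax := second_deriv_nonpos_of_max hF1 hF2 (by
    intro s
    have h1 := hle (v + s • ξ)
    rw [hphi] at h1
    have h2 := hphi 0
    simp only [zero_smul, add_zero] at h2 ⊢
    rw [← h2, ← heq]
    linarith)
  have hbr := bracket_pos v
  have hq0 : q 0 = bracket v ^ 2 := by simp [hq]
  have hpow : ∀ k : ℕ, (bracket v ^ 2) ^ (-m / 2 - k) =
      bracket v ^ (-m) / bracket v ^ (2 * k) := by
    intro k
    rw [← Real.rpow_natCast (bracket v) 2, ← Real.rpow_mul hbr.le,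
      ← Real.rpow_natCast (bracket v) (2 * k), ← Real.rpow_sub hbr]
    congr 1
    push_cast
    ring
  have hp1 := hpow 1
  have hp2 := hpow 2
  rw [show -m / 2 - 1 - 1 = -m / 2 - ((2 : ℕ) : ℝ) by push_cast; ring,
    show -m / 2 - 1 = -m / 2 - ((1 : ℕ) : ℝ) by push_cast; ring, hq0, hp1, hp2] at hmax
  rw [heq]
  have : N * bracket v ^ (-m) * (m * (m + 2) / bracket v ^ 4 * b ^ 2 -
      m / bracket v ^ 2 * ‖ξ‖ ^ 2) = N * (2 * ‖ξ‖ ^ 2 * (-m / 2) *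
      (bracket v ^ (-m) / bracket v ^ (2 * 1)) + 2 * b * (-m / 2) * (2 * b * (-m / 2 - ((1 : ℕ) : ℝ)) *
      (bracket v ^ (-m) / bracket v ^ (2 * 2)))) := by
    push_cast
    ring
  rw [this]
  linarith

/-- The Hessian of the barrier minus that of `f` is a nonnegative form, so contracting it with `|z|²
Π(z)` preserves the sign (`inner_le_norm_sq_mul_trc`). -/
theorem norm_sq_mul_trc_hessian_le_of_touching {f : E d → ℝ} (hf : ContDiff ℝ 2 f) {N m : ℝ}
    {v : E d} (hle : ∀ w, f w ≤ N * bracket w ^ (-m)) (heq : f v = N * bracket v ^ (-m))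
    (z : E d) :
    ‖z‖ ^ 2 * trc (fderiv ℝ (gradient f) v) - inner ℝ z (fderiv ℝ (gradient f) v z) ≤
      f v * (m * (m + 2) / bracket v ^ 4 * (‖z‖ ^ 2 * ‖v‖ ^ 2 - inner ℝ v z ^ 2) -
        m / bracket v ^ 2 * ((d - 1) * ‖z‖ ^ 2)) := by
  set H := fderiv ℝ (gradient f) v
  set A : E d →L[ℝ] E d := (f v * (m * (m + 2) / bracket v ^ 4)) • (innerSL ℝ v).smulRight v -
    (f v * (m / bracket v ^ 2)) • ContinuousLinearMap.id ℝ (E d) - H with hA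
  have h := inner_le_norm_sq_mul_trc (A := A) (fun ξ => by
    have := inner_hessian_le_of_touching hf hle heq ξ
    simp only [hA, _root_.sub_apply, _root_.smul_apply,
      ContinuousLinearMap.smulRight_apply, innerSL_apply_apply, ContinuousLinearMap.id_apply,
      inner_sub_right, real_inner_smul_right, real_inner_self_eq_norm_sq, real_inner_comm v ξ]
    linarith) z
  simp only [hA, _root_.sub_apply, _root_.smul_apply,
      ContinuousLinearMap.smulRight_apply, innerSL_apply_apply, ContinuousLinearMap.id_apply,
      inner_sub_right, real_inner_smul_right, real_inner_self_eq_norm_sq, map_sub, map_smul,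
      trc_smulRight, trc_id, smul_eq_mul, real_inner_comm v z] at h
  linarith

end Touching

/-! ### Integration by parts against fields tangent to spheres. -/

section IntegrationByParts

variable {d : ℕ}

theorem hasFDerivAt_radial {r : ℝ → ℝ} (hr : Differentiable ℝ r) (u w : E d) :
    HasFDerivAt (fun u : E d => r (‖u - w‖ ^ 2))
      ((2 * deriv r (‖u - w‖ ^ 2)) • innerSL ℝ (u - w)) u := by
  have h1 : HasFDerivAt (fun u : E d => ‖u - w‖ ^ 2) (2 • innerSL ℝ (u - w)) u :=
    ((hasFDerivAt_id u).sub_const w).norm_sq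
  have h2 := (hr (‖u - w‖ ^ 2)).hasDerivAt.comp_hasFDerivAt u h1
  refine h2.congr_fderiv ?_
  ext h
  simp
  ring

/-- The derivative of `u ↦ r(|u - w|^2) |u - w|^2 Π(u - w) G(u)`, with `z = u - w`. -/
def fieldDeriv (r : ℝ → ℝ) (z G : E d) (G' : E d →L[ℝ] E d) : E d →L[ℝ] E d :=
  ((2 * deriv r (‖z‖ ^ 2)) • innerSL ℝ z).smulRight (projSq z G) +
    r (‖z‖ ^ 2) • ((2 • innerSL ℝ z).smulRight G - (innerSL ℝ G).smulRight z -
      inner ℝ z G • ContinuousLinearMap.id ℝ (E d) + (projSq z).comp G')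

theorem hasFDerivAt_radial_smul_projSq {r : ℝ → ℝ} (hr : Differentiable ℝ r) {G : E d → E d}
    {G' : E d →L[ℝ] E d} {u : E d} (hG : HasFDerivAt G G' u) (w : E d) :
    HasFDerivAt (fun u : E d => r (‖u - w‖ ^ 2) • projSq (u - w) (G u))
      (fieldDeriv r (u - w) (G u) G') u := by
  have hz : HasFDerivAt (fun u : E d => u - w) (ContinuousLinearMap.id ℝ (E d)) u :=
    (hasFDerivAt_id u).sub_const w
  have h1 : HasFDerivAt (fun u : E d => ‖u - w‖ ^ 2) (2 • innerSL ℝ (u - w)) u :=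
    ((hasFDerivAt_id u).sub_const w).norm_sq
  have h2 := (h1.smul hG).sub ((hz.inner ℝ hG).smul hz)
  have h3 := (hasFDerivAt_radial hr u w).smul h2
  have h4 : (fun u : E d => r (‖u - w‖ ^ 2) • projSq (u - w) (G u)) =
      (fun u : E d => r (‖u - w‖ ^ 2)) • ((fun u : E d => ‖u - w‖ ^ 2) • G -
        (fun u => inner ℝ (u - w) (G u)) • fun u => u - w) := by
    funext u
    simp [projSq_apply]
  rw [h4]
  refine h3.congr_fderiv ?_
  ext1 h
  simp only [fieldDeriv, projSq_apply, _root_.add_apply, _root_.smul_apply, _root_.sub_apply,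
    ContinuousLinearMap.smulRight_apply, innerSL_apply_apply, ContinuousLinearMap.id_apply,
    ContinuousLinearMap.comp_apply, fderivInnerCLM_apply, ContinuousLinearMap.prod_apply,
    smul_eq_mul, nsmul_eq_mul, Pi.smul_apply', Pi.sub_apply]
  rw [real_inner_comm (G u) h]
  push_cast
  module


/-- The derivative of the radial weight multiplies `inner ℝ z (projSq z G)`, which vanishes; so
`deriv r` does not appear. -/
theorem trc_fieldDeriv (r : ℝ → ℝ) (z G : E d) (G' : E d →L[ℝ] E d) :
    trc (fieldDeriv r z G G') = r (‖z‖ ^ 2) * (‖z‖ ^ 2 * trc G' - inner ℝ z (G' z) -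
      (d - 1) * inner ℝ z G) := by
  simp only [fieldDeriv, map_add, map_sub, map_smul, trc_smulRight, trc_id, trc_projSq_comp,
    _root_.smul_apply, innerSL_apply_apply, inner_self_projSq, smul_eq_mul, nsmul_eq_mul,
    real_inner_comm z G]
  push_cast
  ring

theorem norm_smulRight_le (l : E d →L[ℝ] ℝ) (b : E d) : ‖l.smulRight b‖ ≤ ‖l‖ * ‖b‖ :=
  (ContinuousLinearMap.norm_smulRight_apply l b).le

theorem norm_fieldDeriv_le (r : ℝ → ℝ) (z G : E d) (G' : E d →L[ℝ] E d) :
    ‖fieldDeriv r z G G'‖ ≤ 4 * |deriv r (‖z‖ ^ 2)| * ‖z‖ ^ 3 * ‖G‖ +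
      |r (‖z‖ ^ 2)| * (4 * ‖z‖ * ‖G‖ + 2 * ‖z‖ ^ 2 * ‖G'‖) := by
  have h1 : ‖((2 * deriv r (‖z‖ ^ 2)) • innerSL ℝ z).smulRight (projSq z G)‖ ≤
      4 * |deriv r (‖z‖ ^ 2)| * ‖z‖ ^ 3 * ‖G‖ := by
    refine (norm_smulRight_le _ _).trans ?_
    rw [norm_smul, innerSL_apply_norm, Real.norm_eq_abs, abs_mul, abs_two]
    calc 2 * |deriv r (‖z‖ ^ 2)| * ‖z‖ * ‖projSq z G‖
        ≤ 2 * |deriv r (‖z‖ ^ 2)| * ‖z‖ * (2 * ‖z‖ ^ 2 * ‖G‖) := by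
          gcongr
          exact norm_projSq_apply_le z G
      _ = _ := by ring
  have h2 : ‖(2 • innerSL ℝ z).smulRight G - (innerSL ℝ G).smulRight z -
      inner ℝ z G • ContinuousLinearMap.id ℝ (E d) + (projSq z).comp G'‖ ≤
      4 * ‖z‖ * ‖G‖ + 2 * ‖z‖ ^ 2 * ‖G'‖ := by
    have ha : ‖(2 • innerSL ℝ z).smulRight G‖ ≤ 2 * ‖z‖ * ‖G‖ := by
      refine (norm_smulRight_le _ _).trans ?_
      gcongr
      rw [two_smul, two_mul]
      refine (norm_add_le _ _).trans ?_
      rw [innerSL_apply_norm]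
    have hb : ‖(innerSL ℝ G).smulRight z‖ ≤ ‖z‖ * ‖G‖ := by
      refine (norm_smulRight_le _ _).trans ?_
      rw [innerSL_apply_norm, mul_comm]
    have hc : ‖inner ℝ z G • ContinuousLinearMap.id ℝ (E d)‖ ≤ ‖z‖ * ‖G‖ := by
      rw [norm_smul]
      exact (mul_le_of_le_one_right (norm_nonneg _) ContinuousLinearMap.norm_id_le).trans
        (norm_inner_le_norm z G)
    have hd : ‖(projSq z).comp G'‖ ≤ 2 * ‖z‖ ^ 2 * ‖G'‖ :=
      (ContinuousLinearMap.opNorm_comp_le _ _).trans (by gcongr; exact norm_projSq_le z)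
    have h3 := norm_add_le ((2 • innerSL ℝ z).smulRight G - (innerSL ℝ G).smulRight z -
      inner ℝ z G • ContinuousLinearMap.id ℝ (E d)) ((projSq z).comp G')
    have h4 := norm_sub_le ((2 • innerSL ℝ z).smulRight G - (innerSL ℝ G).smulRight z)
      (inner ℝ z G • ContinuousLinearMap.id ℝ (E d))
    have h5 := norm_sub_le ((2 • innerSL ℝ z).smulRight G) ((innerSL ℝ G).smulRight z)
    linarith
  refine (norm_add_le _ _).trans (add_le_add h1 ?_)
  rw [norm_smul, Real.norm_eq_abs]
  gcongr

theorem integral_fderiv_apply_eq_neg {X : E d → E d} (hX : ContDiff ℝ 1 X)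
    (hXc : HasCompactSupport X) {g : E d → ℝ} (hg : ContDiff ℝ 1 g) :
    ∫ z, fderiv ℝ g z (X z) = -∫ z, trc (fderiv ℝ X z) * g z := by
  have hXi : ∀ i : Fin d, ContDiff ℝ 1 (fun z => X z i) := fun i =>
    (EuclideanSpace.proj i : E d →L[ℝ] ℝ).contDiff.comp hX
  have hXic : ∀ i : Fin d, HasCompactSupport (fun z => X z i) := fun i =>
    hXc.comp_left (g := fun y : E d => y i) rfl
  have hd1 : ∀ i : Fin d, Continuous fun z => fderiv ℝ g z (EuclideanSpace.single i 1) := fun i =>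
    (hg.continuous_fderiv one_ne_zero).clm_apply continuous_const
  have hd2 : ∀ i : Fin d, Continuous fun z =>
      fderiv ℝ (fun z => X z i) z (EuclideanSpace.single i 1) := fun i =>
    ((hXi i).continuous_fderiv one_ne_zero).clm_apply continuous_const
  have hd2c : ∀ i : Fin d, HasCompactSupport fun z =>
      fderiv ℝ (fun z => X z i) z (EuclideanSpace.single i 1) := fun i =>
    ((hXic i).fderiv ℝ).comp_left (g := fun A : E d →L[ℝ] ℝ => A (EuclideanSpace.single i 1)) rfl
  have hI1 : ∀ i : Fin d, Integrable fun z => X z i * fderiv ℝ g z (EuclideanSpace.single i 1) :=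
    fun i => ((hXi i).continuous.mul (hd1 i)).integrable_of_hasCompactSupport (hXic i).mul_right
  have hI2 : ∀ i : Fin d, Integrable fun z =>
      fderiv ℝ (fun z => X z i) z (EuclideanSpace.single i 1) * g z :=
    fun i => ((hd2 i).mul hg.continuous).integrable_of_hasCompactSupport (hd2c i).mul_right
  have hI3 : ∀ i : Fin d, Integrable fun z => X z i * g z :=
    fun i => ((hXi i).continuous.mul hg.continuous).integrable_of_hasCompactSupport
      (hXic i).mul_right
  have hlhs : ∀ z, fderiv ℝ g z (X z) =
      ∑ i : Fin d, X z i * fderiv ℝ g z (EuclideanSpace.single i 1) := by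
    intro z
    conv_lhs => rw [← sum_smul_single (X z), map_sum]
    simp
  have hrhs : ∀ z, trc (fderiv ℝ X z) * g z =
      ∑ i : Fin d, fderiv ℝ (fun z => X z i) z (EuclideanSpace.single i 1) * g z := by
    intro z
    rw [trc_apply, Finset.sum_mul]
    refine Finset.sum_congr rfl fun i _ => ?_
    have h : HasFDerivAt (fun z => X z i)
        ((EuclideanSpace.proj i : E d →L[ℝ] ℝ).comp (fderiv ℝ X z)) z :=
      (EuclideanSpace.proj i : E d →L[ℝ] ℝ).hasFDerivAt.comp z
        (hX.differentiable one_ne_zero z).hasFDerivAt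
    rw [h.fderiv]
    rfl
  simp only [hlhs, hrhs]
  rw [integral_finsetSum _ fun i _ => hI1 i, integral_finsetSum _ fun i _ => hI2 i,
    ← Finset.sum_neg_distrib]
  refine Finset.sum_congr rfl fun i _ => ?_
  exact integral_mul_fderiv_eq_neg_fderiv_mul_of_integrable (hI2 i) (hI1 i) (hI3 i)
    (fun z _ => (hXi i).differentiable one_ne_zero z) (fun z _ => hg.differentiable one_ne_zero z)

theorem contDiff_radial {r : ℝ → ℝ} (hr : ContDiff ℝ 1 r) :
    ContDiff ℝ 1 fun z : E d => r (‖z‖ ^ 2) :=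
  hr.comp (contDiff_norm_sq ℝ)

theorem contDiff_radial_smul_projSq {r : ℝ → ℝ} (hr : ContDiff ℝ 1 r) (e : E d) :
    ContDiff ℝ 1 fun z : E d => r (‖z‖ ^ 2) • projSq z e := by
  simp only [projSq_apply]
  refine (contDiff_radial hr).smul (ContDiff.sub ?_ ?_)
  · exact (contDiff_norm_sq ℝ).smul contDiff_const
  · exact (contDiff_id.inner ℝ contDiff_const).smul contDiff_id

theorem integral_radial_field_of_compact {r : ℝ → ℝ} (hr : ContDiff ℝ 1 r) {R : ℝ} (hR : 0 ≤ R)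
    (hrR : ∀ s, R ^ 2 < s → r s = 0) {g : E d → ℝ} (hg : ContDiff ℝ 1 g) (e : E d) :
    ∫ z, fderiv ℝ g z (r (‖z‖ ^ 2) • projSq z e) =
      (d - 1) * ∫ z, r (‖z‖ ^ 2) * inner ℝ z e * g z := by
  have hc : HasCompactSupport fun z : E d => r (‖z‖ ^ 2) • projSq z e := by
    refine HasCompactSupport.intro (isCompact_closedBall (0 : E d) R) fun z hz => ?_
    rw [mem_closedBall_zero_iff, not_le] at hz
    rw [hrR _ (by gcongr), zero_smul]
  rw [integral_fderiv_apply_eq_neg (contDiff_radial_smul_projSq hr e) hc hg, ← integral_neg,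
    ← integral_const_mul]
  refine integral_congr_ae (ae_of_all _ fun z => ?_)
  have h := hasFDerivAt_radial_smul_projSq (hr.differentiable one_ne_zero)
    (hasFDerivAt_const e z) (0 : E d)
  simp only [sub_zero] at h
  simp only [h.fderiv, trc_fieldDeriv, map_zero, _root_.zero_apply, inner_zero_right]
  ring

/-- The field is tangent to spheres, so there is no boundary term. In the proof, multiplying `r` by
a radial cutoff `ψ n` keeps the form of the field and creates no derivative of the cutoff; the
cutoffs then tend to the indicator of the ball. This is what makes the improper flux tractable
without decay of `∇f`. -/
theorem integral_ball_radial_field {r : ℝ → ℝ} (hr : ContDiff ℝ 1 r) {R : ℝ} (hR : 0 < R)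
    {g : E d → ℝ} (hg : ContDiff ℝ 1 g) (e : E d) :
    ∫ z in Metric.ball 0 R, fderiv ℝ g z (r (‖z‖ ^ 2) • projSq z e) =
      (d - 1) * ∫ z in Metric.ball 0 R, r (‖z‖ ^ 2) * inner ℝ z e * g z := by
  set ψ : ℕ → ℝ → ℝ := fun n s => Real.smoothTransition (n * (R ^ 2 - s)) with hψ
  have hψd : ∀ n, ContDiff ℝ 1 (ψ n) := fun n =>
    Real.smoothTransition.contDiff.comp (by fun_prop)
  have hψ0 : ∀ n s, R ^ 2 ≤ s → ψ n s = 0 := fun n s hs =>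
    Real.smoothTransition.zero_of_nonpos (mul_nonpos_of_nonneg_of_nonpos (by positivity)
      (by linarith))
  have hψ1 : ∀ s, s < R ^ 2 → ∀ᶠ n in atTop, ψ n s = 1 := by
    intro s hs
    filter_upwards [eventually_ge_atTop ⌈(R ^ 2 - s)⁻¹⌉₊] with n hn
    refine Real.smoothTransition.one_of_one_le ?_
    have h1 : (R ^ 2 - s)⁻¹ ≤ n := (Nat.le_ceil _).trans (by exact_mod_cast hn)
    rwa [inv_le_iff_one_le_mul₀ (by linarith)] at h1
  have hlim : ∀ h : E d → ℝ, Continuous h →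
      Tendsto (fun n => ∫ z, ψ n (‖z‖ ^ 2) * h z) atTop (𝓝 (∫ z in Metric.ball 0 R, h z)) := by
    intro h hh
    rw [← integral_indicator Metric.isOpen_ball.measurableSet]
    refine tendsto_integral_of_dominated_convergence
      (fun z => (Metric.ball (0 : E d) R).indicator (fun z => ‖h z‖) z) ?_ ?_ ?_ ?_
    · intro n
      exact (((hψd n).continuous.comp (by fun_prop)).mul hh).aestronglyMeasurable
    · rw [integrable_indicator_iff Metric.isOpen_ball.measurableSet]
      exact (hh.norm.continuousOn.integrableOn_compact (isCompact_closedBall (0 : E d) R)).mono_set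
        Metric.ball_subset_closedBall
    · intro n
      refine ae_of_all _ fun z => ?_
      by_cases hz : z ∈ Metric.ball (0 : E d) R
      · rw [Set.indicator_of_mem hz, norm_mul]
        refine mul_le_of_le_one_left (norm_nonneg _) ?_
        rw [Real.norm_of_nonneg (Real.smoothTransition.nonneg _)]
        exact Real.smoothTransition.le_one _
      · rw [Set.indicator_of_notMem hz]
        rw [mem_ball_zero_iff, not_lt] at hz
        rw [hψ0 n _ (by gcongr), zero_mul, norm_zero]
    · refine ae_of_all _ fun z => ?_
      by_cases hz : z ∈ Metric.ball (0 : E d) R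
      · rw [Set.indicator_of_mem hz]
        rw [mem_ball_zero_iff] at hz
        refine tendsto_const_nhds.congr' ?_
        filter_upwards [hψ1 (‖z‖ ^ 2) (by gcongr)] with n hn
        rw [hn, one_mul]
      · rw [Set.indicator_of_notMem hz]
        rw [mem_ball_zero_iff, not_lt] at hz
        refine tendsto_const_nhds.congr fun n => ?_
        rw [hψ0 n _ (by gcongr), zero_mul]
  have hc1 : Continuous fun z : E d => fderiv ℝ g z (r (‖z‖ ^ 2) • projSq z e) :=
    (hg.continuous_fderiv one_ne_zero).clm_apply (contDiff_radial_smul_projSq hr e).continuous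
  have hc2 : Continuous fun z : E d => r (‖z‖ ^ 2) * inner ℝ z e * g z :=
    ((contDiff_radial hr).continuous.mul (by fun_prop)).mul hg.continuous
  refine tendsto_nhds_unique (hlim _ hc1) (((hlim _ hc2).const_mul ((d : ℝ) - 1)).congr fun n => ?_)
  have h := integral_radial_field_of_compact (r := fun s => ψ n s * r s) ((hψd n).mul hr) hR.le
    (fun s hs => by rw [hψ0 n s hs.le, zero_mul]) hg e
  simp only [mul_smul, map_smul, smul_eq_mul, mul_assoc] at h ⊢
  rw [h]

end IntegrationByParts

/-! ### Smooth truncation of the kernel `|z|^γ` near its singularity. -/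

section LandauWeight

theorem exists_abs_deriv_smoothTransition_le :
    ∃ c : ℝ, 0 < c ∧ ∀ x, |deriv Real.smoothTransition x| ≤ c ∧
      (1 < x → deriv Real.smoothTransition x = 0) := by
  have hc : Continuous (deriv Real.smoothTransition) :=
    (Real.smoothTransition.contDiff (n := 1)).continuous_deriv le_rfl
  have h1 : ∀ x : ℝ, 1 < x → deriv Real.smoothTransition x = 0 := by
    intro x hx
    have : Real.smoothTransition =ᶠ[𝓝 x] fun _ => 1 := by
      filter_upwards [Ioi_mem_nhds hx] with y hy
      exact Real.smoothTransition.one_of_one_le (le_of_lt hy)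
    rw [this.deriv_eq, deriv_const]
  have h0 : ∀ x : ℝ, x < 0 → deriv Real.smoothTransition x = 0 := by
    intro x hx
    have : Real.smoothTransition =ᶠ[𝓝 x] fun _ => 0 := by
      filter_upwards [Iio_mem_nhds hx] with y hy
      exact Real.smoothTransition.zero_of_nonpos (le_of_lt hy)
    rw [this.deriv_eq, deriv_const]
  obtain ⟨c, hcb⟩ := (isCompact_Icc (a := (0 : ℝ)) (b := 1)).exists_bound_of_continuousOn
    hc.continuousOn
  refine ⟨max c 1, by positivity, fun x => ⟨?_, h1 x⟩⟩
  by_cases hx : x ∈ Set.Icc (0 : ℝ) 1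
  · exact (hcb x hx).trans (le_max_left _ _)
  · have : deriv Real.smoothTransition x = 0 := by
      rcases lt_or_ge x 0 with h | h
      · exact h0 x h
      · exact h1 x (by
          by_contra! h'
          exact hx ⟨h, h'⟩)
    rw [this, abs_zero]
    positivity

/-- The weight `s^{γ/2}`, cut off smoothly to vanish for `s ≤ ε^2`. -/
def landauWeight (γ ε s : ℝ) : ℝ := s ^ (γ / 2) * Real.smoothTransition (s / ε ^ 2 - 1)

variable {γ ε : ℝ}

theorem landauWeight_eq_zero (hε : 0 < ε) {s : ℝ} (hs : s ≤ ε ^ 2) : landauWeight γ ε s = 0 := by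
  rw [landauWeight, Real.smoothTransition.zero_of_nonpos, mul_zero]
  rw [sub_nonpos, div_le_one (by positivity)]
  exact hs

theorem landauWeight_eq (hε : 0 < ε) {s : ℝ} (hs : 2 * ε ^ 2 ≤ s) :
    landauWeight γ ε s = s ^ (γ / 2) := by
  rw [landauWeight, Real.smoothTransition.one_of_one_le, mul_one]
  rw [le_sub_iff_add_le, le_div_iff₀ (by positivity)]
  linarith

theorem landauWeight_nonneg {s : ℝ} (hs : 0 ≤ s) : 0 ≤ landauWeight γ ε s :=
  mul_nonneg (by positivity) (Real.smoothTransition.nonneg _)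

theorem landauWeight_le {s : ℝ} (hs : 0 ≤ s) : landauWeight γ ε s ≤ s ^ (γ / 2) :=
  mul_le_of_le_one_right (by positivity) (Real.smoothTransition.le_one _)

theorem contDiff_landauWeight (hε : 0 < ε) : ContDiff ℝ 1 (landauWeight γ ε) := by
  rw [contDiff_iff_contDiffAt]
  intro s
  rcases le_or_gt s 0 with hs | hs
  · have : landauWeight γ ε =ᶠ[𝓝 s] fun _ => 0 := by
      filter_upwards [Iio_mem_nhds (show s < ε ^ 2 by
        have : 0 < ε ^ 2 := by positivity
        linarith)] with y hy
      exact landauWeight_eq_zero hε (le_of_lt hy)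
    exact contDiffAt_const.congr_of_eventuallyEq this
  · refine (Real.contDiffAt_rpow_const_of_ne hs.ne').mul ?_
    exact (Real.smoothTransition.contDiff.comp (by fun_prop)).contDiffAt

theorem deriv_landauWeight_of_lt (hε : 0 < ε) {s : ℝ} (hs : s < ε ^ 2) :
    deriv (landauWeight γ ε) s = 0 := by
  have : landauWeight γ ε =ᶠ[𝓝 s] fun _ => 0 := by
    filter_upwards [Iio_mem_nhds hs] with y hy
    exact landauWeight_eq_zero hε (le_of_lt hy)
  rw [this.deriv_eq, deriv_const]

theorem mul_deriv_landauWeight {s : ℝ} (hs : 0 < s) :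
    s * deriv (landauWeight γ ε) s = γ / 2 * landauWeight γ ε s +
      s ^ (γ / 2) * (deriv Real.smoothTransition (s / ε ^ 2 - 1) * (s / ε ^ 2)) := by
  have h1 : HasDerivAt (fun s : ℝ => s ^ (γ / 2)) (γ / 2 * s ^ (γ / 2 - 1)) s :=
    Real.hasDerivAt_rpow_const (Or.inl hs.ne')
  have h2 : HasDerivAt (fun s : ℝ => Real.smoothTransition (s / ε ^ 2 - 1))
      (deriv Real.smoothTransition (s / ε ^ 2 - 1) * (1 / ε ^ 2)) s :=
    ((Real.smoothTransition.contDiff (n := 1)).differentiable one_ne_zero _).hasDerivAt.comp s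
      (((hasDerivAt_id s).div_const _).sub_const 1)
  have h3 : deriv (landauWeight γ ε) s = _ := (h1.mul h2).deriv
  rw [h3, landauWeight, Real.rpow_sub_one hs.ne']
  field_simp

/-- The derivative of the weight differs from that of `s^{γ/2}` by a term supported on
`ε^2 ≤ s ≤ 2 ε^2`. -/
theorem exists_abs_mul_deriv_landauWeight_sub_le :
    ∃ c : ℝ, 0 < c ∧ ∀ γ ε s : ℝ, 0 < ε → 0 ≤ s →
      |2 * (s * deriv (landauWeight γ ε) s) - γ * landauWeight γ ε s| ≤ c * s ^ (γ / 2) ∧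
      (s < ε ^ 2 ∨ 2 * ε ^ 2 < s →
        2 * (s * deriv (landauWeight γ ε) s) - γ * landauWeight γ ε s = 0) := by
  obtain ⟨c, hc, h⟩ := exists_abs_deriv_smoothTransition_le
  -- One factor `2` is the prefactor of the derivative term; the other bounds `s / ε ^ 2` on the
  -- transition shell.
  refine ⟨4 * c, by positivity, fun γ ε s hε hs => ?_⟩
  have hzero : s < ε ^ 2 ∨ 2 * ε ^ 2 < s →
        2 * (s * deriv (landauWeight γ ε) s) - γ * landauWeight γ ε s = 0 := by
    rintro (h1 | h1)
    · rw [deriv_landauWeight_of_lt hε h1, landauWeight_eq_zero hε h1.le]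
      ring
    · have h2 : 1 < s / ε ^ 2 - 1 := by
        rw [lt_sub_iff_add_lt, lt_div_iff₀ (by positivity)]
        linarith
      rw [mul_deriv_landauWeight (lt_of_le_of_lt (by positivity) h1), (h _).2 h2]
      ring
  refine ⟨?_, hzero⟩
  by_cases hr : s < ε ^ 2 ∨ 2 * ε ^ 2 < s
  · rw [hzero hr, abs_zero]
    positivity
  · push Not at hr
    have hs0 : 0 < s := lt_of_lt_of_le (by positivity) hr.1
    rw [mul_deriv_landauWeight hs0]
    have h1 : s / ε ^ 2 ≤ 2 := by
      rw [div_le_iff₀ (by positivity)]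
      exact hr.2
    have h2 := (h (s / ε ^ 2 - 1)).1
    calc |2 * (γ / 2 * landauWeight γ ε s +
          s ^ (γ / 2) * (deriv Real.smoothTransition (s / ε ^ 2 - 1) * (s / ε ^ 2))) -
          γ * landauWeight γ ε s|
        = 2 * s ^ (γ / 2) * (|deriv Real.smoothTransition (s / ε ^ 2 - 1)| * (s / ε ^ 2)) := by
          rw [show 2 * (γ / 2 * landauWeight γ ε s + s ^ (γ / 2) *
            (deriv Real.smoothTransition (s / ε ^ 2 - 1) * (s / ε ^ 2))) - γ * landauWeight γ ε s =
            2 * s ^ (γ / 2) * (deriv Real.smoothTransition (s / ε ^ 2 - 1) * (s / ε ^ 2)) by ring,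
            abs_mul, abs_mul (deriv _ _), abs_of_nonneg (show 0 ≤ 2 * s ^ (γ / 2) by positivity),
            abs_of_nonneg (show 0 ≤ s / ε ^ 2 by positivity)]
      _ ≤ 2 * s ^ (γ / 2) * (c * 2) := by gcongr
      _ = 4 * c * s ^ (γ / 2) := by ring

theorem norm_sq_rpow_half {d : ℕ} (z : E d) (γ : ℝ) : (‖z‖ ^ 2) ^ (γ / 2) = ‖z‖ ^ γ := by
  rw [← Real.rpow_natCast, ← Real.rpow_mul (norm_nonneg z)]
  congr 1
  push_cast
  ring

end LandauWeight

/-! ### The singular and the regular part of the Landau flux. -/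

section LandauFlux

variable {d : ℕ} {γ ε : ℝ}

theorem integrableOn_norm_rpow_closedBall (hd : 2 ≤ d) {p : ℝ} (hp : -(d : ℝ) < p) (R : ℝ) :
    IntegrableOn (fun z : E d => ‖z‖ ^ p) (Metric.closedBall 0 R) := by
  have h := integrable_norm_rpow_mul_one_add_norm (d := d) hd hp (m := d + p + 1) (by linarith)
  refine Integrable.mono' ((h.const_mul ((1 + R) ^ (d + p + 1))).integrableOn
    (s := Metric.closedBall (0 : E d) R)) (measurable_norm.pow_const p).aestronglyMeasurable ?_
  filter_upwards [ae_restrict_mem measurableSet_closedBall] with z hz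
  rw [mem_closedBall_zero_iff] at hz
  have h1 : 0 < 1 + ‖z‖ := by positivity
  have h2 : 0 ≤ (d : ℝ) + p + 1 := by linarith
  rw [Real.norm_of_nonneg (by positivity), Real.rpow_neg h1.le]
  have h3 : 1 ≤ (1 + R) ^ (d + p + 1) * ((1 + ‖z‖) ^ (d + p + 1))⁻¹ := by
    rw [← div_eq_mul_inv, one_le_div (by positivity)]
    exact Real.rpow_le_rpow h1.le (by linarith) h2
  calc ‖z‖ ^ p ≤ ‖z‖ ^ p * ((1 + R) ^ (d + p + 1) * ((1 + ‖z‖) ^ (d + p + 1))⁻¹) :=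
        le_mul_of_one_le_right (by positivity) h3
    _ = _ := by ring

/-- The singular part of the kernel `|z|^γ`. -/
def landauNearWeight (γ ε : ℝ) (z : E d) : ℝ := ‖z‖ ^ γ - landauWeight γ ε (‖z‖ ^ 2)

theorem abs_landauNearWeight_le (z : E d) : |landauNearWeight γ ε z| ≤ ‖z‖ ^ γ := by
  have h1 := landauWeight_nonneg (γ := γ) (ε := ε) (sq_nonneg ‖z‖)
  have h2 := landauWeight_le (γ := γ) (ε := ε) (sq_nonneg ‖z‖)
  rw [norm_sq_rpow_half] at h2
  rw [landauNearWeight, abs_of_nonneg (by linarith)]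
  linarith

theorem landauNearWeight_eq_zero (hε : 0 < ε) {z : E d} (hz : 2 * ε ≤ ‖z‖) :
    landauNearWeight γ ε z = 0 := by
  rw [landauNearWeight, landauWeight_eq hε (by nlinarith), norm_sq_rpow_half, sub_self]

theorem measurable_landauNearWeight (hε : 0 < ε) :
    Measurable (landauNearWeight γ ε : E d → ℝ) := by
  have := (contDiff_radial (d := d) (contDiff_landauWeight (γ := γ) hε)).continuous.measurable
  unfold landauNearWeight
  fun_prop

/-- The antisymmetric combination `f(u - z) ∇f(u) - f(u) ∇f(u - z)`. -/
def landauCommutator (f : E d → ℝ) (u z : E d) : E d :=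
  f (u - z) • gradient f u - f u • gradient f (u - z)

/-- The contribution of the singular part of the kernel to the flux. -/
def landauNear (γ ε : ℝ) (f : E d → ℝ) (u : E d) : E d :=
  ∫ z in Metric.closedBall 0 (2 * ε), landauNearWeight γ ε z • projSq z (landauCommutator f u z)

/-- The integrand of the contribution of the regular part of the kernel to the flux. -/
def landauFarIntegrand (γ ε : ℝ) (f : E d → ℝ) (u w : E d) : E d :=
  f w • (landauWeight γ ε (‖u - w‖ ^ 2) • projSq (u - w) (gradient f u) +
    ((d - 1) * f u) • landauWeight γ ε (‖u - w‖ ^ 2) • (u - w))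

theorem continuous_landauCommutator {f : E d → ℝ} (hf : ContDiff ℝ 2 f) (u : E d) :
    Continuous (landauCommutator f u) := by
  have := (contDiff_gradient hf).continuous
  have := hf.continuous
  unfold landauCommutator
  fun_prop

/-- `projSq` contributes two powers of `‖z‖`, so the singularity is of order `γ + 2`, which exceeds
`-d` even when `γ = -d`. -/
theorem norm_landauNearWeight_smul_le (B : ℝ) {z y : E d} (hy : ‖y‖ ≤ B) :
    ‖landauNearWeight γ ε z • projSq z y‖ ≤ 2 * B * ‖z‖ ^ (γ + 2) := by
  rcases eq_or_ne z 0 with rfl | hz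
  · have hB := (norm_nonneg y).trans hy
    have : projSq (0 : E d) y = 0 := by simp [projSq_apply]
    rw [this, smul_zero, norm_zero]
    positivity
  · have hz0 := norm_pos_iff.2 hz
    rw [norm_smul, Real.rpow_add hz0, Real.rpow_two]
    calc ‖landauNearWeight γ ε z‖ * ‖projSq z y‖ ≤ ‖z‖ ^ γ * (2 * ‖z‖ ^ 2 * B) := by
          gcongr
          · exact abs_landauNearWeight_le z
          · exact (norm_projSq_apply_le z y).trans (by gcongr)
      _ = _ := by ring

theorem integrableOn_landauNear (hd : 2 ≤ d) (hγ : -(d : ℝ) < γ + 2) (hε : 0 < ε)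
    {F : E d → E d} (hF : Continuous F) (R : ℝ) :
    IntegrableOn (fun z => landauNearWeight γ ε z • projSq z (F z)) (Metric.closedBall 0 R) := by
  obtain ⟨B, hB⟩ := (isCompact_closedBall (0 : E d) R).exists_bound_of_continuousOn hF.continuousOn
  refine Integrable.mono' ((integrableOn_norm_rpow_closedBall hd hγ R).const_mul (2 * B)) ?_ ?_
  · have h1 : Continuous fun z => projSq z (F z) := continuous_projSq.clm_apply hF
    exact ((measurable_landauNearWeight hε).smul h1.measurable).aestronglyMeasurable
  · filter_upwards [ae_restrict_mem measurableSet_closedBall] with z hz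
    exact norm_landauNearWeight_smul_le B (hB z hz)

theorem setIntegral_ball_sub {F : Type*} [NormedAddCommGroup F] [NormedSpace ℝ F] (h : E d → F)
    (u : E d) (R : ℝ) :
    ∫ w in Metric.ball u R, h w = ∫ z in Metric.ball 0 R, h (u - z) := by
  rw [← integral_indicator measurableSet_ball, ← integral_indicator measurableSet_ball,
    ← integral_sub_left_eq_self _ volume u]
  refine integral_congr_ae (ae_of_all _ fun z => ?_)
  by_cases hz : z ∈ Metric.ball (0 : E d) R
  · have hz' : u - z ∈ Metric.ball u R := by
      simpa [dist_eq_norm] using hz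
    simp only [Set.indicator_of_mem hz, Set.indicator_of_mem hz']
  · have hz' : u - z ∉ Metric.ball u R := by
      simpa [dist_eq_norm] using hz
    simp only [Set.indicator_of_notMem hz, Set.indicator_of_notMem hz']

/-- Tested against a fixed vector `e`, the symmetry of `projSq` moves it onto `e`, and
`integral_ball_radial_field` applies to `z ↦ f (u - z)`. -/
theorem integral_ball_projSq_gradient {f : E d → ℝ} (hf : ContDiff ℝ 2 f) (hε : 0 < ε) {R : ℝ}
    (hR : 0 < R) (u : E d) :
    ∫ z in Metric.ball 0 R, landauWeight γ ε (‖z‖ ^ 2) • projSq z (gradient f (u - z)) =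
      -((d - 1 : ℝ) • ∫ z in Metric.ball 0 R, f (u - z) • landauWeight γ ε (‖z‖ ^ 2) • z) := by
  have hw : Continuous fun z : E d => landauWeight γ ε (‖z‖ ^ 2) :=
    (contDiff_radial (contDiff_landauWeight hε)).continuous
  have hG := (contDiff_gradient hf).continuous
  have hfc := hf.continuous
  have hon : ∀ {F : Type} [NormedAddCommGroup F] [NormedSpace ℝ F] {h : E d → F}, Continuous h →
      IntegrableOn h (Metric.ball 0 R) := fun hh =>
    (hh.continuousOn.integrableOn_compact (isCompact_closedBall (0 : E d) R)).mono_set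
      Metric.ball_subset_closedBall
  have hc1 : Continuous fun z => landauWeight γ ε (‖z‖ ^ 2) • projSq z (gradient f (u - z)) :=
    hw.smul (continuous_projSq.clm_apply (by fun_prop))
  have hc2 : Continuous fun z => f (u - z) • landauWeight γ ε (‖z‖ ^ 2) • z := by fun_prop
  refine ext_inner_left ℝ fun e => ?_
  rw [← integral_inner (hon hc1), inner_neg_right, real_inner_smul_right,
    ← integral_inner (hon hc2)]
  set g : E d → ℝ := fun z => f (u - z) with hg
  have hgc : ContDiff ℝ 1 g := (hf.of_le (by norm_num)).comp (contDiff_const.sub contDiff_id)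
  have h := integral_ball_radial_field (contDiff_landauWeight (γ := γ) hε) hR hgc e
  have hgd : ∀ z h, fderiv ℝ g z h = -inner ℝ h (gradient f (u - z)) := by
    intro z h
    have h1 : HasFDerivAt g ((fderiv ℝ f (u - z)).comp (-ContinuousLinearMap.id ℝ (E d))) z :=
      (hf.differentiable (by norm_num) (u - z)).hasFDerivAt.comp z ((hasFDerivAt_id z).const_sub u)
    rw [h1.fderiv, real_inner_comm, inner_gradient]
    simp
  simp only [hgd, integral_neg] at h
  rw [neg_eq_iff_eq_neg] at h
  calc ∫ z in Metric.ball 0 R,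
        inner ℝ e (landauWeight γ ε (‖z‖ ^ 2) • projSq z (gradient f (u - z)))
      = ∫ z in Metric.ball 0 R,
        inner ℝ (landauWeight γ ε (‖z‖ ^ 2) • projSq z e) (gradient f (u - z)) := by
        refine integral_congr_ae (ae_of_all _ fun z => ?_)
        simp only [real_inner_smul_right, real_inner_smul_left, inner_projSq]
    _ = _ := h
    _ = _ := by
        congr 2
        refine integral_congr_ae (ae_of_all _ fun z => ?_)
        simp only [real_inner_smul_right, real_inner_comm z e, hg]
        ring

end LandauFlux

/-! ### Convergence of the truncated Landau flux. -/

section LandauSplitting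

variable {d : ℕ} {γ ε : ℝ}

/-- Only the regular part of the kernel is integrated by parts. Afterwards `∇f` is evaluated at `u`
alone and the integration variable enters through `f`, whose decay is known. -/
theorem landauFluxTrunc_eq (hd : 2 ≤ d) (hγ : -(d : ℝ) < γ + 2) (hε : 0 < ε) {f : E d → ℝ}
    (hf : ContDiff ℝ 2 f) {R : ℝ} (hR : 2 * ε < R) (u : E d) :
    landauFluxTrunc γ f f R u = landauNear γ ε f u +
      ∫ z in Metric.ball 0 R, landauFarIntegrand γ ε f u (u - z) := by
  have hR0 : 0 < R := by linarith
  have hG := (contDiff_gradient hf).continuous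
  have hfc := hf.continuous
  have hw : Continuous fun z : E d => landauWeight γ ε (‖z‖ ^ 2) :=
    (contDiff_radial (contDiff_landauWeight hε)).continuous
  have hon : ∀ {F : Type} [NormedAddCommGroup F] [NormedSpace ℝ F] {h : E d → F}, Continuous h →
      IntegrableOn h (Metric.ball 0 R) := fun hh =>
    (hh.continuousOn.integrableOn_compact (isCompact_closedBall (0 : E d) R)).mono_set
      Metric.ball_subset_closedBall
  have hc := continuous_landauCommutator hf u
  have hnear : IntegrableOn (fun z => landauNearWeight γ ε z • projSq z (landauCommutator f u z))
      (Metric.ball 0 R) :=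
    (integrableOn_landauNear hd hγ hε hc R).mono_set Metric.ball_subset_closedBall
  have hreg : Continuous fun z =>
      landauWeight γ ε (‖z‖ ^ 2) • projSq z (landauCommutator f u z) :=
    hw.smul (continuous_projSq.clm_apply hc)
  have h1 : landauFluxTrunc γ f f R u = ∫ z in Metric.ball 0 R,
      (landauNearWeight γ ε z • projSq z (landauCommutator f u z) +
        landauWeight γ ε (‖z‖ ^ 2) • projSq z (landauCommutator f u z)) := by
    rw [landauFluxTrunc, setIntegral_ball_sub]
    refine integral_congr_ae (ae_restrict_of_ae ?_)
    have : Nontrivial (E d) :=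
      Module.nontrivial_of_finrank_pos (R := ℝ) (by rw [finrank_euclideanSpace_fin]; omega)
    have h0 : ∀ᵐ z : E d, z ≠ 0 := by
      rw [ae_iff]
      simp
    filter_upwards [h0] with z hz
    simp only [sub_sub_cancel]
    rw [norm_rpow_smul_perpProj γ hz, ← add_smul, landauNearWeight, sub_add_cancel]
    rfl
  have h2 : ∫ z in Metric.ball 0 R, landauNearWeight γ ε z • projSq z (landauCommutator f u z) =
      landauNear γ ε f u := by
    rw [landauNear]
    refine (setIntegral_eq_of_subset_of_forall_sdiff_eq_zero measurableSet_ball ?_ ?_)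
    · exact Metric.closedBall_subset_ball hR
    · intro z hz
      have hz2 : 2 * ε ≤ ‖z‖ := by
        have := hz.2
        rw [mem_closedBall_zero_iff, not_le] at this
        exact this.le
      rw [landauNearWeight_eq_zero hε hz2, zero_smul]
  rw [h1, integral_add hnear (hon hreg), h2]
  congr 1
  have hA : Continuous fun z =>
      f (u - z) • landauWeight γ ε (‖z‖ ^ 2) • projSq z (gradient f u) := by
    have : Continuous fun z : E d => projSq z (gradient f u) :=
      continuous_projSq.clm_apply continuous_const
    fun_prop
  have hB : Continuous fun z =>
      landauWeight γ ε (‖z‖ ^ 2) • projSq z (gradient f (u - z)) :=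
    hw.smul (continuous_projSq.clm_apply (by fun_prop))
  have hC : Continuous fun z => f (u - z) • landauWeight γ ε (‖z‖ ^ 2) • z := by fun_prop
  have h3 : ∫ z in Metric.ball 0 R,
      landauWeight γ ε (‖z‖ ^ 2) • projSq z (landauCommutator f u z) =
      (∫ z in Metric.ball 0 R, f (u - z) • landauWeight γ ε (‖z‖ ^ 2) • projSq z (gradient f u)) -
      f u • ∫ z in Metric.ball 0 R,
        landauWeight γ ε (‖z‖ ^ 2) • projSq z (gradient f (u - z)) := by
    have hB' : Continuous fun z =>
        f u • landauWeight γ ε (‖z‖ ^ 2) • projSq z (gradient f (u - z)) := hB.const_smul (f u)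
    rw [← integral_smul, ← integral_sub (hon hA) (hon hB')]
    refine integral_congr_ae (ae_of_all _ fun z => ?_)
    simp only [landauCommutator, map_sub, map_smul]
    module
  rw [h3, integral_ball_projSq_gradient hf hε hR0]
  have h4 : ∫ z in Metric.ball 0 R, landauFarIntegrand γ ε f u (u - z) =
      (∫ z in Metric.ball 0 R, f (u - z) • landauWeight γ ε (‖z‖ ^ 2) • projSq z (gradient f u)) +
      ((d - 1) * f u) • ∫ z in Metric.ball 0 R, f (u - z) • landauWeight γ ε (‖z‖ ^ 2) • z := by
    have hC' : Continuous fun z =>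
        ((d - 1) * f u) • f (u - z) • landauWeight γ ε (‖z‖ ^ 2) • z :=
      hC.const_smul ((d - 1) * f u)
    rw [← integral_smul, ← integral_add (hon hA) (hon hC')]
    refine integral_congr_ae (ae_of_all _ fun z => ?_)
    simp only [landauFarIntegrand, sub_sub_cancel]
    module
  rw [h4]
  module

/-- Away from the singularity, lower powers of `‖z‖` are absorbed into `‖z‖ ^ (γ + 2)` at the cost
of powers of `ε⁻¹`. -/
theorem norm_rpow_mul_pow_le {p : ℝ} {j k : ℕ} (hjk : j ≤ k) {a b : ℝ} (ha : 0 < a) (hab : a ≤ b) :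
    b ^ p * b ^ j ≤ a⁻¹ ^ (k - j) * b ^ (p + k) := by
  have hb := ha.trans_le hab
  rw [Real.rpow_add_natCast hb.ne']
  obtain ⟨i, rfl⟩ := Nat.exists_eq_add_of_le hjk
  have h1 : 1 ≤ a⁻¹ ^ i * b ^ i := by
    rw [← mul_pow]
    refine one_le_pow₀ ?_
    rw [inv_mul_eq_div, one_le_div ha]
    exact hab
  rw [Nat.add_sub_cancel_left, pow_add]
  calc b ^ p * b ^ j ≤ b ^ p * b ^ j * (a⁻¹ ^ i * b ^ i) :=
        le_mul_of_one_le_right (by positivity) h1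
    _ = _ := by ring

theorem norm_landauFarIntegrand_le (hd : 2 ≤ d) (hε : 0 < ε) (f : E d → ℝ) (u w : E d) :
    ‖landauFarIntegrand γ ε f u w‖ ≤ |f w| * ((2 * ‖gradient f u‖ + d * |f u| * ε⁻¹) *
      ‖u - w‖ ^ (γ + 2)) := by
  rw [landauFarIntegrand, norm_smul, Real.norm_eq_abs]
  gcongr
  set z := u - w
  rcases le_or_gt ‖z‖ ε with hz | hz
  · rw [landauWeight_eq_zero hε (by gcongr)]
    simp only [zero_smul, smul_zero, add_zero, norm_zero]
    positivity
  · have hz0 := hε.trans hz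
    have hw0 := landauWeight_nonneg (γ := γ) (ε := ε) (sq_nonneg ‖z‖)
    have hw1 := landauWeight_le (γ := γ) (ε := ε) (sq_nonneg ‖z‖)
    rw [norm_sq_rpow_half] at hw1
    have hd1 : (1 : ℝ) ≤ d := by exact_mod_cast (by omega : 1 ≤ d)
    refine (norm_add_le _ _).trans ?_
    rw [add_mul]
    refine add_le_add ?_ ?_
    · rw [norm_smul, Real.norm_of_nonneg hw0]
      calc landauWeight γ ε (‖z‖ ^ 2) * ‖projSq z (gradient f u)‖
          ≤ ‖z‖ ^ γ * (2 * ‖z‖ ^ 2 * ‖gradient f u‖) := by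
            gcongr
            exact norm_projSq_apply_le _ _
        _ = 2 * ‖gradient f u‖ * (‖z‖ ^ γ * ‖z‖ ^ 2) := by ring
        _ ≤ 2 * ‖gradient f u‖ * ‖z‖ ^ (γ + 2) := by
            gcongr
            have := norm_rpow_mul_pow_le (p := γ) (le_refl 2) hε hz.le
            simpa using this
    · rw [norm_smul, norm_smul, norm_mul, Real.norm_of_nonneg hw0,
        Real.norm_of_nonneg (by linarith : (0 : ℝ) ≤ d - 1), Real.norm_eq_abs]
      calc (d - 1) * |f u| * (landauWeight γ ε (‖z‖ ^ 2) * ‖z‖)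
          ≤ d * |f u| * (‖z‖ ^ γ * ‖z‖) := by
            gcongr
            linarith
        _ ≤ d * |f u| * (ε⁻¹ * ‖z‖ ^ (γ + 2)) := by
            refine mul_le_mul_of_nonneg_left ?_ (by positivity)
            have := norm_rpow_mul_pow_le (p := γ) (by norm_num : 1 ≤ 2) hε hz.le
            simpa using this
        _ = _ := by ring

theorem continuous_landauFarIntegrand (hε : 0 < ε) {f : E d → ℝ} (hf : ContDiff ℝ 2 f) (u : E d) :
    Continuous (landauFarIntegrand γ ε f u) := by
  have hw : Continuous fun z : E d => landauWeight γ ε (‖z‖ ^ 2) :=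
    (contDiff_radial (contDiff_landauWeight hε)).continuous
  have hw' : Continuous fun w : E d => landauWeight γ ε (‖u - w‖ ^ 2) :=
    hw.comp (continuous_const.sub continuous_id)
  have hp : Continuous fun w : E d => projSq (u - w) (gradient f u) :=
    (continuous_projSq.comp (continuous_const.sub continuous_id)).clm_apply continuous_const
  have hfc := hf.continuous
  unfold landauFarIntegrand
  fun_prop

theorem integrable_landauFarIntegrand (hd : 2 ≤ d) (hγ : -(d : ℝ) < γ + 2) (hε : 0 < ε)
    {f : E d → ℝ} (hf : ContDiff ℝ 2 f) {N m : ℝ} (hm : d + 2 + γ < m) (hf0 : ∀ w, 0 ≤ f w)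
    (hle : ∀ w, f w ≤ N * bracket w ^ (-m)) (u : E d) :
    Integrable (landauFarIntegrand γ ε f u) := by
  have h := (integrable_norm_sub_rpow_mul_bracket hd hγ (m := m) (by linarith) u).const_mul
    (N * (2 * ‖gradient f u‖ + d * |f u| * ε⁻¹))
  refine h.mono' (continuous_landauFarIntegrand hε hf u).aestronglyMeasurable
    (ae_of_all _ fun w => ?_)
  refine (norm_landauFarIntegrand_le hd hε f u w).trans ?_
  rw [abs_of_nonneg (hf0 w)]
  calc f w * ((2 * ‖gradient f u‖ + d * |f u| * ε⁻¹) * ‖u - w‖ ^ (γ + 2))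
      ≤ N * bracket w ^ (-m) * ((2 * ‖gradient f u‖ + d * |f u| * ε⁻¹) * ‖u - w‖ ^ (γ + 2)) := by
        gcongr
        exact hle w
    _ = _ := by ring

/-- The limit is represented with an arbitrary `ε`, although it does not depend on it; this freedom
is used at the end. The condition `d + 2 + γ < m` makes `‖u - w‖ ^ (γ + 2) * bracket w ^ (-m)`
integrable. -/
theorem tendsto_landauFluxTrunc (hd : 2 ≤ d) (hγ : -(d : ℝ) < γ + 2) (hε : 0 < ε)
    {f : E d → ℝ} (hf : ContDiff ℝ 2 f) {N m : ℝ} (hm : d + 2 + γ < m) (hf0 : ∀ w, 0 ≤ f w)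
    (hle : ∀ w, f w ≤ N * bracket w ^ (-m)) (u : E d) :
    Tendsto (fun R : ℝ => landauFluxTrunc γ f f R u) atTop
      (𝓝 (landauNear γ ε f u + ∫ w, landauFarIntegrand γ ε f u w)) := by
  have hint := integrable_landauFarIntegrand hd hγ hε hf hm hf0 hle u
  have h1 : Tendsto (fun R : ℝ => ∫ z in Metric.ball 0 R, landauFarIntegrand γ ε f u (u - z)) atTop
      (𝓝 (∫ w, landauFarIntegrand γ ε f u w)) := by
    rw [← integral_sub_left_eq_self _ volume u]
    exact (aecover_ball tendsto_id).integral_tendsto_of_countably_generated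
      (hint.comp_sub_left u)
  refine (h1.const_add (landauNear γ ε f u)).congr' ?_
  filter_upwards [eventually_gt_atTop (2 * ε)] with R hR
  exact (landauFluxTrunc_eq hd hγ hε hf hR u).symm

end LandauSplitting

/-! ### Divergence of the singular part of the flux. -/

section LandauDivergence

variable {d : ℕ} {γ ε : ℝ}

/-- The derivative of `u ↦ f(u - z) ∇f(u) - f(u) ∇f(u - z)`. -/
def landauCommutatorDeriv (f : E d → ℝ) (u z : E d) : E d →L[ℝ] E d :=
  (f (u - z) • fderiv ℝ (gradient f) u + (fderiv ℝ f (u - z)).smulRight (gradient f u)) -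
    (f u • fderiv ℝ (gradient f) (u - z) + (fderiv ℝ f u).smulRight (gradient f (u - z)))

theorem hasFDerivAt_landauCommutator {f : E d → ℝ} (hf : ContDiff ℝ 2 f) (u z : E d) :
    HasFDerivAt (fun u => landauCommutator f u z) (landauCommutatorDeriv f u z) u := by
  have hfd := hf.differentiable (by norm_num)
  have hGd := (contDiff_gradient hf).differentiable one_ne_zero
  have h1 : HasFDerivAt (fun u => f (u - z)) (fderiv ℝ f (u - z)) u := by
    have := (hfd (u - z)).hasFDerivAt.comp u ((hasFDerivAt_id u).sub_const z)
    exact this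
  have h2 : HasFDerivAt (fun u => gradient f (u - z)) (fderiv ℝ (gradient f) (u - z)) u := by
    have := (hGd (u - z)).hasFDerivAt.comp u ((hasFDerivAt_id u).sub_const z)
    exact this
  exact (h1.smul (hGd u).hasFDerivAt).sub ((hfd u).hasFDerivAt.smul h2)

theorem continuous_landauCommutatorDeriv {f : E d → ℝ} (hf : ContDiff ℝ 2 f) :
    Continuous fun p : E d × E d => landauCommutatorDeriv f p.1 p.2 := by
  have h0 := hf.continuous
  have h1 := hf.continuous_fderiv (by norm_num)
  have h2 := (contDiff_gradient hf).continuous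
  have h3 := (contDiff_gradient hf).continuous_fderiv one_ne_zero
  have hs := (ContinuousLinearMap.smulRightL ℝ (E d) (E d)).continuous₂
  have ha : Continuous fun p : E d × E d =>
      (fderiv ℝ f (p.1 - p.2)).smulRight (gradient f p.1) :=
    hs.comp ((h1.comp (continuous_fst.sub continuous_snd)).prodMk (h2.comp continuous_fst))
  have hb : Continuous fun p : E d × E d =>
      (fderiv ℝ f p.1).smulRight (gradient f (p.1 - p.2)) :=
    hs.comp ((h1.comp continuous_fst).prodMk (h2.comp (continuous_fst.sub continuous_snd)))
  unfold landauCommutatorDeriv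
  fun_prop

/-- In the variable `z` the kernel does not depend on `u`, so all derivatives fall on the `C²`
function `f`. The constant `B` is chosen before `ε`, hence this contribution disappears as `ε → 0`.
-/
theorem exists_hasFDerivAt_landauNear (hd : 2 ≤ d) (hγ : -(d : ℝ) < γ + 2) {f : E d → ℝ}
    (hf : ContDiff ℝ 2 f) (v : E d) :
    ∃ B : ℝ, ∀ ε, 0 < ε → ε ≤ 1 / 2 → ∃ A : E d →L[ℝ] E d, HasFDerivAt (landauNear γ ε f) A v ∧
      ‖A‖ ≤ B * ∫ z in Metric.closedBall (0 : E d) (2 * ε), ‖z‖ ^ (γ + 2) := by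
  obtain ⟨B, hB⟩ := ((isCompact_closedBall v 1).prod
    (isCompact_closedBall (0 : E d) 1)).exists_bound_of_continuousOn
      (continuous_landauCommutatorDeriv hf).continuousOn
  refine ⟨2 * B, fun ε hε hε2 => ?_⟩
  have hsub : Metric.closedBall (0 : E d) (2 * ε) ⊆ Metric.closedBall 0 1 :=
    Metric.closedBall_subset_closedBall (by linarith)
  have hint := (integrableOn_norm_rpow_closedBall hd hγ (2 * ε)).const_mul (2 * B)
  have hbd : ∀ z ∈ Metric.closedBall (0 : E d) (2 * ε), ∀ u ∈ Metric.closedBall v 1,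
      ‖landauNearWeight γ ε z • (projSq z).comp (landauCommutatorDeriv f u z)‖ ≤
        2 * B * ‖z‖ ^ (γ + 2) := by
    intro z hz u hu
    have hBz := hB (u, z) ⟨hu, hsub hz⟩
    have hB0 := (norm_nonneg _).trans hBz
    refine ContinuousLinearMap.opNorm_le_bound _ (by positivity) fun h => ?_
    have := norm_landauNearWeight_smul_le (γ := γ) (ε := ε) (B * ‖h‖) (z := z)
      (y := landauCommutatorDeriv f u z h) ((ContinuousLinearMap.le_opNorm _ _).trans (by gcongr))
    calc _ ≤ 2 * (B * ‖h‖) * ‖z‖ ^ (γ + 2) := this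
      _ = _ := by ring
  have hmeas : AEStronglyMeasurable (fun z => landauNearWeight γ ε z •
      (projSq z).comp (landauCommutatorDeriv f v z))
      (volume.restrict (Metric.closedBall 0 (2 * ε))) := by
    have h0 : Continuous fun z => landauCommutatorDeriv f v z := by
      have hc := continuous_landauCommutatorDeriv hf
      exact Continuous.uncurry_left (f := landauCommutatorDeriv f) v hc
    have h1 : Continuous fun z => (projSq z).comp (landauCommutatorDeriv f v z) :=
      continuous_projSq.clm_comp h0
    have h2 : AEStronglyMeasurable (fun z : E d => landauNearWeight γ ε z)
        (volume.restrict (Metric.closedBall 0 (2 * ε))) :=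
      (measurable_landauNearWeight hε).aestronglyMeasurable
    have h3 : AEStronglyMeasurable (fun z => (projSq z).comp (landauCommutatorDeriv f v z))
        (volume.restrict (Metric.closedBall 0 (2 * ε))) := h1.aestronglyMeasurable
    exact h2.smul h3
  have key := hasFDerivAt_integral_of_dominated_of_fderiv_le
    (μ := volume.restrict (Metric.closedBall (0 : E d) (2 * ε))) (x₀ := v) (s := Metric.ball v 1)
    (F := fun u z => landauNearWeight γ ε z • projSq z (landauCommutator f u z))
    (F' := fun u z => landauNearWeight γ ε z • (projSq z).comp (landauCommutatorDeriv f u z))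
    (bound := fun z => 2 * B * ‖z‖ ^ (γ + 2)) (Metric.ball_mem_nhds v one_pos)
    (Eventually.of_forall fun u =>
      (integrableOn_landauNear hd hγ hε (continuous_landauCommutator hf u) _).aestronglyMeasurable)
    (integrableOn_landauNear hd hγ hε (continuous_landauCommutator hf v) _) hmeas
    (by
      filter_upwards [ae_restrict_mem measurableSet_closedBall] with z hz u hu
      exact hbd z hz u (Metric.ball_subset_closedBall hu)) hint
    (ae_of_all _ fun z u _ => by
      have := ((projSq z).hasFDerivAt.comp u (hasFDerivAt_landauCommutator hf u z)).const_smul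
        (landauNearWeight γ ε z)
      exact this)
  refine ⟨_, key, ?_⟩
  rw [← integral_const_mul]
  refine norm_integral_le_of_norm_le hint ?_
  filter_upwards [ae_restrict_mem measurableSet_closedBall] with z hz
  exact hbd z hz v (Metric.mem_closedBall_self zero_le_one)

end LandauDivergence

/-! ### Divergence of the regular part of the flux. -/

section LandauFar

variable {d : ℕ} {γ ε : ℝ}

/-- The derivative in `u` of `landauFarIntegrand γ ε f u w`. -/
def landauFarDeriv (γ ε : ℝ) (f : E d → ℝ) (u w : E d) : E d →L[ℝ] E d :=
  f w • (fieldDeriv (landauWeight γ ε) (u - w) (gradient f u) (fderiv ℝ (gradient f) u) +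
    (d - 1 : ℝ) • ((fderiv ℝ f u).smulRight (landauWeight γ ε (‖u - w‖ ^ 2) • (u - w)) +
      f u • (((2 * deriv (landauWeight γ ε) (‖u - w‖ ^ 2)) • innerSL ℝ (u - w)).smulRight (u - w) +
        landauWeight γ ε (‖u - w‖ ^ 2) • ContinuousLinearMap.id ℝ (E d))))

theorem hasFDerivAt_landauFarIntegrand (hε : 0 < ε) {f : E d → ℝ} (hf : ContDiff ℝ 2 f)
    (u w : E d) :
    HasFDerivAt (fun u => landauFarIntegrand γ ε f u w) (landauFarDeriv γ ε f u w) u := by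
  have hr := (contDiff_landauWeight (γ := γ) hε).differentiable one_ne_zero
  have hfd := (hf.differentiable (by norm_num) u).hasFDerivAt
  have hGd := ((contDiff_gradient hf).differentiable one_ne_zero u).hasFDerivAt
  have h1 := hasFDerivAt_radial_smul_projSq hr hGd w
  have h2 := (hasFDerivAt_radial hr u w).smul ((hasFDerivAt_id u).sub_const w)
  have h3 := (hfd.const_mul ((d : ℝ) - 1)).smul h2
  refine ((h1.add h3).const_smul (f w)).congr_fderiv ?_
  rw [landauFarDeriv]
  congr 2
  ext1 h
  simp only [_root_.add_apply, _root_.smul_apply, ContinuousLinearMap.smulRight_apply,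
    innerSL_apply_apply, ContinuousLinearMap.id_apply, smul_eq_mul, Pi.smul_apply', id]
  module

/-- The first-order terms `(d - 1) * inner ℝ z ∇f` of the two summands cancel. What remains is the
nondivergence form: a diffusion term in the Hessian and a zeroth-order reaction term. -/
theorem trc_landauFarDeriv (f : E d → ℝ) (u w : E d) :
    trc (landauFarDeriv γ ε f u w) = f w * (landauWeight γ ε (‖u - w‖ ^ 2) *
      (‖u - w‖ ^ 2 * trc (fderiv ℝ (gradient f) u) -
        inner ℝ (u - w) (fderiv ℝ (gradient f) u (u - w))) +
      (d - 1) * f u * (2 * (‖u - w‖ ^ 2 * deriv (landauWeight γ ε) (‖u - w‖ ^ 2)) +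
        d * landauWeight γ ε (‖u - w‖ ^ 2))) := by
  rw [landauFarDeriv, map_smul, map_add, trc_fieldDeriv]
  simp only [map_add, map_smul, trc_smulRight, trc_id, _root_.smul_apply, innerSL_apply_apply,
    real_inner_self_eq_norm_sq, smul_eq_mul, ← inner_gradient, real_inner_comm (u - w)]
  ring

theorem exists_norm_landauFarDeriv_le (d : ℕ) (hd : 2 ≤ d) (γ : ℝ) (hε : 0 < ε) :
    ∃ C : ℝ, 0 ≤ C ∧ ∀ (f : E d → ℝ) (u w : E d),
      (‖u - w‖ < ε → landauFarDeriv γ ε f u w = 0) ∧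
      ‖landauFarDeriv γ ε f u w‖ ≤ |f w| *
        (C * (‖gradient f u‖ + ‖fderiv ℝ (gradient f) u‖ + |f u|) * ‖u - w‖ ^ (γ + 2)) := by
  obtain ⟨c, hc, hcb⟩ := exists_abs_mul_deriv_landauWeight_sub_le
  have hd1 : (0 : ℝ) ≤ d - 1 := by
    have : (1 : ℝ) ≤ d := by exact_mod_cast (by omega : 1 ≤ d)
    linarith
  set K := |γ| + c with hK
  have hK0 : 0 ≤ K := by positivity
  set C := (2 * K + 4 + (d - 1)) * ε⁻¹ + 2 + (d - 1) * (K + 1) * ε⁻¹ ^ 2 with hC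
  have hC0 : 0 ≤ C := by positivity
  refine ⟨C, hC0, fun f u w => ?_⟩
  set z := u - w with hz
  have hzero : ‖z‖ < ε → landauFarDeriv γ ε f u w = 0 := by
    intro h
    have h2 : ‖z‖ ^ 2 < ε ^ 2 := by gcongr
    rw [landauFarDeriv, fieldDeriv, ← hz, landauWeight_eq_zero hε h2.le,
      deriv_landauWeight_of_lt hε h2]
    ext1 h
    simp
  refine ⟨hzero, ?_⟩
  rcases lt_or_ge ‖z‖ ε with h | h
  · rw [hzero h, norm_zero]
    positivity
  have hz0 : 0 < ‖z‖ := hε.trans_le h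
  have hw0 := landauWeight_nonneg (γ := γ) (ε := ε) (sq_nonneg ‖z‖)
  have hw1 := landauWeight_le (γ := γ) (ε := ε) (sq_nonneg ‖z‖)
  rw [norm_sq_rpow_half] at hw1
  set ρ := landauWeight γ ε (‖z‖ ^ 2) with hρ
  set ρ' := deriv (landauWeight γ ε) (‖z‖ ^ 2) with hρ'
  set P := ‖z‖ ^ γ with hP
  have hP0 : 0 ≤ P := by positivity
  have hder : 2 * (‖z‖ ^ 2 * |ρ'|) ≤ K * P := by
    have h1 := (hcb γ ε (‖z‖ ^ 2) hε (sq_nonneg _)).1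
    rw [norm_sq_rpow_half] at h1
    have h2 : |2 * (‖z‖ ^ 2 * ρ')| ≤ |2 * (‖z‖ ^ 2 * ρ') - γ * ρ| + |γ * ρ| := by
      have := abs_add_le (2 * (‖z‖ ^ 2 * ρ') - γ * ρ) (γ * ρ)
      rwa [sub_add_cancel] at this
    rw [abs_mul, abs_mul, abs_two, abs_of_nonneg (sq_nonneg ‖z‖), abs_mul γ,
      abs_of_nonneg hw0] at h2
    calc _ ≤ _ := h2
      _ ≤ c * P + |γ| * P := by gcongr
      _ = K * P := by ring
  set g := ‖gradient f u‖ with hg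
  set H := ‖fderiv ℝ (gradient f) u‖ with hH
  have hfg : ‖fderiv ℝ f u‖ = g := by
    rw [hg, gradient, LinearIsometryEquiv.norm_map]
  have hg0 : 0 ≤ g := norm_nonneg _
  have hH0 : 0 ≤ H := norm_nonneg _
  have h1 := norm_fieldDeriv_le (landauWeight γ ε) z (gradient f u) (fderiv ℝ (gradient f) u)
  rw [← hρ, ← hρ', abs_of_nonneg hw0, ← hg, ← hH] at h1
  have h2 : ‖(fderiv ℝ f u).smulRight (ρ • z)‖ ≤ g * (ρ * ‖z‖) := by
    refine (norm_smulRight_le _ _).trans ?_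
    rw [norm_smul, Real.norm_of_nonneg hw0, hfg]
  have h3 : ‖((2 * ρ') • innerSL ℝ z).smulRight z + ρ • ContinuousLinearMap.id ℝ (E d)‖ ≤
      2 * (‖z‖ ^ 2 * |ρ'|) + ρ := by
    refine (norm_add_le _ _).trans (add_le_add ?_ ?_)
    · refine (norm_smulRight_le _ _).trans ?_
      rw [norm_smul, innerSL_apply_norm, Real.norm_eq_abs, abs_mul, abs_two]
      apply le_of_eq
      ring
    · rw [norm_smul, Real.norm_of_nonneg hw0]
      exact mul_le_of_le_one_right hw0 ContinuousLinearMap.norm_id_le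
  have hP1 : P * ‖z‖ ≤ ε⁻¹ * ‖z‖ ^ (γ + 2) := by
    have := norm_rpow_mul_pow_le (p := γ) (by norm_num : 1 ≤ 2) hε h
    simpa using this
  have hP2 : P * ‖z‖ ^ 2 ≤ ‖z‖ ^ (γ + 2) := by
    have := norm_rpow_mul_pow_le (p := γ) (le_refl 2) hε h
    simpa using this
  have hP3 : P ≤ ε⁻¹ ^ 2 * ‖z‖ ^ (γ + 2) := by
    have := norm_rpow_mul_pow_le (p := γ) (by norm_num : 0 ≤ 2) hε h
    simpa using this
  set Z := ‖z‖ ^ (γ + 2) with hZ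
  have hZ0 : 0 ≤ Z := by positivity
  rw [landauFarDeriv, norm_smul, Real.norm_eq_abs]
  refine mul_le_mul_of_nonneg_left ?_ (abs_nonneg _)
  refine (norm_add_le _ _).trans ?_
  rw [norm_smul, Real.norm_of_nonneg hd1]
  have h4 : ‖(fderiv ℝ f u).smulRight (ρ • z) + f u • (((2 * ρ') • innerSL ℝ z).smulRight z +
      ρ • ContinuousLinearMap.id ℝ (E d))‖ ≤ g * (P * ‖z‖) + |f u| * ((K + 1) * P) := by
    refine (norm_add_le _ _).trans (add_le_add (h2.trans (by gcongr)) ?_)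
    rw [norm_smul, Real.norm_eq_abs]
    gcongr
    linarith
  have h5 : 4 * |ρ'| * ‖z‖ ^ 3 * g + ρ * (4 * ‖z‖ * g + 2 * ‖z‖ ^ 2 * H) ≤
      (2 * K + 4) * g * (P * ‖z‖) + 2 * H * (P * ‖z‖ ^ 2) := by
    calc _ = 2 * (2 * (‖z‖ ^ 2 * |ρ'|)) * (‖z‖ * g) + ρ * (4 * ‖z‖ * g + 2 * ‖z‖ ^ 2 * H) := by ring
      _ ≤ 2 * (K * P) * (‖z‖ * g) + P * (4 * ‖z‖ * g + 2 * ‖z‖ ^ 2 * H) := by gcongr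
      _ = _ := by ring
  calc _ ≤ ((2 * K + 4) * g * (P * ‖z‖) + 2 * H * (P * ‖z‖ ^ 2)) +
        (d - 1) * (g * (P * ‖z‖) + |f u| * ((K + 1) * P)) :=
        add_le_add (h1.trans h5) (mul_le_mul_of_nonneg_left h4 hd1)
    _ = (2 * K + 4 + (d - 1)) * g * (P * ‖z‖) + 2 * H * (P * ‖z‖ ^ 2) +
        (d - 1) * (K + 1) * |f u| * P := by ring
    _ ≤ (2 * K + 4 + (d - 1)) * g * (ε⁻¹ * Z) + 2 * H * Z +
        (d - 1) * (K + 1) * |f u| * (ε⁻¹ ^ 2 * Z) := by gcongr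
    _ = ((2 * K + 4 + (d - 1)) * ε⁻¹ * g + 2 * H + (d - 1) * (K + 1) * ε⁻¹ ^ 2 * |f u|) * Z := by
        ring
    _ ≤ (C * g + C * H + C * |f u|) * Z := by
        have e1 : 0 ≤ (2 * K + 4 + (d - 1)) * ε⁻¹ := by positivity
        have e2 : 0 ≤ (d - 1) * (K + 1) * ε⁻¹ ^ 2 := by positivity
        gcongr <;> linarith
    _ = _ := by ring

theorem rpow_le_two_rpow_mul {a b p : ℝ} (ha : 0 < a) (hb : 0 < b) (hab : a ≤ 2 * b)
    (hba : b ≤ 2 * a) : a ^ p ≤ 2 ^ |p| * b ^ p := by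
  rcases le_total 0 p with hp | hp
  · rw [abs_of_nonneg hp, ← Real.mul_rpow zero_le_two hb.le]
    exact Real.rpow_le_rpow ha.le hab hp
  · rw [abs_of_nonpos hp, Real.rpow_neg zero_le_two, ← Real.inv_rpow zero_le_two,
      ← Real.mul_rpow (by norm_num) hb.le]
    exact Real.rpow_le_rpow_of_nonpos (by positivity) (by linarith) hp

theorem continuous_landauFarDeriv (hε : 0 < ε) {f : E d → ℝ} (hf : ContDiff ℝ 2 f) (u : E d) :
    Continuous (landauFarDeriv γ ε f u) := by
  have hw : Continuous fun w : E d => landauWeight γ ε (‖u - w‖ ^ 2) :=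
    (contDiff_radial (contDiff_landauWeight hε)).continuous.comp
      (continuous_const.sub continuous_id)
  have hw' : Continuous fun w : E d => deriv (landauWeight γ ε) (‖u - w‖ ^ 2) :=
    ((contDiff_landauWeight hε).continuous_deriv le_rfl).comp (by fun_prop)
  have hz : Continuous fun w : E d => u - w := by fun_prop
  have hi : Continuous fun w : E d => innerSL ℝ (u - w) := (innerSL ℝ).continuous.comp hz
  have hp : Continuous fun w : E d => projSq (u - w) := continuous_projSq.comp hz
  have hpG : Continuous fun w : E d => projSq (u - w) (gradient f u) :=
    hp.clm_apply continuous_const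
  have hpH : Continuous fun w : E d => (projSq (u - w)).comp (fderiv ℝ (gradient f) u) :=
    hp.clm_comp continuous_const
  have hs : ∀ {l : E d → E d →L[ℝ] ℝ} {b : E d → E d}, Continuous l → Continuous b →
      Continuous fun w => (l w).smulRight (b w) := fun hl hb =>
    ((ContinuousLinearMap.smulRightL ℝ (E d) (E d)).continuous₂).comp (hl.prodMk hb)
  have hfc := hf.continuous
  have c1 := hs ((hw'.const_mul 2).smul hi) hpG
  have c2 := hs (hi.const_smul 2) (continuous_const (y := gradient f u))
  have c3 := hs (continuous_const (y := innerSL ℝ (gradient f u))) hz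
  have c4 : Continuous fun w : E d => inner ℝ (u - w) (gradient f u) := by fun_prop
  have c5 := hs (continuous_const (y := fderiv ℝ f u)) (hw.smul hz)
  have c6 := hs ((hw'.const_mul 2).smul hi) hz
  have cid : Continuous fun _ : E d => ContinuousLinearMap.id ℝ (E d) := continuous_const
  exact hfc.smul ((c1.add (hw.smul (((c2.sub c3).sub (c4.smul cid)).add hpH))).add
    ((c5.add ((c6.add (hw.smul cid)).const_smul (f u))).const_smul ((d : ℝ) - 1)))

theorem hasFDerivAt_integral_landauFar (hd : 2 ≤ d) (hγ : -(d : ℝ) < γ + 2) (hε : 0 < ε)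
    (hε1 : ε ≤ 1) {f : E d → ℝ} (hf : ContDiff ℝ 2 f) {N m : ℝ} (hm : d + 2 + γ < m)
    (hf0 : ∀ w, 0 ≤ f w) (hle : ∀ w, f w ≤ N * bracket w ^ (-m)) (v : E d) :
    Integrable (landauFarDeriv γ ε f v) ∧
    HasFDerivAt (fun u => ∫ w, landauFarIntegrand γ ε f u w) (∫ w, landauFarDeriv γ ε f v w) v := by
  obtain ⟨C, hC, hCb⟩ := exists_norm_landauFarDeriv_le d hd γ hε
  have hcont : Continuous fun u => ‖gradient f u‖ + ‖fderiv ℝ (gradient f) u‖ + |f u| := by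
    have h0 := hf.continuous
    have h2 := (contDiff_gradient hf).continuous
    have h3 := (contDiff_gradient hf).continuous_fderiv one_ne_zero
    fun_prop
  obtain ⟨B, hB⟩ := (isCompact_closedBall v 1).exists_bound_of_continuousOn hcont.continuousOn
  have hBv := hB v (Metric.mem_closedBall_self zero_le_one)
  have hB0 : 0 ≤ B := (norm_nonneg _).trans hBv
  have hint := (integrable_norm_sub_rpow_mul_bracket hd hγ (m := m) (by linarith) v).const_mul
    (N * (C * B * 2 ^ |γ + 2|))
  -- For `u` within `ε / 2` of `v`, either the derivative vanishes because `‖u - w‖ < ε`, or `‖u -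
  -- w‖` and `‖v - w‖` agree up to a factor `2`. The dominating function can thus be centred at `v`,
  -- whatever the sign of `γ + 2`.
  have hbound : ∀ w, ∀ u ∈ Metric.ball v (ε / 2), ‖landauFarDeriv γ ε f u w‖ ≤
      N * (C * B * 2 ^ |γ + 2|) * (‖v - w‖ ^ (γ + 2) * bracket w ^ (-m)) := by
    intro w u hu
    have hN : 0 ≤ N * bracket w ^ (-m) := (hf0 w).trans (hle w)
    rcases lt_or_ge ‖u - w‖ ε with h | h
    · rw [(hCb f u w).1 h, norm_zero]
      have : N * (C * B * 2 ^ |γ + 2|) * (‖v - w‖ ^ (γ + 2) * bracket w ^ (-m)) =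
        N * bracket w ^ (-m) * (C * B * 2 ^ |γ + 2| * ‖v - w‖ ^ (γ + 2)) := by ring
      rw [this]
      positivity
    · rw [Metric.mem_ball, dist_eq_norm] at hu
      have hu1 : u ∈ Metric.closedBall v 1 := by
        rw [Metric.mem_closedBall, dist_eq_norm]
        linarith
      have t1 : ‖u - w‖ ≤ ‖v - w‖ + ε / 2 := by
        have := norm_add_le (u - v) (v - w)
        rw [sub_add_sub_cancel] at this
        linarith
      have t2 : ‖v - w‖ ≤ ‖u - w‖ + ε / 2 := by
        have := norm_add_le (v - u) (u - w)
        rw [sub_add_sub_cancel, norm_sub_rev v u] at this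
        linarith
      have hpow := rpow_le_two_rpow_mul (p := γ + 2) (a := ‖u - w‖) (b := ‖v - w‖) (by linarith)
        (by linarith) (by linarith) (by linarith)
      have hBu := (Real.le_norm_self _).trans (hB u hu1)
      calc _ ≤ _ := (hCb f u w).2
        _ ≤ N * bracket w ^ (-m) * (C * B * (2 ^ |γ + 2| * ‖v - w‖ ^ (γ + 2))) := by
            rw [abs_of_nonneg (hf0 w)]
            have := hle w
            gcongr
        _ = _ := by ring
  have hmeas : AEStronglyMeasurable (landauFarDeriv γ ε f v) :=
    (continuous_landauFarDeriv hε hf v).aestronglyMeasurable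
  refine ⟨hint.mono' hmeas (ae_of_all _ fun w => hbound w v (Metric.mem_ball_self (by positivity))),
    ?_⟩
  exact hasFDerivAt_integral_of_dominated_of_fderiv_le
    (Metric.ball_mem_nhds v (half_pos hε))
    (Eventually.of_forall fun u => (continuous_landauFarIntegrand hε hf u).aestronglyMeasurable)
    (integrable_landauFarIntegrand hd hγ hε hf hm hf0 hle v) hmeas
    (ae_of_all _ hbound) hint
    (ae_of_all _ fun w u _ => hasFDerivAt_landauFarIntegrand hε hf u w)

end LandauFar

/-! ### The touching estimate for the Landau operator. -/

section LandauTouching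

variable {d : ℕ} {γ : ℝ}

theorem bracket_le_two_mul_bracket {v w : E d} (h : ‖v - w‖ ≤ 1) : bracket v ≤ 2 * bracket w := by
  have h1 : ‖v‖ ≤ ‖w‖ + 1 := by
    have := norm_add_le (v - w) w
    rw [sub_add_cancel] at this
    linarith
  have h2 := bracket_sq v
  have h3 := bracket_sq w
  have h4 := norm_le_bracket w
  have h5 := one_le_bracket w
  have h6 : bracket v ^ 2 ≤ (bracket w + 1) ^ 2 := by nlinarith [norm_nonneg v, norm_nonneg w]
  have h7 := (abs_le_of_sq_le_sq' h6 (by linarith)).2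
  linarith

theorem le_two_rpow_mul_of_touching {f : E d → ℝ} {N m : ℝ} (hm : 0 ≤ m) (hN : 0 ≤ N)
    (hle : ∀ w, f w ≤ N * bracket w ^ (-m)) {v w : E d} (heq : f v = N * bracket v ^ (-m))
    (h : ‖v - w‖ ≤ 1) : f w ≤ 2 ^ m * f v := by
  have h1 := bracket_le_two_mul_bracket h
  have hv := bracket_pos v
  have hw := bracket_pos w
  have h2 : bracket w ^ (-m) ≤ 2 ^ m * bracket v ^ (-m) := by
    have : bracket w ^ (-m) ≤ (bracket v / 2) ^ (-m) :=
      Real.rpow_le_rpow_of_nonpos (by positivity) (by linarith) (by linarith)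
    rw [Real.div_rpow hv.le zero_le_two, Real.rpow_neg zero_le_two, div_inv_eq_mul] at this
    linarith
  rw [heq]
  calc f w ≤ N * bracket w ^ (-m) := hle w
    _ ≤ N * (2 ^ m * bracket v ^ (-m)) := by gcongr
    _ = _ := by ring

/-- Since `bracket w ≥ 1`, a point `w` in the near zone forces `bracket v > 1 / δ`; then `‖v‖` is
almost `bracket v`, and so is `‖v - w‖`. -/
theorem norm_sub_bounds_of_notMem_farZone {δ : ℝ} (hδ : 0 < δ) (hδ1 : δ < 1 / 4) {v w : E d}
    (hw : w ∉ farZone δ v) :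
    ‖w‖ ≤ δ * bracket v ∧ (1 - 2 * δ) * bracket v ≤ ‖v - w‖ ∧ 1 < δ * bracket v := by
  have h1 : bracket w < δ * bracket v := by
    by_contra! h
    exact hw h
  have h2 := norm_le_bracket w
  have h3 := one_le_bracket w
  have h4 := bracket_sq v
  have h5 := bracket_pos v
  have h6 : (1 - δ) * bracket v ≤ ‖v‖ := by
    refine abs_le_of_sq_le_sq' ?_ (norm_nonneg v) |>.2
    have : 1 ≤ (δ * bracket v) ^ 2 := by nlinarith
    nlinarith
  have h7 := norm_sub_norm_le v w
  refine ⟨by linarith, by linarith, by linarith⟩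

/-- In the near zone the diffusion dominates the reaction. -/
theorem exists_landau_nearZone_nonpos (hd : 2 ≤ d) {m : ℝ} (hγ : -(d : ℝ) ≤ γ) (hm : d + γ < m) :
    ∃ δ : ℝ, 0 < δ ∧ δ < 1 / 4 ∧ ∀ v w : E d, w ∉ farZone δ v →
      m * (m + 2) / bracket v ^ 4 * (‖v - w‖ ^ 2 * ‖v‖ ^ 2 - inner ℝ v (v - w) ^ 2) -
        m / bracket v ^ 2 * ((d - 1) * ‖v - w‖ ^ 2) + (d - 1) * (d + γ) ≤ 0 := by
  have hd1 : (1 : ℝ) ≤ d - 1 := by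
    have : (2 : ℝ) ≤ d := by exact_mod_cast hd
    linarith
  have hm0 : 0 < m := by linarith
  have hcont : Continuous fun δ : ℝ => (1 - 2 * δ) ^ 2 * (m * (d - 1) - m * (m + 2) * δ ^ 2) := by
    fun_prop
  -- At `δ = 0` the inequality reads `d + γ < m`; by continuity it persists for small `δ`.
  have h0 : (d - 1) * (d + γ) < (1 - 2 * (0 : ℝ)) ^ 2 * (m * (d - 1) - m * (m + 2) * 0 ^ 2) := by
    nlinarith
  have hev := (hcont.continuousAt (x := 0)).eventually (lt_mem_nhds h0)
  have hcont2 : Continuous fun δ : ℝ => m * (d - 1) - m * (m + 2) * δ ^ 2 := by fun_prop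
  have hev2 := (hcont2.continuousAt (x := 0)).eventually (lt_mem_nhds (a := 0) (by
    norm_num
    nlinarith))
  have hev3 : ∀ᶠ δ : ℝ in 𝓝[>] 0, 0 < δ ∧ δ < 1 / 4 := Ioo_mem_nhdsGT (by norm_num)
  obtain ⟨δ, ⟨hδ, hδ4⟩, h1, h2⟩ := (hev3.and ((hev.and hev2).filter_mono
    nhdsWithin_le_nhds)).exists
  refine ⟨δ, hδ, hδ4, fun v w hw => ?_⟩
  obtain ⟨hw1, hw2, -⟩ := norm_sub_bounds_of_notMem_farZone hδ hδ4 hw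
  have hb := bracket_pos v
  set z := v - w with hz
  -- The Gram determinant of `z` and `v` equals that of `z` and `w = v - z`, which is small because
  -- `w` is: the positive part of the barrier's Hessian is radial and is nearly annihilated by `Π(v
  -- - w)`.
  have hgram : ‖z‖ ^ 2 * ‖v‖ ^ 2 - inner ℝ v z ^ 2 = ‖z‖ ^ 2 * ‖w‖ ^ 2 - inner ℝ w z ^ 2 := by
    have hv : v = w + z := by rw [hz]; abel
    have e1 : ‖v‖ ^ 2 = ‖w‖ ^ 2 + 2 * inner ℝ w z + ‖z‖ ^ 2 := by rw [hv, norm_add_sq_real]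
    have e2 : inner ℝ v z = inner ℝ w z + ‖z‖ ^ 2 := by
      rw [← real_inner_self_eq_norm_sq, ← inner_add_left, ← hv]
    rw [e1, e2]
    ring
  rw [hgram]
  set a := ‖z‖ ^ 2 / bracket v ^ 2 with ha
  have ha1 : (1 - 2 * δ) ^ 2 ≤ a := by
    rw [ha, le_div_iff₀ (by positivity), ← mul_pow]
    have : 0 ≤ (1 - 2 * δ) * bracket v := mul_nonneg (by linarith) hb.le
    gcongr
  have hw3 : ‖w‖ ^ 2 / bracket v ^ 2 ≤ δ ^ 2 := by
    rw [div_le_iff₀ (by positivity), ← mul_pow]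
    gcongr
  have e3 : m * (m + 2) / bracket v ^ 4 * (‖z‖ ^ 2 * ‖w‖ ^ 2 - inner ℝ w z ^ 2) ≤
      a * (m * (m + 2) * δ ^ 2) := by
    calc _ ≤ m * (m + 2) / bracket v ^ 4 * (‖z‖ ^ 2 * ‖w‖ ^ 2) := by
          gcongr
          linarith [sq_nonneg (inner ℝ w z)]
      _ = a * (m * (m + 2) * (‖w‖ ^ 2 / bracket v ^ 2)) := by
          rw [ha]
          field_simp
      _ ≤ _ := by gcongr
  have e4 : m / bracket v ^ 2 * ((d - 1) * ‖z‖ ^ 2) = a * (m * (d - 1)) := by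
    rw [ha]
    ring
  rw [e4]
  nlinarith

/-- For `γ = -d` the power `‖v - w‖ ^ γ` is not locally integrable, but then the factor `d + γ` is
zero; it is kept inside the integral to cover this case. -/
theorem exists_integral_farZone_le_of_le (hd : 2 ≤ d) {m δ : ℝ} (hγ : -(d : ℝ) ≤ γ)
    (hm : d + γ < m) (hδ : 0 < δ) :
    ∃ C : ℝ, 0 ≤ C ∧ ∀ v : E d,
      IntegrableOn (fun w => (d + γ) * (‖v - w‖ ^ γ * bracket w ^ (-m))) (farZone δ v) ∧
      ∫ w in farZone δ v, (d + γ) * (‖v - w‖ ^ γ * bracket w ^ (-m)) ≤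
        C * bracket v ^ (d + γ - m) := by
  rcases hγ.eq_or_lt with h | h
  · refine ⟨0, le_rfl, fun v => ?_⟩
    have : (d : ℝ) + γ = 0 := by linarith
    simp [this]
  · obtain ⟨C, hC, hb⟩ := exists_integral_farZone_le hd h hm hδ
    have h0 : 0 ≤ (d : ℝ) + γ := by linarith
    refine ⟨(d + γ) * C, by positivity, fun v => ⟨(hb v).1.const_mul _, ?_⟩⟩
    rw [integral_const_mul, mul_assoc]
    exact mul_le_mul_of_nonneg_left (hb v).2 h0

/-- Pointwise bound of the divergence of the far part of the flux at a touching point. -/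
theorem exists_trc_landauFarDeriv_le (hd : 2 ≤ d) {m : ℝ} (hγ : -(d : ℝ) ≤ γ) (hm : d + γ < m) :
    ∃ δ c : ℝ, 0 < δ ∧ 0 < c ∧ ∀ (f : E d → ℝ) (N ε : ℝ) (v w : E d), ContDiff ℝ 2 f →
      (∀ w, 0 ≤ f w) → (∀ w, f w ≤ N * bracket w ^ (-m)) → f v = N * bracket v ^ (-m) →
      0 < ε → ε ≤ 1 / 2 →
      trc (landauFarDeriv γ ε f v w) ≤
        (farZone δ v).indicator (fun w => f v * N * (m * (m + 2) / bracket v ^ 2 *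
          (‖v - w‖ ^ (γ + 2) * bracket w ^ (-m)) +
            (d - 1) * ((d + γ) * (‖v - w‖ ^ γ * bracket w ^ (-m))))) w +
        (Metric.closedBall v (2 * ε)).indicator (fun _ => c * f v ^ 2 * ε ^ γ) w := by
  obtain ⟨δ, hδ, -, hnear⟩ := exists_landau_nearZone_nonpos (d := d) (γ := γ) hd hγ hm
  obtain ⟨c, hc, hcb⟩ := exists_abs_mul_deriv_landauWeight_sub_le
  have hd1 : (1 : ℝ) ≤ d - 1 := by
    have : (2 : ℝ) ≤ d := by exact_mod_cast hd
    linarith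
  have hm0 : 0 < m := by linarith
  -- The factor `2 ^ m` compares `f w` with `f v` at distance at most one, and `2 ^ |γ|` compares
  -- `‖v - w‖ ^ γ` with `ε ^ γ` on the transition shell.
  refine ⟨δ, 2 ^ m * (d - 1) * c * 2 ^ |γ|, hδ, by positivity, ?_⟩
  intro f N ε v w hf hf0 hle heq hε hε2
  have hb := bracket_pos v
  have hN : 0 ≤ N := by
    have := heq ▸ hf0 v
    exact nonneg_of_mul_nonneg_left this (Real.rpow_pos_of_pos hb _)
  rw [trc_landauFarDeriv]
  have hhess := norm_sq_mul_trc_hessian_le_of_touching hf hle heq (v - w)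
  set z := v - w with hz
  set ρ := landauWeight γ ε (‖z‖ ^ 2) with hρ
  set ρ' := deriv (landauWeight γ ε) (‖z‖ ^ 2) with hρ'
  have hw0 : 0 ≤ ρ := landauWeight_nonneg (sq_nonneg ‖z‖)
  have hw1 : ρ ≤ ‖z‖ ^ γ := by
    rw [← norm_sq_rpow_half]
    exact landauWeight_le (sq_nonneg ‖z‖)
  have hfv := hf0 v
  have hfw := hf0 w
  set Q := m * (m + 2) / bracket v ^ 4 * (‖z‖ ^ 2 * ‖v‖ ^ 2 - inner ℝ v z ^ 2) -
        m / bracket v ^ 2 * ((d - 1) * ‖z‖ ^ 2) with hQ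
  -- The reaction coefficient is written as `(d + γ) ρ` plus the error `2 ‖z‖² ρ' - γ ρ`, which is
  -- supported on the transition shell of the cutoff.
  have hsplit : f w * (ρ * (‖z‖ ^ 2 * trc (fderiv ℝ (gradient f) v) -
      inner ℝ z (fderiv ℝ (gradient f) v z)) +
      (d - 1) * f v * (2 * (‖z‖ ^ 2 * ρ') + d * ρ)) ≤
      f w * (f v * (ρ * (Q + (d - 1) * (d + γ)))) +
        f w * ((d - 1) * f v * (2 * (‖z‖ ^ 2 * ρ') - γ * ρ)) := by
    rw [← mul_add]
    refine mul_le_mul_of_nonneg_left ?_ hfw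
    have := mul_le_mul_of_nonneg_left hhess hw0
    nlinarith
  refine hsplit.trans (add_le_add ?_ ?_)
  · by_cases hfar : w ∈ farZone δ v
    · rw [Set.indicator_of_mem hfar]
      have hgram : ‖z‖ ^ 2 * ‖v‖ ^ 2 - inner ℝ v z ^ 2 ≤ ‖z‖ ^ 2 * bracket v ^ 2 := by
        rw [bracket_sq]
        nlinarith [sq_nonneg (inner ℝ v z), sq_nonneg ‖z‖]
      have hQ1 : Q ≤ m * (m + 2) / bracket v ^ 2 * ‖z‖ ^ 2 := by
        have h1 : m * (m + 2) / bracket v ^ 4 * (‖z‖ ^ 2 * ‖v‖ ^ 2 - inner ℝ v z ^ 2) ≤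
            m * (m + 2) / bracket v ^ 4 * (‖z‖ ^ 2 * bracket v ^ 2) := by gcongr
        have h2 : m * (m + 2) / bracket v ^ 4 * (‖z‖ ^ 2 * bracket v ^ 2) =
            m * (m + 2) / bracket v ^ 2 * ‖z‖ ^ 2 := by field_simp
        have h3 : 0 ≤ m / bracket v ^ 2 * ((d - 1) * ‖z‖ ^ 2) := by positivity
        linarith
      have hdγ : 0 ≤ (d : ℝ) + γ := by linarith
      have hrpow : ‖z‖ ^ γ * ‖z‖ ^ 2 ≤ ‖z‖ ^ (γ + 2) ∨ ρ = 0 := by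
        rcases eq_or_ne ‖z‖ 0 with h | h
        · right
          rw [hρ, h]
          exact landauWeight_eq_zero hε (by rw [zero_pow two_ne_zero]; positivity)
        · left
          rw [Real.rpow_add (lt_of_le_of_ne (norm_nonneg z) (Ne.symm h)), Real.rpow_two]
      have hmain : ρ * (Q + (d - 1) * (d + γ)) ≤ m * (m + 2) / bracket v ^ 2 * ‖z‖ ^ (γ + 2) +
          (d - 1) * ((d + γ) * ‖z‖ ^ γ) := by
        rcases hrpow with h | h
        · calc ρ * (Q + (d - 1) * (d + γ))
              ≤ ρ * (m * (m + 2) / bracket v ^ 2 * ‖z‖ ^ 2 + (d - 1) * (d + γ)) := by gcongr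
            _ ≤ ‖z‖ ^ γ * (m * (m + 2) / bracket v ^ 2 * ‖z‖ ^ 2 + (d - 1) * (d + γ)) := by
                gcongr
            _ = m * (m + 2) / bracket v ^ 2 * (‖z‖ ^ γ * ‖z‖ ^ 2) +
                (d - 1) * ((d + γ) * ‖z‖ ^ γ) := by ring
            _ ≤ _ := by gcongr
        · rw [h, zero_mul]
          have h1 : 0 ≤ (d - 1) * ((d + γ) * ‖z‖ ^ γ) :=
            mul_nonneg (by linarith) (mul_nonneg hdγ (by positivity))
          have h2 : 0 ≤ m * (m + 2) / bracket v ^ 2 * ‖z‖ ^ (γ + 2) := by positivity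
          linarith
      calc f w * (f v * (ρ * (Q + (d - 1) * (d + γ))))
          ≤ (N * bracket w ^ (-m)) * (f v * (m * (m + 2) / bracket v ^ 2 * ‖z‖ ^ (γ + 2) +
          (d - 1) * ((d + γ) * ‖z‖ ^ γ))) := by
            refine (mul_le_mul_of_nonneg_left (mul_le_mul_of_nonneg_left hmain hfv) hfw).trans ?_
            exact mul_le_mul_of_nonneg_right (hle w) (by positivity)
        _ = _ := by ring
    · rw [Set.indicator_of_notMem hfar]
      have := hnear v w hfar
      refine mul_nonpos_of_nonneg_of_nonpos hfw (mul_nonpos_of_nonneg_of_nonpos hfv ?_)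
      exact mul_nonpos_of_nonneg_of_nonpos hw0 this
  · have hχ := hcb γ ε (‖z‖ ^ 2) hε (sq_nonneg _)
    rw [norm_sq_rpow_half] at hχ
    by_cases hzr : ‖z‖ ^ 2 < ε ^ 2 ∨ 2 * ε ^ 2 < ‖z‖ ^ 2
    · rw [hχ.2 hzr, mul_zero, mul_zero]
      exact Set.indicator_nonneg (fun _ _ => by positivity) _
    · push Not at hzr
      have hz1 : ε ≤ ‖z‖ := abs_le_of_sq_le_sq' hzr.1 (norm_nonneg z) |>.2
      have hz2 : ‖z‖ ≤ 2 * ε :=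
        abs_le_of_sq_le_sq' (by nlinarith) (by positivity) |>.2
      have hmem : w ∈ Metric.closedBall v (2 * ε) := by
        rwa [Metric.mem_closedBall, dist_comm, dist_eq_norm]
      rw [Set.indicator_of_mem hmem]
      have hfw2 : f w ≤ 2 ^ m * f v :=
        le_two_rpow_mul_of_touching hm0.le hN hle heq (by rw [← hz]; linarith)
      have hpow : ‖z‖ ^ γ ≤ 2 ^ |γ| * ε ^ γ :=
        rpow_le_two_rpow_mul (hε.trans_le hz1) hε hz2 (by linarith)
      calc f w * ((d - 1) * f v * (2 * (‖z‖ ^ 2 * ρ') - γ * ρ))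
          ≤ f w * ((d - 1) * f v * (c * ‖z‖ ^ γ)) := by
            gcongr
            exact (le_abs_self _).trans hχ.1
        _ ≤ (2 ^ m * f v) * ((d - 1) * f v * (c * (2 ^ |γ| * ε ^ γ))) := by gcongr
        _ = _ := by ring

theorem tendsto_integral_closedBall_norm_rpow (hd : 2 ≤ d) {p : ℝ} (hp : -(d : ℝ) < p) :
    Tendsto (fun ε : ℝ => ∫ z in Metric.closedBall (0 : E d) (2 * ε), ‖z‖ ^ p) (𝓝[>] 0) (𝓝 0) := by
  have h1 := integrableOn_norm_rpow_closedBall hd hp 1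
  have hfin : ∀ ε : ℝ, 0 < ε → volume (Metric.closedBall (0 : E d) (2 * ε)) =
      ENNReal.ofReal ((2 * ε) ^ d) * volume (Metric.closedBall (0 : E d) 1) := by
    intro ε hε
    rw [Measure.addHaar_closedBall' _ _ (by positivity), finrank_euclideanSpace_fin]
  have hs : Tendsto (fun ε : ℝ => (volume.restrict (Metric.closedBall (0 : E d) 1))
      (Metric.closedBall (0 : E d) (2 * ε))) (𝓝[>] 0) (𝓝 0) := by
    have h2 : Tendsto (fun ε : ℝ => ENNReal.ofReal ((2 * ε) ^ d) *
        volume (Metric.closedBall (0 : E d) 1)) (𝓝[>] 0) (𝓝 0) := by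
      have h3 : Tendsto (fun ε : ℝ => ENNReal.ofReal ((2 * ε) ^ d)) (𝓝[>] 0) (𝓝 0) := by
        have hc : Continuous fun ε : ℝ => ENNReal.ofReal ((2 * ε) ^ d) :=
          ENNReal.continuous_ofReal.comp (by fun_prop)
        have := (hc.tendsto 0).mono_left (nhdsWithin_le_nhds (s := Set.Ioi 0))
        simpa [show d ≠ 0 by omega] using this
      have := ENNReal.Tendsto.mul_const (b := volume (Metric.closedBall (0 : E d) 1)) h3
        (Or.inr measure_closedBall_lt_top.ne)
      simpa using this
    refine tendsto_of_tendsto_of_tendsto_of_le_of_le' tendsto_const_nhds h2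
      (Eventually.of_forall fun _ => zero_le) ?_
    filter_upwards [self_mem_nhdsWithin] with ε hε
    rw [← hfin ε hε]
    exact Measure.restrict_apply_le _ _
  have h := Integrable.tendsto_setIntegral_nhds_zero h1 hs
  refine h.congr' ?_
  filter_upwards [Ioo_mem_nhdsGT (show (0 : ℝ) < 1 / 2 by norm_num)] with ε hε
  rw [Measure.restrict_restrict measurableSet_closedBall, Set.inter_eq_left.2]
  exact Metric.closedBall_subset_closedBall (by linarith [hε.2])

/-- The divergence of the flux is computed for each `ε`: the singular part tends to `0`, the near
zone has a sign, the far zone is bounded by the power integrals, and the shell term stays bounded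
since `d + γ ≥ 0`. For `γ = -d` the shell term plays the role of the local reaction proportional to
`f(v)²`. -/
theorem exists_touchingEstimate_landau (hd : 2 ≤ d) {m : ℝ} (hγ : -(d : ℝ) ≤ γ)
    (hm : d + 2 + γ < m) : ∃ C : ℝ, 0 < C ∧ TouchingEstimate (d := d) (IsLandauValue γ) γ m C := by
  have hγ2 : -(d : ℝ) < γ + 2 := by linarith
  have hmγ : d + γ < m := by linarith
  have hm0 : 0 < m := by linarith
  have hdγ : 0 ≤ (d : ℝ) + γ := by linarith
  have hd1 : (1 : ℝ) ≤ d - 1 := by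
    have : (2 : ℝ) ≤ d := by exact_mod_cast hd
    linarith
  obtain ⟨δ, c, hδ, hc, hpt⟩ := exists_trc_landauFarDeriv_le (d := d) hd hγ hmγ
  obtain ⟨C₁, hC₁, hI₁⟩ := exists_integral_farZone_le hd hγ2 (m := m) (by linarith) hδ
  obtain ⟨C₂, hC₂, hI₂⟩ := exists_integral_farZone_le_of_le (d := d) hd hγ hmγ hδ
  set ω := (volume (Metric.closedBall (0 : E d) 1)).toReal with hω
  have hω0 : 0 ≤ ω := ENNReal.toReal_nonneg
  set C := m * (m + 2) * C₁ + (d - 1) * C₂ + c * 2 ^ d * ω + 1 with hC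
  refine ⟨C, by positivity, ?_⟩
  rintro f N v q hf hf0 hN hle heq ⟨J, A, hJ, hA, rfl⟩
  have hb := bracket_pos v
  have hfv := hf0 v
  obtain ⟨B, hB⟩ := exists_hasFDerivAt_landauNear hd hγ2 hf v
  rw [← trc_apply]
  have hlim : Tendsto (fun ε : ℝ => d * (B * ∫ z in Metric.closedBall (0 : E d) (2 * ε),
      ‖z‖ ^ (γ + 2)) + C * bracket v ^ (d + γ) * f v ^ 2) (𝓝[>] 0)
      (𝓝 (d * (B * 0) + C * bracket v ^ (d + γ) * f v ^ 2)) :=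
    (((tendsto_integral_closedBall_norm_rpow hd hγ2).const_mul B).const_mul (d : ℝ)).add_const _
  rw [mul_zero, mul_zero, zero_add] at hlim
  refine ge_of_tendsto hlim ?_
  filter_upwards [Ioo_mem_nhdsGT (show (0 : ℝ) < 1 / 2 by norm_num)] with ε hε
  obtain ⟨hε0, hε2⟩ := hε
  obtain ⟨A₁, hA₁, hA₁n⟩ := hB ε hε0 hε2.le
  obtain ⟨hfarint, hfar⟩ := hasFDerivAt_integral_landauFar hd hγ2 hε0 (by linarith) hf hm hf0 hle v
  -- By uniqueness of limits, the given flux has this representation for the chosen `ε`, and its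
  -- derivative splits accordingly.
  have hJeq : J = fun u => landauNear γ ε f u + ∫ w, landauFarIntegrand γ ε f u w := by
    funext u
    exact tendsto_nhds_unique (hJ u) (tendsto_landauFluxTrunc hd hγ2 hε0 hf hm hf0 hle u)
  have hAeq : A = A₁ + ∫ w, landauFarDeriv γ ε f v w := by
    refine hA.unique ?_
    rw [hJeq]
    exact hA₁.add hfar
  rw [hAeq, map_add]
  refine add_le_add ?_ ?_
  · calc trc A₁ ≤ d * ‖A₁‖ := (le_abs_self _).trans (abs_trc_le A₁)
      _ ≤ _ := by gcongr
  rw [← ContinuousLinearMap.integral_comp_comm _ hfarint]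
  set U₁ : E d → ℝ := fun w => f v * N * (m * (m + 2) / bracket v ^ 2 *
    (‖v - w‖ ^ (γ + 2) * bracket w ^ (-m)) +
      (d - 1) * ((d + γ) * (‖v - w‖ ^ γ * bracket w ^ (-m)))) with hU₁
  have hU₁int : IntegrableOn U₁ (farZone δ v) :=
    (((hI₁ v).1.const_mul _).add ((hI₂ v).1.const_mul _)).const_mul _
  have hU₂int : IntegrableOn (fun _ : E d => c * f v ^ 2 * ε ^ γ)
      (Metric.closedBall v (2 * ε)) := integrableOn_const measure_closedBall_lt_top.ne
  have hU₁i : Integrable ((farZone δ v).indicator U₁) :=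
    (integrable_indicator_iff (measurableSet_farZone δ v)).2 hU₁int
  have hU₂i : Integrable ((Metric.closedBall v (2 * ε)).indicator
      fun _ => c * f v ^ 2 * ε ^ γ) :=
    (integrable_indicator_iff measurableSet_closedBall).2 hU₂int
  have hmono : ∫ w, trc (landauFarDeriv γ ε f v w) ≤ ∫ w, ((farZone δ v).indicator U₁ w +
      (Metric.closedBall v (2 * ε)).indicator (fun _ => c * f v ^ 2 * ε ^ γ) w) :=
    integral_mono (trc.integrable_comp hfarint) (hU₁i.add hU₂i)
      fun w => hpt f N ε v w hf hf0 hle heq hε0 hε2.le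
  refine hmono.trans ?_
  rw [integral_add hU₁i hU₂i, integral_indicator (measurableSet_farZone δ v),
    integral_indicator measurableSet_closedBall]
  have e1 : ∫ w in farZone δ v, U₁ w ≤ f v * N * (m * (m + 2) / bracket v ^ 2 *
      (C₁ * bracket v ^ (d + (γ + 2) - m)) + (d - 1) * (C₂ * bracket v ^ (d + γ - m))) := by
    rw [hU₁, integral_const_mul, integral_add ((hI₁ v).1.const_mul _) ((hI₂ v).1.const_mul _),
      integral_const_mul, integral_const_mul]
    have h1 := (hI₁ v).2
    have h2 := (hI₂ v).2
    gcongr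
  have e2 : bracket v ^ (d + (γ + 2) - m) = bracket v ^ (-m) * bracket v ^ (d + γ) *
      bracket v ^ 2 := by
    rw [← Real.rpow_add hb, ← Real.rpow_two, ← Real.rpow_add hb]
    congr 1
    ring
  have e3 : bracket v ^ (d + γ - m) = bracket v ^ (-m) * bracket v ^ (d + γ) := by
    rw [← Real.rpow_add hb]
    congr 1
    ring
  have e4 : f v * N * (m * (m + 2) / bracket v ^ 2 *
      (C₁ * bracket v ^ (d + (γ + 2) - m)) + (d - 1) * (C₂ * bracket v ^ (d + γ - m))) =
      (m * (m + 2) * C₁ + (d - 1) * C₂) * bracket v ^ (d + γ) * f v ^ 2 := by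
    rw [e2, e3, sq (f v)]
    nth_rewrite 3 [heq]
    field_simp
  have e5 : ∫ _ in Metric.closedBall v (2 * ε), c * f v ^ 2 * ε ^ γ ≤
      c * 2 ^ d * ω * bracket v ^ (d + γ) * f v ^ 2 := by
    rw [setIntegral_const, smul_eq_mul, Measure.real,
      Measure.addHaar_closedBall' _ _ (by positivity), finrank_euclideanSpace_fin,
      ENNReal.toReal_mul, ENNReal.toReal_ofReal (by positivity), ← hω]
    -- The volume of the shell compensates the singularity of the kernel on it.
    have h1 : ε ^ d * ε ^ γ ≤ 1 := by
      rw [← Real.rpow_natCast, ← Real.rpow_add hε0]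
      exact Real.rpow_le_one hε0.le (by linarith) hdγ
    have h2 : 1 ≤ bracket v ^ (d + γ) := Real.one_le_rpow (one_le_bracket v) hdγ
    calc (2 * ε) ^ d * ω * (c * f v ^ 2 * ε ^ γ)
        = c * 2 ^ d * ω * (ε ^ d * ε ^ γ) * f v ^ 2 := by rw [mul_pow]; ring
      _ ≤ c * 2 ^ d * ω * bracket v ^ (d + γ) * f v ^ 2 := by
          gcongr
          exact h1.trans h2
  have e6 : 0 ≤ bracket v ^ (d + γ) * f v ^ 2 := by positivity
  rw [e4] at e1
  calc _ ≤ _ := add_le_add e1 e5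
    _ ≤ _ := by
      rw [hC]
      nlinarith

end LandauTouching

/-! ### Isometry invariance of the surface measure. -/

section SphereMeasure

variable {d : ℕ}

instance : IsFiniteMeasure (sphereMeasure d) :=
  inferInstanceAs (IsFiniteMeasure (volume : Measure (E d)).toSphere)

/-- The action of a linear isometry on the unit sphere. -/
def sphereMap (A : E d ≃ₗᵢ[ℝ] E d) (σ : Metric.sphere (0 : E d) 1) : Metric.sphere (0 : E d) 1 :=
  ⟨A σ, by simp⟩

theorem continuous_sphereMap (A : E d ≃ₗᵢ[ℝ] E d) : Continuous (sphereMap A) :=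
  (A.continuous.comp continuous_subtype_val).subtype_mk _

open scoped Pointwise in
-- The surface measure of a set is, up to a constant, the volume of the cone over it, and a linear
-- isometry maps cones to cones of equal volume.
theorem map_sphereMap (A : E d ≃ₗᵢ[ℝ] E d) :
    (sphereMeasure d).map (sphereMap A) = sphereMeasure d := by
  ext s hs
  have hmeas := (continuous_sphereMap A).measurable
  rw [Measure.map_apply hmeas hs, sphereMeasure, Measure.toSphere_apply' _ (hmeas hs),
    Measure.toSphere_apply' _ hs]
  congr 1
  have hset : Set.Ioo (0 : ℝ) 1 • ((↑) '' (sphereMap A ⁻¹' s) : Set (E d)) =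
      A ⁻¹' (Set.Ioo (0 : ℝ) 1 • ((↑) '' s : Set (E d))) := by
    ext x
    simp only [Set.mem_smul, Set.mem_image, Set.mem_preimage]
    constructor
    · rintro ⟨r, hr, _, ⟨σ, hσ, rfl⟩, rfl⟩
      exact ⟨r, hr, _, ⟨_, hσ, rfl⟩, by simp [sphereMap]⟩
    · rintro ⟨r, hr, _, ⟨σ, hσ, rfl⟩, hx⟩
      refine ⟨r, hr, A.symm σ, ⟨⟨A.symm σ, by simp⟩, ?_, rfl⟩, ?_⟩
      · simpa [sphereMap] using hσ
      · rw [← map_smul, hx, A.symm_apply_apply]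
  rw [hset]
  exact A.measurePreserving.measure_preimage_emb A.toHomeomorph.measurableEmbedding _

theorem lintegral_sphere_isometry (A : E d ≃ₗᵢ[ℝ] E d) {F : E d → ENNReal} (hF : Measurable F) :
    ∫⁻ σ : Metric.sphere (0 : E d) 1, F (A σ) ∂sphereMeasure d =
      ∫⁻ σ : Metric.sphere (0 : E d) 1, F σ ∂sphereMeasure d := by
  conv_rhs => rw [← map_sphereMap A]
  rw [lintegral_map (f := fun σ : Metric.sphere (0 : E d) 1 => F σ)
    (hF.comp measurable_subtype_coe) (continuous_sphereMap A).measurable]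
  rfl

theorem lintegral_sphere_neg {F : E d → ENNReal} (hF : Measurable F) :
    ∫⁻ σ : Metric.sphere (0 : E d) 1, F (-σ) ∂sphereMeasure d =
      ∫⁻ σ : Metric.sphere (0 : E d) 1, F σ ∂sphereMeasure d :=
  lintegral_sphere_isometry (LinearIsometryEquiv.neg ℝ) hF

/-- The reflection in the hyperplane orthogonal to `e - e'` exchanges the two vectors. -/
theorem lintegral_sphere_inner_eq {e e' : E d} (h : ‖e‖ = ‖e'‖) {φ : ℝ → ENNReal}
    (hφ : Measurable φ) :
    ∫⁻ σ : Metric.sphere (0 : E d) 1, φ (inner ℝ e σ) ∂sphereMeasure d =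
      ∫⁻ σ : Metric.sphere (0 : E d) 1, φ (inner ℝ e' σ) ∂sphereMeasure d := by
  set A := (ℝ ∙ (e - e'))ᗮ.reflection with hA
  have hAe : A e = e' := Submodule.reflection_sub h
  rw [← lintegral_sphere_isometry A (F := fun x => φ (inner ℝ e' x)) (by fun_prop), ← hAe]
  simp only [LinearIsometryEquiv.inner_map_map]

end SphereMeasure

/-! ### The change of variables from pre- to post-collisional velocities at fixed `σ`. -/

section CollisionMap

variable {d : ℕ}

/-- `cos(θ/2)^2`, where `θ` is the angle between `z` and the unit vector `σ`. -/
def cosSqHalf (z σ : E d) : ℝ := (1 + inner ℝ z σ / ‖z‖) / 2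

/-- The map `v - v_* ↦ v - v_*'`. -/
def collisionMap (σ z : E d) : E d := (1 / 2 : ℝ) • (z + ‖z‖ • σ)

/-- The inverse of `collisionMap σ`. -/
def collisionInv (σ y : E d) : E d := (2 : ℝ) • y - (‖y‖ ^ 2 / inner ℝ y σ) • σ

/-- The cosine of the angle between `y` and the unit vector `σ`. -/
def cosAng (y σ : E d) : ℝ := inner ℝ y σ / ‖y‖

variable {σ : E d}

theorem inner_collisionMap (hσ : ‖σ‖ = 1) (z : E d) :
    inner ℝ (collisionMap σ z) σ = (inner ℝ z σ + ‖z‖) / 2 := by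
  simp only [collisionMap, real_inner_smul_left, inner_add_left, real_inner_self_eq_norm_sq, hσ]
  ring

theorem norm_sq_collisionMap (hσ : ‖σ‖ = 1) (z : E d) :
    ‖collisionMap σ z‖ ^ 2 = ‖z‖ * ((inner ℝ z σ + ‖z‖) / 2) := by
  rw [collisionMap, norm_smul, mul_pow, norm_add_sq_real, real_inner_smul_right, norm_smul, hσ,
    norm_norm]
  norm_num
  ring

theorem collisionInv_collisionMap (hσ : ‖σ‖ = 1) {z : E d} (hz : 0 < inner ℝ z σ + ‖z‖) :
    collisionInv σ (collisionMap σ z) = z := by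
  rw [collisionInv, inner_collisionMap hσ, norm_sq_collisionMap hσ, collisionMap,
    mul_div_assoc, div_self (by positivity)]
  module

theorem norm_collisionInv (hσ : ‖σ‖ = 1) {y : E d} (hy : 0 < inner ℝ y σ) :
    ‖collisionInv σ y‖ = ‖y‖ ^ 2 / inner ℝ y σ := by
  have h : ‖collisionInv σ y‖ ^ 2 = (‖y‖ ^ 2 / inner ℝ y σ) ^ 2 := by
    rw [collisionInv, norm_sub_sq_real, norm_smul, norm_smul, real_inner_smul_left,
      real_inner_smul_right, hσ, Real.norm_eq_abs, Real.norm_eq_abs, mul_pow, mul_pow, sq_abs,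
      sq_abs]
    field_simp
    ring
  exact (sq_eq_sq₀ (norm_nonneg _) (by positivity)).1 h

theorem collisionMap_collisionInv (hσ : ‖σ‖ = 1) {y : E d} (hy : 0 < inner ℝ y σ) :
    collisionMap σ (collisionInv σ y) = y := by
  rw [collisionMap, norm_collisionInv hσ hy, collisionInv]
  module

theorem inner_collisionInv (hσ : ‖σ‖ = 1) (y : E d) :
    inner ℝ (collisionInv σ y) σ = 2 * inner ℝ y σ - ‖y‖ ^ 2 / inner ℝ y σ := by
  simp only [collisionInv, real_inner_smul_left, inner_sub_left, real_inner_self_eq_norm_sq, hσ]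
  ring

theorem ne_zero_of_inner_pos {y : E d} (hy : 0 < inner ℝ y σ) : y ≠ 0 := by
  rintro rfl
  simp at hy

/-- The vector `y` bisects the directions of `z` and `σ`, so it makes the angle `θ / 2` with `σ`. -/
theorem cosSqHalf_collisionInv (hσ : ‖σ‖ = 1) {y : E d} (hy : 0 < inner ℝ y σ) :
    cosSqHalf (collisionInv σ y) σ = cosAng y σ ^ 2 := by
  have hy0 : 0 < ‖y‖ := norm_pos_iff.2 (ne_zero_of_inner_pos hy)
  rw [cosSqHalf, cosAng, inner_collisionInv hσ, norm_collisionInv hσ hy]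
  field_simp
  ring

theorem norm_collisionInv_eq (hσ : ‖σ‖ = 1) {y : E d} (hy : 0 < inner ℝ y σ) :
    ‖collisionInv σ y‖ = ‖y‖ / cosAng y σ := by
  rw [norm_collisionInv hσ hy, cosAng, div_div_eq_mul_div, sq]

theorem image_collisionMap (hσ : ‖σ‖ = 1) :
    collisionMap σ '' {z | 0 < inner ℝ z σ + ‖z‖} = {y | 0 < inner ℝ y σ} := by
  ext y
  constructor
  · rintro ⟨z, hz, rfl⟩
    change 0 < inner ℝ (collisionMap σ z) σ
    rw [inner_collisionMap hσ]
    exact half_pos hz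
  · intro hy
    refine ⟨collisionInv σ y, ?_, collisionMap_collisionInv hσ hy⟩
    change 0 < inner ℝ (collisionInv σ y) σ + ‖collisionInv σ y‖
    rw [norm_collisionInv hσ hy, inner_collisionInv hσ]
    have : 0 < inner ℝ y σ := hy
    linarith

theorem hasFDerivAt_collisionMap {z : E d} (hz : z ≠ 0) :
    HasFDerivAt (collisionMap σ) ((1 / 2 : ℝ) • (ContinuousLinearMap.id ℝ (E d) +
      (‖z‖⁻¹ • innerSL ℝ z).smulRight σ)) z := by
  have hn : HasFDerivAt (fun z : E d => ‖z‖) (‖z‖⁻¹ • innerSL ℝ z) z := by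
    have h1 := ((hasFDerivAt_id z).norm_sq).sqrt (by
      simp only [id]
      have := norm_pos_iff.2 hz
      positivity)
    simp only [id, Real.sqrt_sq (norm_nonneg _)] at h1
    refine h1.congr_fderiv ?_
    ext h
    simp
    ring
  exact ((hasFDerivAt_id z).add (hn.smul_const σ)).const_smul (1 / 2 : ℝ)

/-- The derivative is half of a rank-one perturbation of the identity, whose determinant is one plus
the functional evaluated at `σ`. -/
theorem det_collisionMap {z : E d} :
    ((1 / 2 : ℝ) • (ContinuousLinearMap.id ℝ (E d) +
      (‖z‖⁻¹ • innerSL ℝ z).smulRight σ)).det = (1 / 2) ^ d * (2 * cosSqHalf z σ) := by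
  have : (((1 / 2 : ℝ) • (ContinuousLinearMap.id ℝ (E d) +
      (‖z‖⁻¹ • innerSL ℝ z).smulRight σ) : E d →L[ℝ] E d) : E d →ₗ[ℝ] E d) =
      (1 / 2 : ℝ) • LinearMap.transvection
        ((‖z‖⁻¹ • innerSL ℝ z : E d →L[ℝ] ℝ) : E d →ₗ[ℝ] ℝ) σ := by
    ext1 h
    simp [LinearMap.transvection]
  rw [ContinuousLinearMap.det, this, LinearMap.det_smul, finrank_euclideanSpace_fin,
    LinearMap.transvection.det, cosSqHalf]
  simp
  ring

theorem cosSqHalf_nonneg (hσ : ‖σ‖ = 1) (z : E d) : 0 ≤ cosSqHalf z σ := by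
  have h := abs_real_inner_div_norm_mul_norm_le_one z σ
  rw [hσ, mul_one] at h
  have := (abs_le.1 h).1
  rw [cosSqHalf]
  linarith

theorem cosSqHalf_le_one (hσ : ‖σ‖ = 1) (z : E d) : cosSqHalf z σ ≤ 1 := by
  have h := abs_real_inner_div_norm_mul_norm_le_one z σ
  rw [hσ, mul_one] at h
  have := (abs_le.1 h).2
  rw [cosSqHalf]
  linarith

theorem cosSqHalf_neg (z σ : E d) : cosSqHalf z (-σ) = 1 - cosSqHalf z σ := by
  rw [cosSqHalf, cosSqHalf, inner_neg_right]
  ring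

/-- Equality in Cauchy–Schwarz: the excluded `z` are nonpositive multiples of `σ`, contained in a
line, which is a null set as `d ≥ 2`. -/
theorem ae_collision_domain (hd : 2 ≤ d) (hσ : ‖σ‖ = 1) :
    ∀ᵐ z : E d, 0 < inner ℝ z σ + ‖z‖ := by
  rw [ae_iff]
  refine measure_mono_null (t := ((ℝ ∙ σ : Submodule ℝ (E d)) : Set (E d))) ?_ ?_
  · intro z hz
    have hz' : ¬ 0 < inner ℝ z σ + ‖z‖ := hz
    have h1 : ‖z + ‖z‖ • σ‖ ^ 2 = 2 * ‖z‖ * (inner ℝ z σ + ‖z‖) := by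
      rw [norm_add_sq_real, real_inner_smul_right, norm_smul, hσ, norm_norm]
      ring
    have h2 : ‖z + ‖z‖ • σ‖ ^ 2 ≤ 0 := by
      rw [h1]
      exact mul_nonpos_of_nonneg_of_nonpos (by positivity) (not_lt.1 hz')
    have h3 : z + ‖z‖ • σ = 0 := by
      rw [← norm_eq_zero]
      exact pow_eq_zero_iff two_ne_zero |>.1 (le_antisymm h2 (sq_nonneg _))
    have h4 : z = (-‖z‖) • σ := by
      rw [neg_smul]
      exact eq_neg_of_add_eq_zero_left h3
    exact Submodule.mem_span_singleton.2 ⟨-‖z‖, h4.symm⟩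
  · refine Measure.addHaar_submodule _ _ fun htop => ?_
    have h1 := finrank_span_le_card (R := ℝ) ({σ} : Set (E d))
    rw [htop, finrank_top, finrank_euclideanSpace_fin] at h1
    simp at h1
    omega

/-- The change of variables `v_* ↦ v_*'` for a fixed `σ`. -/
theorem lintegral_collision (hd : 2 ≤ d) (hσ : ‖σ‖ = 1) (G : E d → ENNReal) :
    ∫⁻ z, G z = ∫⁻ y in {y : E d | 0 < inner ℝ y σ},
      ENNReal.ofReal (2 ^ (d - 1) * (cosAng y σ ^ 2)⁻¹) * G (collisionInv σ y) := by
  have hmeas : MeasurableSet {z : E d | 0 < inner ℝ z σ + ‖z‖} :=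
    measurableSet_lt measurable_const (by fun_prop)
  have h := lintegral_image_eq_lintegral_abs_det_fderiv_mul volume (f := collisionMap σ)
    (f' := fun z => (1 / 2 : ℝ) • (ContinuousLinearMap.id ℝ (E d) +
      (‖z‖⁻¹ • innerSL ℝ z).smulRight σ)) hmeas (fun z hz => by
        refine (hasFDerivAt_collisionMap ?_).hasFDerivWithinAt
        rintro rfl
        simp at hz) (fun z hz z' hz' h => by
        rw [← collisionInv_collisionMap hσ hz, h, collisionInv_collisionMap hσ hz'])
    (fun y => ENNReal.ofReal (2 ^ (d - 1) * (cosAng y σ ^ 2)⁻¹) * G (collisionInv σ y))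
  rw [image_collisionMap hσ] at h
  rw [h]
  have hrestr : ∫⁻ z, G z = ∫⁻ z in {z : E d | 0 < inner ℝ z σ + ‖z‖}, G z := by
    have hae : ∀ᵐ z : E d, z ∈ {z : E d | 0 < inner ℝ z σ + ‖z‖} := ae_collision_domain hd hσ
    rw [Measure.restrict_eq_self_of_ae_mem hae]
  rw [hrestr]
  refine setLIntegral_congr_fun hmeas fun z hz => ?_
  have hz' : 0 < inner ℝ z σ + ‖z‖ := hz
  have hy : 0 < inner ℝ (collisionMap σ z) σ := by
    rw [inner_collisionMap hσ]
    exact half_pos hz'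
  have hq : cosAng (collisionMap σ z) σ ^ 2 = cosSqHalf z σ := by
    rw [← cosSqHalf_collisionInv hσ hy, collisionInv_collisionMap hσ hz']
  have hz0 : 0 < ‖z‖ := by
    rw [norm_pos_iff]
    rintro rfl
    simp at hz'
  have hq0 : 0 < cosSqHalf z σ := by
    have : cosSqHalf z σ = (inner ℝ z σ + ‖z‖) / (2 * ‖z‖) := by
      rw [cosSqHalf]
      field_simp
      ring
    rw [this]
    positivity
  simp only
  rw [det_collisionMap, hq, collisionInv_collisionMap hσ hz', ← mul_assoc,
    ← ENNReal.ofReal_mul (abs_nonneg _), abs_of_nonneg (by positivity)]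
  have : (1 / 2 : ℝ) ^ d * (2 * cosSqHalf z σ) * (2 ^ (d - 1) * (cosSqHalf z σ)⁻¹) = 1 := by
    obtain ⟨n, rfl⟩ := Nat.exists_eq_add_of_le' (show 1 ≤ d by omega)
    rw [Nat.add_sub_cancel]
    have h2 : (1 / 2 : ℝ) ^ n * 2 ^ n = 1 := by
      rw [← mul_pow]
      norm_num
    calc _ = (1 / 2 : ℝ) ^ n * 2 ^ n * (cosSqHalf z σ * (cosSqHalf z σ)⁻¹) := by ring
      _ = 1 := by rw [h2, mul_inv_cancel₀ hq0.ne', one_mul]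
  rw [this, ENNReal.ofReal_one, one_mul]

end CollisionMap

/-! ### Angular integrals in terms of the half angle. -/

section AngularIntegrals

variable {d : ℕ}

theorem measurable_cosAng : Measurable fun p : E d × E d => cosAng p.1 p.2 := by
  have h : Continuous fun p : E d × E d => (inner ℝ p.1 p.2 : ℝ) := by fun_prop
  exact h.measurable.div measurable_fst.norm

theorem cosSqHalf_eq (z σ : E d) : cosSqHalf z σ = (1 + cosAng z σ) / 2 := rfl

theorem measurable_cosSqHalf : Measurable fun p : E d × E d => cosSqHalf p.1 p.2 := by
  have := measurable_cosAng (d := d)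
  simp only [cosSqHalf_eq]
  fun_prop

theorem measurable_collisionInv : Measurable fun p : E d × E d => collisionInv p.2 p.1 := by
  have h : Continuous fun p : E d × E d => (inner ℝ p.1 p.2 : ℝ) := by fun_prop
  have h2 := h.measurable
  unfold collisionInv
  fun_prop

theorem measurable_collisionMap : Measurable fun p : E d × E d => collisionMap p.2 p.1 := by
  unfold collisionMap
  fun_prop

theorem measurable_coe_prod : Measurable fun p : E d × Metric.sphere (0 : E d) 1 =>
    (p.1, (p.2 : E d)) :=
  measurable_fst.prodMk (measurable_subtype_coe.comp measurable_snd)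

theorem measurable_coe_right (y : E d) : Measurable fun σ : Metric.sphere (0 : E d) 1 =>
    (y, (σ : E d)) :=
  measurable_const.prodMk measurable_subtype_coe

theorem measurable_restrict_prod {α : Type*} [MeasurableSpace α] {F : E d × E d → α}
    (h : Measurable F) :
    Measurable fun p : E d × Metric.sphere (0 : E d) 1 => F (p.1, (p.2 : E d)) := by
  have h3 : Measurable fun p : E d × Metric.sphere (0 : E d) 1 =>
    (p.1, (p.2 : E d)) := measurable_coe_prod
  exact h.comp h3

theorem measurable_restrict_right {α : Type*} [MeasurableSpace α] {F : E d × E d → α}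
    (h : Measurable F) (y : E d) :
    Measurable fun σ : Metric.sphere (0 : E d) 1 => F (y, (σ : E d)) := by
  have h3 : Measurable fun σ : Metric.sphere (0 : E d) 1 => (y, (σ : E d)) :=
    measurable_coe_right y
  exact h.comp h3

theorem lintegral_sphere_swap {F : E d → E d → ENNReal}
    (h : Measurable fun p : E d × Metric.sphere (0 : E d) 1 => F p.1 (p.2 : E d)) :
    ∫⁻ z : E d, ∫⁻ σ : Metric.sphere (0 : E d) 1, F z σ ∂sphereMeasure d =
      ∫⁻ σ : Metric.sphere (0 : E d) 1, (∫⁻ z : E d, F z σ) ∂sphereMeasure d :=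
  lintegral_lintegral_swap (f := fun z (σ : Metric.sphere (0 : E d) 1) => F z (σ : E d))
    h.aemeasurable

theorem measurable_cosSqHalf_coe : Measurable fun p : E d × Metric.sphere (0 : E d) 1 =>
    cosSqHalf p.1 (p.2 : E d) :=
  measurable_restrict_prod (F := fun p => cosSqHalf p.1 p.2) measurable_cosSqHalf

theorem measurable_cosAng_coe : Measurable fun p : E d × Metric.sphere (0 : E d) 1 =>
    cosAng p.1 (p.2 : E d) :=
  measurable_restrict_prod (F := fun p => cosAng p.1 p.2) measurable_cosAng

theorem measurable_cosSqHalf_right (y : E d) : Measurable fun σ : Metric.sphere (0 : E d) 1 =>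
    cosSqHalf y (σ : E d) :=
  measurable_restrict_right (F := fun p => cosSqHalf p.1 p.2) measurable_cosSqHalf y

theorem measurable_cosAng_right (y : E d) : Measurable fun σ : Metric.sphere (0 : E d) 1 =>
    cosAng y (σ : E d) :=
  measurable_restrict_right (F := fun p => cosAng p.1 p.2) measurable_cosAng y

theorem lintegral_sphere_cosAng_eq {e e' : E d} (he : e ≠ 0) (he' : e' ≠ 0) {φ : ℝ → ENNReal}
    (hφ : Measurable φ) :
    ∫⁻ σ : Metric.sphere (0 : E d) 1, φ (cosAng e σ) ∂sphereMeasure d =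
      ∫⁻ σ : Metric.sphere (0 : E d) 1, φ (cosAng e' σ) ∂sphereMeasure d := by
  have h : ∀ y σ : E d, cosAng y σ = inner ℝ (‖y‖⁻¹ • y) σ := by
    intro y σ
    rw [cosAng, real_inner_smul_left, inv_mul_eq_div]
  simp only [h]
  refine lintegral_sphere_inner_eq ?_ hφ
  have hn : ∀ y : E d, y ≠ 0 → ‖‖y‖⁻¹ • y‖ = 1 := fun y hy => by
    rw [norm_smul, norm_inv, norm_norm, inv_mul_cancel₀ (norm_ne_zero_iff.2 hy)]
  rw [hn e he, hn e' he']

theorem ae_ne_zero (hd : 2 ≤ d) : ∀ᵐ z : E d, z ≠ 0 := by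
  have : Nontrivial (E d) :=
    Module.nontrivial_of_finrank_pos (R := ℝ) (by rw [finrank_euclideanSpace_fin]; omega)
  rw [ae_iff]
  simp

/-- The weight relating the angles of deviation `θ` and `θ/2`. -/
def halfAngleWeight (d : ℕ) (H : ℝ → ENNReal) : ℝ → ENNReal :=
  (Set.Ioi (0 : ℝ)).indicator fun κ => ENNReal.ofReal (2 ^ (d - 1) * κ ^ (d - 2)) * H (κ ^ 2)

/-- The collision change of variables is applied to `H (cosSqHalf z σ)` over the unit ball in `z`.
The ball becomes `‖y‖ < κ` with `κ = cosAng y σ`, of volume `κ ^ d` times that of the unit ball;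
with the Jacobian `2 ^ (d - 1) / κ ^ 2` this is the weight `2 ^ (d - 1) κ ^ (d - 2)`. Rotation
invariance decouples the direction of `y`, and the volume of the ball cancels. No spherical
coordinates are needed. -/
theorem lintegral_cosSqHalf_eq (hd : 2 ≤ d) {e : E d} (he : e ≠ 0) {H : ℝ → ENNReal}
    (hH : Measurable H) :
    ∫⁻ σ : Metric.sphere (0 : E d) 1, H (cosSqHalf e σ) ∂sphereMeasure d =
      ∫⁻ σ : Metric.sphere (0 : E d) 1, halfAngleWeight d H (cosAng e σ) ∂sphereMeasure d := by
  set V := volume (Metric.ball (0 : E d) 1) with hV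
  have hV0 : V ≠ 0 := (Metric.measure_ball_pos volume _ one_pos).ne'
  have hVt : V ≠ ⊤ := measure_ball_lt_top.ne
  set Ξ : ℝ → ENNReal := fun c => ENNReal.ofReal (2 ^ (d - 1) * (c ^ 2)⁻¹) * H (c ^ 2) with hΞ
  have hΞm : Measurable Ξ := by fun_prop
  have hm1 : Measurable fun p : E d × Metric.sphere (0 : E d) 1 =>
      (Metric.ball (0 : E d) 1).indicator 1 p.1 * H (cosSqHalf p.1 p.2) := by
    have h1 : Measurable ((Metric.ball (0 : E d) 1).indicator (1 : E d → ENNReal)) :=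
      measurable_one.indicator measurableSet_ball
    have h2 : Measurable fun p : E d × Metric.sphere (0 : E d) 1 => H (cosSqHalf p.1 p.2) :=
      hH.comp measurable_cosSqHalf_coe
    have h3 : Measurable fun p : E d × Metric.sphere (0 : E d) 1 =>
        (Metric.ball (0 : E d) 1).indicator (1 : E d → ENNReal) p.1 := h1.comp measurable_fst
    exact h3.mul h2
  have hm2 : ∀ e : E d → E d, Measurable e →
      Measurable fun p : E d × Metric.sphere (0 : E d) 1 =>
      (Set.Ioi ‖p.1‖).indicator Ξ (cosAng (e p.1) p.2) := by
    intro e he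
    have hp : Measurable fun p : E d × Metric.sphere (0 : E d) 1 => (e p.1, p.2) :=
      (he.comp measurable_fst).prodMk measurable_snd
    have hc : Measurable fun p : E d × Metric.sphere (0 : E d) 1 => cosAng (e p.1) p.2 := by
      have h := measurable_cosAng_coe (d := d)
      exact h.comp hp
    have : (fun p : E d × Metric.sphere (0 : E d) 1 =>
        (Set.Ioi ‖p.1‖).indicator Ξ (cosAng (e p.1) p.2)) =
        {p : E d × Metric.sphere (0 : E d) 1 | ‖p.1‖ < cosAng (e p.1) p.2}.indicator
          fun p => Ξ (cosAng (e p.1) p.2) := rfl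
    rw [this]
    exact (hΞm.comp hc).indicator (measurableSet_lt measurable_fst.norm hc)
  have hI1 : ∫⁻ z : E d, ∫⁻ σ : Metric.sphere (0 : E d) 1,
      (Metric.ball (0 : E d) 1).indicator 1 z * H (cosSqHalf z σ) ∂sphereMeasure d =
      V * ∫⁻ σ : Metric.sphere (0 : E d) 1, H (cosSqHalf e σ) ∂sphereMeasure d := by
    have : ∀ᵐ z : E d, ∫⁻ σ : Metric.sphere (0 : E d) 1,
        (Metric.ball (0 : E d) 1).indicator 1 z * H (cosSqHalf z σ) ∂sphereMeasure d =
        (Metric.ball (0 : E d) 1).indicator 1 z *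
          ∫⁻ σ : Metric.sphere (0 : E d) 1, H (cosSqHalf e σ) ∂sphereMeasure d := by
      filter_upwards [ae_ne_zero hd] with z hz
      have hm : Measurable fun σ : Metric.sphere (0 : E d) 1 => H (cosSqHalf z σ) :=
        hH.comp (measurable_cosSqHalf_right z)
      rw [lintegral_const_mul _ hm]
      congr 1
      exact lintegral_sphere_cosAng_eq hz he (φ := fun c => H ((1 + c) / 2)) (by fun_prop)
    rw [lintegral_congr_ae this, lintegral_mul_const _
      (measurable_one.indicator measurableSet_ball), lintegral_indicator_one measurableSet_ball]
  have hI2 : ∫⁻ z : E d, ∫⁻ σ : Metric.sphere (0 : E d) 1,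
      (Metric.ball (0 : E d) 1).indicator 1 z * H (cosSqHalf z σ) ∂sphereMeasure d =
      ∫⁻ y : E d, ∫⁻ σ : Metric.sphere (0 : E d) 1,
        (Set.Ioi ‖y‖).indicator Ξ (cosAng y σ) ∂sphereMeasure d := by
    have hm3 := hm2 id measurable_id
    simp only [id] at hm3
    refine (lintegral_sphere_swap
      (F := fun z σ => (Metric.ball (0 : E d) 1).indicator 1 z * H (cosSqHalf z σ)) hm1).trans (Eq.trans ?_
      (lintegral_sphere_swap (F := fun y σ => (Set.Ioi ‖y‖).indicator Ξ (cosAng y σ)) hm3).symm)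
    refine lintegral_congr fun σ => ?_
    have hσ : ‖(σ : E d)‖ = 1 := by simp
    rw [lintegral_collision hd hσ, ← lintegral_indicator
      (measurableSet_lt measurable_const (by fun_prop))]
    refine lintegral_congr fun y => ?_
    simp only [Set.indicator_apply, Set.mem_ofPred_eq, Set.mem_Ioi]
    by_cases hy : 0 < inner ℝ y (σ : E d)
    · have hy0 : 0 < ‖y‖ := norm_pos_iff.2 (ne_zero_of_inner_pos hy)
      have hc : 0 < cosAng y σ := div_pos hy hy0
      have hmem : collisionInv (σ : E d) y ∈ Metric.ball (0 : E d) 1 ↔ ‖y‖ < cosAng y σ := by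
        rw [mem_ball_zero_iff, norm_collisionInv_eq hσ hy, div_lt_one hc]
      rw [if_pos hy, cosSqHalf_collisionInv hσ hy]
      by_cases hm : ‖y‖ < cosAng y σ
      · rw [if_pos hm, Set.indicator_of_mem (hmem.2 hm), Pi.one_apply, one_mul]
      · rw [if_neg hm, Set.indicator_of_notMem (mt hmem.1 hm), zero_mul, mul_zero]
    · have hc : ¬ ‖y‖ < cosAng y σ := by
        rw [not_lt]
        exact (div_nonpos_of_nonpos_of_nonneg (not_lt.1 hy) (norm_nonneg _)).trans (norm_nonneg _)
      rw [if_neg hy, if_neg hc]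
  have hI3 : ∫⁻ y : E d, ∫⁻ σ : Metric.sphere (0 : E d) 1,
        (Set.Ioi ‖y‖).indicator Ξ (cosAng y σ) ∂sphereMeasure d =
      ∫⁻ y : E d, ∫⁻ σ : Metric.sphere (0 : E d) 1,
        (Set.Ioi ‖y‖).indicator Ξ (cosAng e σ) ∂sphereMeasure d := by
    refine lintegral_congr_ae ?_
    filter_upwards [ae_ne_zero hd] with y hy
    exact lintegral_sphere_cosAng_eq hy he (hΞm.indicator measurableSet_Ioi)
  have hI4 : ∫⁻ y : E d, ∫⁻ σ : Metric.sphere (0 : E d) 1,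
        (Set.Ioi ‖y‖).indicator Ξ (cosAng e σ) ∂sphereMeasure d =
      V * ∫⁻ σ : Metric.sphere (0 : E d) 1, halfAngleWeight d H (cosAng e σ)
        ∂sphereMeasure d := by
    have hmw : Measurable (halfAngleWeight d H) :=
      Measurable.indicator (by fun_prop) measurableSet_Ioi
    have hmw' : Measurable fun σ : Metric.sphere (0 : E d) 1 => halfAngleWeight d H (cosAng e σ) :=
      hmw.comp (measurable_cosAng_right e)
    have hm3 := hm2 (fun _ => e) measurable_const
    rw [lintegral_sphere_swap (F := fun y σ => (Set.Ioi ‖y‖).indicator Ξ (cosAng e σ)) hm3,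
      ← lintegral_const_mul _ hmw']
    refine lintegral_congr fun σ => ?_
    set c := cosAng e σ with hc
    have h1 : ∀ y : E d, (Set.Ioi ‖y‖).indicator Ξ c =
        (Metric.ball (0 : E d) c).indicator (fun _ => Ξ c) y := by
      intro y
      by_cases hy : ‖y‖ < c
      · rw [Set.indicator_of_mem (by exact hy), Set.indicator_of_mem (by simpa using hy)]
      · rw [Set.indicator_of_notMem (by exact hy), Set.indicator_of_notMem (by simpa using hy)]
    simp only [h1]
    rw [lintegral_indicator_const measurableSet_ball, halfAngleWeight]
    rcases le_or_gt c 0 with hc0 | hc0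
    · rw [Metric.ball_eq_empty.2 hc0, measure_empty, mul_zero, Set.indicator_of_notMem (by simpa),
        mul_zero]
    · rw [Measure.addHaar_ball_of_pos _ _ hc0, finrank_euclideanSpace_fin,
        Set.indicator_of_mem (by simpa), ← hV, mul_comm V, ← mul_assoc]
      congr 1
      rw [hΞ, mul_right_comm, ← ENNReal.ofReal_mul (by positivity)]
      congr 2
      obtain ⟨n, rfl⟩ := Nat.exists_eq_add_of_le' hd
      rw [Nat.add_sub_cancel, pow_add]
      field_simp
  rw [hI2, hI3, hI4] at hI1
  exact ((ENNReal.mul_right_inj hV0 hVt).1 hI1).symm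

/-- The transversal displacement `v' - v` as a function of `y = v - v_*'`. -/
def deviation (σ y : E d) : E d := y - collisionInv σ y

theorem deviation_eq (σ y : E d) : deviation σ y = (‖y‖ ^ 2 / inner ℝ y σ) • σ - y := by
  rw [deviation, collisionInv]
  module

theorem inner_deviation {σ y : E d} (hy : 0 < inner ℝ y σ) : inner ℝ y (deviation σ y) = 0 := by
  rw [deviation_eq, inner_sub_right, real_inner_smul_right, real_inner_self_eq_norm_sq,
    div_mul_cancel₀ _ hy.ne', sub_self]

theorem norm_sq_deviation {σ y : E d} (hσ : ‖σ‖ = 1) (hy : 0 < inner ℝ y σ) :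
    ‖deviation σ y‖ ^ 2 = ‖y‖ ^ 2 * ((cosAng y σ ^ 2)⁻¹ - 1) := by
  have hy0 : 0 < ‖y‖ := norm_pos_iff.2 (ne_zero_of_inner_pos hy)
  rw [deviation_eq, norm_sub_sq_real, norm_smul, real_inner_smul_left, hσ, Real.norm_eq_abs,
    mul_one, sq_abs, cosAng, real_inner_comm y σ]
  field_simp
  ring

theorem cosAng_pos {σ y : E d} (hy : 0 < inner ℝ y σ) : 0 < cosAng y σ :=
  div_pos hy (norm_pos_iff.2 (ne_zero_of_inner_pos hy))

theorem cosAng_le_one {σ : E d} (hσ : ‖σ‖ = 1) (y : E d) : cosAng y σ ≤ 1 := by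
  have h := abs_real_inner_div_norm_mul_norm_le_one y σ
  rw [hσ, mul_one] at h
  exact (abs_le.1 h).2

/-- Averaging over the reflection about the line through `y`. -/
theorem two_mul_lintegral_sphere_deviation {y : E d} (hy : y ≠ 0) {W : ℝ → ENNReal}
    (hW : Measurable W) {ψ : E d → ENNReal} (hψ : Measurable ψ) (v : E d) :
    2 * ∫⁻ σ : Metric.sphere (0 : E d) 1,
      (Set.Ioi (0 : ℝ)).indicator W (cosAng y σ) * ψ (v + deviation σ y) ∂sphereMeasure d =
    ∫⁻ σ : Metric.sphere (0 : E d) 1, (Set.Ioi (0 : ℝ)).indicator W (cosAng y σ) *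
      (ψ (v + deviation σ y) + ψ (v - deviation σ y)) ∂sphereMeasure d := by
  have hWi : Measurable ((Set.Ioi (0 : ℝ)).indicator W) := hW.indicator measurableSet_Ioi
  have hdev : Measurable fun σ : E d => deviation σ y := by
    have := measurable_collisionInv.comp (measurable_const.prodMk measurable_id :
      Measurable fun σ : E d => (y, σ))
    exact measurable_const.sub this
  have hcos : Measurable fun σ : E d => cosAng y σ :=
    measurable_cosAng.comp (measurable_const.prodMk measurable_id)
  set T : E d → ENNReal := fun σ => (Set.Ioi (0 : ℝ)).indicator W (cosAng y σ) *
    ψ (v + deviation σ y) with hT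
  have hTm : Measurable T := by fun_prop
  set A := (ℝ ∙ y).reflection with hA
  have hAy : A y = y := Submodule.reflection_mem_subspace_eq_self (Submodule.mem_span_singleton_self y)
  have hinner : ∀ σ, inner ℝ y (A σ) = inner ℝ y σ := fun σ => by
    conv_lhs => rw [← hAy]
    exact A.inner_map_map y σ
  have hcosA : ∀ σ, cosAng y (A σ) = cosAng y σ := fun σ => by rw [cosAng, cosAng, hinner]
  have hTA : ∀ σ, T (A σ) = (Set.Ioi (0 : ℝ)).indicator W (cosAng y σ) *
      ψ (v - deviation σ y) := by
    intro σ
    simp only [hT, hcosA]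
    by_cases h : 0 < cosAng y σ
    · have hy0 : 0 < ‖y‖ := norm_pos_iff.2 hy
      have hin : 0 < inner ℝ y σ := by
        have := mul_pos h hy0
        rwa [cosAng, div_mul_cancel₀ _ hy0.ne'] at this
      have hdevA : deviation (A σ) y = -deviation σ y := by
        have h1 : deviation (A σ) y = A (deviation σ y) := by
          rw [deviation_eq, deviation_eq, hinner, map_sub, map_smul, hAy]
        rw [h1]
        exact Submodule.reflection_mem_subspace_orthogonalComplement_eq_neg
          (Submodule.mem_orthogonal_singleton_iff_inner_right.2 (inner_deviation hin))
      rw [hdevA, sub_eq_add_neg]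
    · rw [Set.indicator_of_notMem (by simpa using h), zero_mul, zero_mul]
  have h := lintegral_sphere_isometry A hTm
  have hTc : Measurable fun σ : Metric.sphere (0 : E d) 1 => T σ := hTm.comp measurable_subtype_coe
  calc 2 * ∫⁻ σ : Metric.sphere (0 : E d) 1, T σ ∂sphereMeasure d
      = ∫⁻ σ : Metric.sphere (0 : E d) 1, T σ ∂sphereMeasure d +
        ∫⁻ σ : Metric.sphere (0 : E d) 1, T (A σ) ∂sphereMeasure d := by rw [h, two_mul]
    _ = _ := by
        rw [← lintegral_add_left hTc]
        refine lintegral_congr fun σ => ?_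
        rw [hTA, mul_add]

end AngularIntegrals

/-! ### The gain term in post-collisional variables. -/

section Gain

variable {d : ℕ}

/-- The gain term in the variables `z = v - v_*`, `σ`. -/
def gainIntegrand (γ : ℝ) (k : ℝ → ENNReal) (g ψ : E d → ENNReal) (v z σ : E d) : ENNReal :=
  ENNReal.ofReal (‖z‖ ^ γ) * k (cosSqHalf z σ) * (g (v - collisionMap σ z) *
    ψ (v - z + collisionMap σ z))

theorem measurable_gainIntegrand (γ : ℝ) {k : ℝ → ENNReal} (hk : Measurable k)
    {g ψ : E d → ENNReal} (hg : Measurable g) (hψ : Measurable ψ) (v : E d) :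
    Measurable fun p : E d × E d => gainIntegrand γ k g ψ v p.1 p.2 := by
  have h1 := measurable_cosSqHalf (d := d)
  have h2 := measurable_collisionMap (d := d)
  unfold gainIntegrand
  fun_prop

/-- The weight of the gain term in the variables `y = v - v_*'`, `σ`. -/
def gainWeight (γ : ℝ) (k : ℝ → ENNReal) (y : E d) (κ : ℝ) : ENNReal :=
  (Set.Ioi (0 : ℝ)).indicator (fun κ => ENNReal.ofReal (2 ^ (d - 1) * (κ ^ 2)⁻¹) *
    (ENNReal.ofReal ((‖y‖ / κ) ^ γ) * k (κ ^ 2))) κ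

theorem measurable_gainWeight (γ : ℝ) {k : ℝ → ENNReal} (hk : Measurable k) :
    Measurable fun p : E d × E d => gainWeight γ k p.1 (cosAng p.1 p.2) := by
  have hc := measurable_cosAng (d := d)
  have h : Measurable fun p : E d × E d => ENNReal.ofReal (2 ^ (d - 1) * (cosAng p.1 p.2 ^ 2)⁻¹) *
    (ENNReal.ofReal ((‖p.1‖ / cosAng p.1 p.2) ^ γ) * k (cosAng p.1 p.2 ^ 2)) := by fun_prop
  have h0 : MeasurableSet {p : E d × E d | 0 < cosAng p.1 p.2} :=
    measurableSet_lt measurable_const hc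
  exact h.indicator h0

theorem measurable_deviation : Measurable fun p : E d × E d => deviation p.2 p.1 := by
  have h := measurable_collisionInv (d := d)
  exact measurable_fst.sub h

/-- `gainIntegrand` in the variables `y = v - v_*'`, `σ`. -/
def gainIntegrandPost (γ : ℝ) (k : ℝ → ENNReal) (g ψ : E d → ENNReal) (v y σ : E d) : ENNReal :=
  g (v - y) * (gainWeight γ k y (cosAng y σ) * ψ (v + deviation σ y))

theorem measurable_gainIntegrandPost (γ : ℝ) {k : ℝ → ENNReal} (hk : Measurable k)
    {g ψ : E d → ENNReal} (hg : Measurable g) (hψ : Measurable ψ) (v : E d) :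
    Measurable fun p : E d × E d => gainIntegrandPost γ k g ψ v p.1 p.2 := by
  have hw := measurable_gainWeight (d := d) γ hk
  have hdev := measurable_deviation (d := d)
  have h2 : Measurable fun p : E d × E d => ψ (v + deviation p.2 p.1) := by
    fun_prop
  have h3 : Measurable fun p : E d × E d => g (v - p.1) := by
    fun_prop
  unfold gainIntegrandPost
  exact h3.mul (hw.mul h2)

theorem gainIntegrand_collisionInv (γ : ℝ) (k : ℝ → ENNReal) (g ψ : E d → ENNReal) (v : E d)
    {y σ : E d} (hσ : ‖σ‖ = 1) (hy : 0 < inner ℝ y σ) :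
    ENNReal.ofReal (2 ^ (d - 1) * (cosAng y σ ^ 2)⁻¹) *
      gainIntegrand γ k g ψ v (collisionInv σ y) σ = gainIntegrandPost γ k g ψ v y σ := by
  rw [gainIntegrandPost, gainWeight, Set.indicator_of_mem (by exact cosAng_pos hy), gainIntegrand,
    cosSqHalf_collisionInv hσ hy, collisionMap_collisionInv hσ hy, norm_collisionInv_eq hσ hy,
    deviation, ← add_sub_assoc, sub_add_eq_add_sub]
  ring

theorem lintegral_gain_eq (hd : 2 ≤ d) (γ : ℝ) {k : ℝ → ENNReal} (hk : Measurable k)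
    {g ψ : E d → ENNReal} (hg : Measurable g) (hψ : Measurable ψ) (v : E d) :
    ∫⁻ z : E d, ∫⁻ σ : Metric.sphere (0 : E d) 1, gainIntegrand γ k g ψ v z σ ∂sphereMeasure d =
      ∫⁻ y : E d, ∫⁻ σ : Metric.sphere (0 : E d) 1, gainIntegrandPost γ k g ψ v y σ
        ∂sphereMeasure d := by
  have h1 := measurable_restrict_prod (measurable_gainIntegrand γ hk hg hψ v)
  have h2 := measurable_restrict_prod (measurable_gainIntegrandPost γ hk hg hψ v)
  refine (lintegral_sphere_swap h1).trans (Eq.trans ?_ (lintegral_sphere_swap h2).symm)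
  refine lintegral_congr fun σ => ?_
  have hσ : ‖(σ : E d)‖ = 1 := by simp
  rw [lintegral_collision hd hσ, ← lintegral_indicator
    (measurableSet_lt measurable_const (by fun_prop))]
  refine lintegral_congr fun y => ?_
  by_cases hy : 0 < inner ℝ y (σ : E d)
  · rw [Set.indicator_of_mem (by exact hy), gainIntegrand_collisionInv γ k g ψ v hσ hy]
  · have hc : ¬ 0 < cosAng y σ := by
      rw [not_lt]
      exact div_nonpos_of_nonpos_of_nonneg (not_lt.1 hy) (norm_nonneg _)
    rw [Set.indicator_of_notMem (by exact hy), gainIntegrandPost, gainWeight,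
      Set.indicator_of_notMem (by exact hc), zero_mul, mul_zero]

/-- `κ ^ (d + γ)` is exactly the factor that converts the Jacobian and the stretched relative
velocity `‖y‖ / κ` into `‖y‖ ^ γ` times the half-angle weight, and so back into an integral over the
original angle. -/
theorem gainWeight_mul_rpow (hd : 2 ≤ d) (γ : ℝ) (k : ℝ → ENNReal) (y : E d) {κ : ℝ} (hκ : 0 < κ) :
    gainWeight γ k y κ * ENNReal.ofReal (κ ^ (d + γ)) = ENNReal.ofReal (‖y‖ ^ γ) *
      (ENNReal.ofReal (2 ^ (d - 1) * κ ^ (d - 2)) * k (κ ^ 2)) := by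
  have hreal : 2 ^ (d - 1) * (κ ^ 2)⁻¹ * ((‖y‖ / κ) ^ γ * κ ^ (d + γ)) =
      ‖y‖ ^ γ * (2 ^ (d - 1) * κ ^ (d - 2)) := by
    obtain ⟨n, rfl⟩ := Nat.exists_eq_add_of_le' hd
    rw [Nat.add_sub_cancel, Real.div_rpow (norm_nonneg y) hκ.le, Real.rpow_add hκ,
      Real.rpow_natCast, pow_add]
    have : κ ^ γ ≠ 0 := (Real.rpow_pos_of_pos hκ γ).ne'
    field_simp
  rw [gainWeight, Set.indicator_of_mem (by exact hκ)]
  calc _ = ENNReal.ofReal (2 ^ (d - 1) * (κ ^ 2)⁻¹) * (ENNReal.ofReal ((‖y‖ / κ) ^ γ) *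
        ENNReal.ofReal (κ ^ (d + γ))) * k (κ ^ 2) := by ring
    _ = ENNReal.ofReal (‖y‖ ^ γ) * ENNReal.ofReal (2 ^ (d - 1) * κ ^ (d - 2)) * k (κ ^ 2) := by
        rw [← ENNReal.ofReal_mul (by positivity), ← ENNReal.ofReal_mul (by positivity),
          ← ENNReal.ofReal_mul (by positivity), hreal]
    _ = _ := by ring

/-- Reduces a bound of the gain term to a pointwise bound on the symmetric pair `v ± h`, where `h`
is the deviation. If `M` were the constant value of the barrier at `v`, the right side would have
exactly the form of the loss term. -/
theorem lintegral_gain_le (hd : 2 ≤ d) (γ : ℝ) {k : ℝ → ENNReal} (hk : Measurable k)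
    {g ψ : E d → ENNReal} (hg : Measurable g) (hψ : Measurable ψ) (v : E d)
    {M : ℝ → E d → ENNReal} (hM : ∀ y, Measurable fun q => M q y)
    (h : ∀ y σ : E d, ‖σ‖ = 1 → 0 < inner ℝ y σ → g (v - y) ≠ 0 → k (cosAng y σ ^ 2) ≠ 0 →
      ψ (v + deviation σ y) + ψ (v - deviation σ y) ≤
        2 * (ENNReal.ofReal (cosAng y σ ^ (d + γ)) * M (cosAng y σ ^ 2) y)) :
    ∫⁻ z : E d, ∫⁻ σ : Metric.sphere (0 : E d) 1, gainIntegrand γ k g ψ v z σ ∂sphereMeasure d ≤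
      ∫⁻ y : E d, g (v - y) * (ENNReal.ofReal (‖y‖ ^ γ) *
        ∫⁻ σ : Metric.sphere (0 : E d) 1, k (cosSqHalf y σ) * M (cosSqHalf y σ) y
          ∂sphereMeasure d) := by
  rw [lintegral_gain_eq hd γ hk hg hψ v]
  refine lintegral_mono_ae ?_
  filter_upwards [ae_ne_zero hd] with y hy
  set w : ℝ → ENNReal := fun κ => ENNReal.ofReal (2 ^ (d - 1) * (κ ^ 2)⁻¹) *
    (ENNReal.ofReal ((‖y‖ / κ) ^ γ) * k (κ ^ 2)) with hw
  have hwm : Measurable w := by fun_prop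
  have hcosy := measurable_cosAng_right y
  simp only [gainIntegrandPost]
  have hwi : Measurable fun σ : Metric.sphere (0 : E d) 1 => gainWeight γ k y (cosAng y σ) :=
    (hwm.indicator measurableSet_Ioi).comp hcosy
  have hdev := measurable_deviation (d := d)
  have hdevy : Measurable fun σ : Metric.sphere (0 : E d) 1 => deviation (σ : E d) y :=
    measurable_restrict_right hdev y
  have hm1 : Measurable fun σ : Metric.sphere (0 : E d) 1 =>
      gainWeight γ k y (cosAng y σ) * ψ (v + deviation (σ : E d) y) := by fun_prop
  rw [lintegral_const_mul _ hm1]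
  by_cases hg0 : g (v - y) = 0
  · rw [hg0, zero_mul, zero_mul]
  refine mul_le_mul_right ?_ _
  set H : ℝ → ENNReal := fun q => k q * M q y with hH
  have hHm : Measurable H := hk.mul (hM y)
  have hmw : Measurable (halfAngleWeight d H) :=
    Measurable.indicator (by fun_prop) measurableSet_Ioi
  have hmw' : Measurable fun σ : Metric.sphere (0 : E d) 1 => halfAngleWeight d H (cosAng y σ) :=
    hmw.comp hcosy
  rw [lintegral_cosSqHalf_eq hd hy hHm,
    ← ENNReal.mul_le_mul_iff_right two_ne_zero ENNReal.ofNat_ne_top,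
    ← lintegral_const_mul _ hmw', ← lintegral_const_mul _ (hmw'.const_mul _)]
  -- The integral is doubled in order to average over the reflection `h ↦ -h`.
  refine (two_mul_lintegral_sphere_deviation hy hwm hψ v).le.trans (lintegral_mono fun σ => ?_)
  have hσ : ‖(σ : E d)‖ = 1 := by simp
  by_cases hc : 0 < cosAng y σ
  · have hy0 : 0 < ‖y‖ := norm_pos_iff.2 hy
    have hin : 0 < inner ℝ y (σ : E d) := by
      have := mul_pos hc hy0
      rwa [cosAng, div_mul_cancel₀ _ hy0.ne'] at this
    by_cases hk0 : k (cosAng y σ ^ 2) = 0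
    · simp [hw, hk0, Set.indicator_apply]
    have hb := h y σ hσ hin hg0 hk0
    calc gainWeight γ k y (cosAng y σ) *
          (ψ (v + deviation (σ : E d) y) + ψ (v - deviation (σ : E d) y))
        ≤ gainWeight γ k y (cosAng y σ) * (2 * (ENNReal.ofReal (cosAng y σ ^ (d + γ)) *
          M (cosAng y σ ^ 2) y)) := by gcongr
      _ = 2 * (gainWeight γ k y (cosAng y σ) * ENNReal.ofReal (cosAng y σ ^ (d + γ))) *
          M (cosAng y σ ^ 2) y := by ring
      _ = _ := by
          rw [gainWeight_mul_rpow hd γ k y hc, halfAngleWeight, Set.indicator_of_mem (by exact hc)]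
          simp only [hH]
          ring
  · rw [Set.indicator_of_notMem (by exact hc), zero_mul]
    exact zero_le

end Gain

/-! ### Pointwise bounds on the weight at the symmetric points `v ± h`. -/

section SymmetricPairs

theorem sub_two_mul_sq_le_log_one_add {x : ℝ} (hx : |x| ≤ 1 / 2) : x - 2 * x ^ 2 ≤ Real.log (1 + x) := by
  have h := Real.abs_log_sub_add_sum_range_le (x := -x) (by rw [abs_neg]; linarith) 1
  rw [abs_neg] at h
  simp only [Finset.sum_range_one, zero_add, pow_one, sub_neg_eq_add, Nat.cast_zero, div_one,
    Nat.reduceAdd, sq_abs] at h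
  have h2 : x ^ 2 / (1 - |x|) ≤ 2 * x ^ 2 := by
    rw [div_le_iff₀ (by linarith)]
    nlinarith [sq_nonneg x]
  have h3 := (abs_le.1 h).1
  linarith

/-- The linear terms of the two logarithms combine into `cosh (a x) ≤ exp (a² x² / 2)`, so the error
is only quadratic in `x`. -/
theorem one_add_rpow_neg_add_le {a x : ℝ} (ha : 0 ≤ a) (hx : |x| ≤ 1 / 2) :
    (1 + x) ^ (-a) + (1 - x) ^ (-a) ≤ 2 * Real.exp ((2 * a + a ^ 2 / 2) * x ^ 2) := by
  have key : ∀ u : ℝ, |u| ≤ 1 / 2 → (1 + u) ^ (-a) ≤ Real.exp (-(a * u)) * Real.exp (2 * a * u ^ 2) := by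
    intro u hu
    have hpos : 0 < 1 + u := by
      have := (abs_le.1 hu).1
      linarith
    rw [Real.rpow_def_of_pos hpos, ← Real.exp_add, Real.exp_le_exp]
    nlinarith [mul_le_mul_of_nonneg_left (sub_two_mul_sq_le_log_one_add hu) ha]
  have h1 := key x hx
  have h2 := key (-x) (by rwa [abs_neg])
  rw [← sub_eq_add_neg, mul_neg, neg_neg, neg_sq] at h2
  have hc := Real.cosh_le_exp_half_sq (a * x)
  rw [Real.cosh_eq] at hc
  have he := Real.exp_pos (2 * a * x ^ 2)
  calc (1 + x) ^ (-a) + (1 - x) ^ (-a)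
      ≤ 2 * (Real.exp (2 * a * x ^ 2) * ((Real.exp (a * x) + Real.exp (-(a * x))) / 2)) := by
        linarith
    _ ≤ 2 * (Real.exp (2 * a * x ^ 2) * Real.exp ((a * x) ^ 2 / 2)) := by gcongr
    _ = _ := by
        rw [← Real.exp_add]
        ring_nf

theorem add_rpow_neg_add_le {a S x : ℝ} (ha : 0 ≤ a) (hS : 0 < S) (hx : |x| ≤ S / 2) :
    (S + x) ^ (-a) + (S - x) ^ (-a) ≤
      2 * S ^ (-a) * Real.exp ((2 * a + a ^ 2 / 2) * (x / S) ^ 2) := by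
  have hx' : |x / S| ≤ 1 / 2 := by
    rw [abs_div, abs_of_pos hS, div_le_iff₀ hS]
    linarith
  have hb := abs_le.1 hx'
  have h1 : S + x = S * (1 + x / S) := by field_simp
  have h2 : S - x = S * (1 - x / S) := by field_simp
  rw [h1, h2, Real.mul_rpow hS.le (by linarith), Real.mul_rpow hS.le (by linarith), ← mul_add]
  calc _ ≤ S ^ (-a) * (2 * Real.exp ((2 * a + a ^ 2 / 2) * (x / S) ^ 2)) := by
        gcongr
        exact one_add_rpow_neg_add_le ha hx'
    _ = _ := by ring

variable {d : ℕ}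

/-- The squared brackets at `v ± h` are `S ± x` with `S = bracket v ^ 2 + ‖h‖ ^ 2` and `x = 2 *
inner ℝ v h`; the constant is `2 a + a² / 2` for `a = m / 2`. -/
theorem bracket_rpow_add_bracket_rpow_le {m : ℝ} (hm : 0 ≤ m) {v h : E d}
    (hvh : |2 * inner ℝ v h| ≤ (bracket v ^ 2 + ‖h‖ ^ 2) / 2) :
    bracket (v + h) ^ (-m) + bracket (v - h) ^ (-m) ≤
      2 * (bracket v ^ 2 + ‖h‖ ^ 2) ^ (-(m / 2)) * Real.exp ((m + m ^ 2 / 8) *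
        (2 * inner ℝ v h / (bracket v ^ 2 + ‖h‖ ^ 2)) ^ 2) := by
  have hb := bracket_pos v
  have h1 : bracket (v + h) ^ (-m) = (bracket v ^ 2 + ‖h‖ ^ 2 + 2 * inner ℝ v h) ^ (-(m / 2)) := by
    rw [bracket_rpow_eq, norm_add_sq_real, bracket_sq, neg_div]
    ring_nf
  have h2 : bracket (v - h) ^ (-m) = (bracket v ^ 2 + ‖h‖ ^ 2 - 2 * inner ℝ v h) ^ (-(m / 2)) := by
    rw [bracket_rpow_eq, norm_sub_sq_real, bracket_sq, neg_div]
    ring_nf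
  rw [h1, h2]
  refine (add_rpow_neg_add_le (by positivity) (by positivity) hvh).trans (le_of_eq ?_)
  ring_nf

/-- At `δ = 0` the right side of the last inequality equals `m`, so the gap `p < m` leaves room for
small `δ`. -/
theorem exists_near_parameter {p m : ℝ} (hpm : p < m) :
    ∃ δ : ℝ, 0 < δ ∧ δ < 1 / 4 ∧
      p ≤ 2 * (1 - 2 * δ) ^ 2 * (m / 2 - 4 * (m + m ^ 2 / 8) * δ ^ 2) := by
  have hc : Continuous fun δ : ℝ => 2 * (1 - 2 * δ) ^ 2 * (m / 2 - 4 * (m + m ^ 2 / 8) * δ ^ 2) := by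
    fun_prop
  have h0 : ∀ᶠ δ in 𝓝 (0 : ℝ), p < 2 * (1 - 2 * δ) ^ 2 *
      (m / 2 - 4 * (m + m ^ 2 / 8) * δ ^ 2) :=
    (hc.tendsto 0).eventually (lt_mem_nhds (by norm_num; linarith))
  have h1 : ∀ᶠ δ in 𝓝[>] (0 : ℝ), 0 < δ ∧ δ < 1 / 4 :=
    Ioo_mem_nhdsGT (by norm_num)
  obtain ⟨δ, h, h2⟩ := ((h0.filter_mono nhdsWithin_le_nhds).and h1).exists
  exact ⟨δ, h2.1, h2.2, h.le⟩

set_option maxHeartbeats 1000000 in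
-- When `v - y` is small, `h` is orthogonal to `y` and hence almost orthogonal to `v`, while `‖h‖²`
-- is about `bracket v ^ 2 * (κ⁻² - 1)`. Both brackets are then about `bracket v / κ`, and the
-- weight gains nearly `κ ^ m`. The errors in `δ` lower the exponent slightly, and the gap between
-- `p` and `m` absorbs this.
theorem near_pair_le {p m δ : ℝ} (hp : 0 < p) (hm : 0 ≤ m) (hδ : 0 < δ) (hδ1 : δ < 1 / 4)
    (hpδ : p ≤ 2 * (1 - 2 * δ) ^ 2 * (m / 2 - 4 * (m + m ^ 2 / 8) * δ ^ 2))
    {v y σ : E d} (hσ : ‖σ‖ = 1) (hy : 0 < inner ℝ y σ) (hw : v - y ∉ farZone δ v) :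
    bracket (v + deviation σ y) ^ (-m) + bracket (v - deviation σ y) ^ (-m) ≤
      2 * (cosAng y σ ^ p * bracket v ^ (-m)) := by
  obtain ⟨hw1, hw2, -⟩ := norm_sub_bounds_of_notMem_farZone hδ hδ1 hw
  rw [sub_sub_cancel] at hw2
  have hκ := cosAng_pos hy
  have hκ1 := cosAng_le_one hσ y
  have hh2 := norm_sq_deviation hσ hy
  have hin : inner ℝ v (deviation σ y) = inner ℝ (v - y) (deviation σ y) := by
    rw [inner_sub_left, inner_deviation hy, sub_zero]
  set h := deviation σ y with hh
  set κ := cosAng y σ with hκd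
  set c := m + m ^ 2 / 8 with hc
  have hc0 : 0 ≤ c := by positivity
  have hb := bracket_pos v
  have hS : 0 < bracket v ^ 2 + ‖h‖ ^ 2 := by positivity
  have hx : |2 * inner ℝ v h| ≤ 2 * δ * (bracket v * ‖h‖) := by
    rw [hin, abs_mul, abs_of_pos (by norm_num : (0 : ℝ) < 2)]
    have := (abs_real_inner_le_norm (v - y) h).trans
      (mul_le_mul_of_nonneg_right hw1 (norm_nonneg h))
    linarith
  have hamgm : 2 * (bracket v * ‖h‖) ≤ bracket v ^ 2 + ‖h‖ ^ 2 := by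
    nlinarith [sq_nonneg (bracket v - ‖h‖)]
  have hbh : 0 ≤ bracket v * ‖h‖ := by positivity
  have hpair := bracket_rpow_add_bracket_rpow_le hm (v := v) (h := h) (by nlinarith)
  set D := 1 + ‖h‖ ^ 2 / bracket v ^ 2 with hD
  have hD1 : 1 ≤ D := le_add_of_nonneg_right (by positivity)
  have hD0 : 0 < D := by linarith
  have hSD : bracket v ^ 2 + ‖h‖ ^ 2 = bracket v ^ 2 * D := by
    rw [hD]
    field_simp
  -- Bounding the quadratic error by a multiple of `log D` makes its exponential a small power of
  -- `D`, to be subtracted from the main exponent.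
  have hxS : (2 * inner ℝ v h / (bracket v ^ 2 + ‖h‖ ^ 2)) ^ 2 ≤ 4 * δ ^ 2 * Real.log D := by
    have h1 : (2 * inner ℝ v h) ^ 2 ≤ (2 * δ * (bracket v * ‖h‖)) ^ 2 := sq_le_sq' (by
      linarith [(abs_le.1 hx).1]) (abs_le.1 hx).2
    have h2 : 1 - D⁻¹ ≤ Real.log D := Real.one_sub_inv_le_log_of_pos hD0
    have h3 : ‖h‖ ^ 2 = bracket v ^ 2 * (D - 1) := by linarith
    calc (2 * inner ℝ v h / (bracket v ^ 2 + ‖h‖ ^ 2)) ^ 2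
        ≤ (2 * δ * (bracket v * ‖h‖)) ^ 2 / (bracket v ^ 2 + ‖h‖ ^ 2) ^ 2 := by
          rw [div_pow]
          gcongr
      _ = 4 * δ ^ 2 * ((1 - D⁻¹) * D⁻¹) := by
          rw [hSD, mul_pow, mul_pow (bracket v), h3]
          field_simp
          ring
      _ ≤ 4 * δ ^ 2 * (1 - D⁻¹) := by
          have h4 : D⁻¹ ≤ 1 := inv_le_one_of_one_le₀ hD1
          have : (1 - D⁻¹) * D⁻¹ ≤ 1 - D⁻¹ := mul_le_of_le_one_right (by linarith) h4
          gcongr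
      _ ≤ _ := by gcongr
  set e := m / 2 - 4 * c * δ ^ 2 with he
  have he0 : 0 < e := by
    by_contra! hneg
    nlinarith [mul_nonneg (sq_nonneg (1 - 2 * δ)) (neg_nonneg.2 hneg)]
  -- Bernoulli's inequality with an exponent below one: `1 + p s ≥ (1 + s) ^ p` for `p = (1 - 2δ)²`
  -- and `s = κ⁻² - 1`.
  have hDlow : (κ ^ 2)⁻¹ ^ ((1 - 2 * δ) ^ 2) ≤ D := by
    have hs : 0 ≤ (κ ^ 2)⁻¹ - 1 := by
      rw [sub_nonneg]
      exact one_le_inv_iff₀.2 ⟨by positivity, pow_le_one₀ hκ.le hκ1⟩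
    have hbern := rpow_one_add_le_one_add_mul_self (s := (κ ^ 2)⁻¹ - 1) (p := (1 - 2 * δ) ^ 2)
      (by linarith) (by positivity) (by nlinarith)
    rw [add_sub_cancel] at hbern
    refine hbern.trans ?_
    rw [hD, hh2]
    gcongr
    rw [mul_div_right_comm]
    gcongr
    rw [← div_pow]
    gcongr
    · linarith
    · rwa [le_div_iff₀ hb]
  calc _ ≤ _ := hpair
    _ ≤ 2 * (bracket v ^ 2 * D) ^ (-(m / 2)) * Real.exp (c * (4 * δ ^ 2 * Real.log D)) := by
        rw [hSD] at hxS ⊢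
        gcongr
    _ = 2 * (D ^ (-e) * bracket v ^ (-m)) := by
        have h1 : Real.exp (c * (4 * δ ^ 2 * Real.log D)) = D ^ (4 * c * δ ^ 2) := by
          rw [Real.rpow_def_of_pos hD0]
          ring_nf
        rw [h1, Real.mul_rpow (by positivity) hD0.le, ← Real.rpow_natCast, ← Real.rpow_mul hb.le,
          show -e = -(m / 2) + 4 * c * δ ^ 2 by rw [he]; ring, Real.rpow_add hD0]
        have : ((2 : ℕ) : ℝ) * -(m / 2) = -m := by push_cast; ring
        rw [this]
        ring
    _ ≤ 2 * (κ ^ p * bracket v ^ (-m)) := by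
        gcongr
        calc D ^ (-e) ≤ ((κ ^ 2)⁻¹ ^ ((1 - 2 * δ) ^ 2)) ^ (-e) :=
              Real.rpow_le_rpow_of_nonpos (by positivity) hDlow (by linarith)
          _ = κ ^ (2 * (1 - 2 * δ) ^ 2 * e) := by
              rw [← Real.rpow_mul (by positivity), Real.inv_rpow (by positivity),
                ← Real.rpow_neg (by positivity), ← Real.rpow_natCast, ← Real.rpow_mul hκ.le]
              push_cast
              ring_nf
          _ ≤ κ ^ p := Real.rpow_le_rpow_of_exponent_ge hκ hκ1 hpδ

theorem exp_le_one_add_mul_exp {s t : ℝ} (hs : 0 ≤ s) (hst : s ≤ t) :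
    Real.exp s ≤ 1 + s * Real.exp t := by
  have h1 := Real.add_one_le_exp (-s)
  have h2 := Real.exp_pos s
  have h3 : Real.exp s * Real.exp (-s) = 1 := by rw [← Real.exp_add, add_neg_cancel, Real.exp_zero]
  have h4 := mul_le_mul_of_nonneg_left (Real.exp_le_exp.2 hst) hs
  nlinarith

theorem rpow_neg_le_one_add {p κ : ℝ} (hp : 0 ≤ p) (hκ : 0 < κ) (hκ1 : κ ≤ 1)
    (hκ2 : 1 / 2 ≤ κ ^ 2) : κ ^ (-p) ≤ 1 + p * Real.exp p * (1 - κ ^ 2) := by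
  have hk : κ ^ 2 ≤ 1 := pow_le_one₀ hκ.le hκ1
  have h1 := Real.one_sub_inv_le_log_of_pos (x := κ ^ 2) (by positivity)
  rw [Real.log_pow] at h1
  have h2 : (κ ^ 2)⁻¹ - 1 ≤ 2 * (1 - κ ^ 2) := by
    have : (κ ^ 2)⁻¹ ≤ 2 := inv_le_of_inv_le₀ (by norm_num) (by linarith)
    have h3 : (κ ^ 2)⁻¹ - 1 = (κ ^ 2)⁻¹ * (1 - κ ^ 2) := by field_simp
    rw [h3]
    exact mul_le_mul_of_nonneg_right this (by linarith)
  push_cast at h1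
  have h3 : -p * Real.log κ ≤ p * (1 - κ ^ 2) := by nlinarith
  calc κ ^ (-p) = Real.exp (-p * Real.log κ) := by rw [Real.rpow_def_of_pos hκ, mul_comm]
    _ ≤ Real.exp (p * (1 - κ ^ 2)) := Real.exp_le_exp.2 h3
    _ ≤ 1 + p * (1 - κ ^ 2) * Real.exp p :=
        exp_le_one_add_mul_exp (mul_nonneg hp (by linarith)) (by nlinarith [sq_nonneg κ])
    _ = _ := by ring

/-- The part of the weight in the far zone. -/
def farWeight (m δ : ℝ) (v u : E d) : ℝ := (farZone δ v).indicator (fun u => bracket u ^ (-m)) u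

theorem farWeight_le {m δ : ℝ} (v u : E d) : farWeight m δ v u ≤ bracket u ^ (-m) :=
  Set.indicator_le_self' (fun u _ => Real.rpow_nonneg (bracket_pos u).le _) u

theorem farWeight_le_rpow {m δ : ℝ} (hm : 0 ≤ m) (hδ : 0 < δ) (v u : E d) :
    farWeight m δ v u ≤ δ ^ (-m) * bracket v ^ (-m) := by
  have hb := bracket_pos v
  rw [← Real.mul_rpow hδ.le hb.le]
  by_cases hu : u ∈ farZone δ v
  · rw [farWeight, Set.indicator_of_mem hu]
    exact Real.rpow_le_rpow_of_nonpos (by positivity) hu (by linarith)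
  · rw [farWeight, Set.indicator_of_notMem hu]
    positivity

/-- For `‖h‖ ≤ bracket v / 4` the first-order terms of the pair cancel. Otherwise `‖h‖² / bracket v
^ 2` exceeds `1 / 16`, and each term is bounded crudely by its far-zone maximum; this is where `16 *
δ ^ (-m)` comes from. -/
theorem farWeight_add_farWeight_le {m δ : ℝ} (hm : 0 ≤ m) (hδ : 0 < δ) {v h : E d} :
    farWeight m δ v (v + h) + farWeight m δ v (v - h) ≤
      2 * bracket v ^ (-m) * (1 + ((m + m ^ 2 / 8) * 4 * Real.exp (m + m ^ 2 / 8) + 16 * δ ^ (-m)) *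
        (‖h‖ ^ 2 / bracket v ^ 2)) := by
  have hb := bracket_pos v
  set c := m + m ^ 2 / 8 with hc
  have hc0 : 0 ≤ c := by positivity
  have hW : 0 < bracket v ^ (-m) := Real.rpow_pos_of_pos hb _
  have hδm : 0 < δ ^ (-m) := Real.rpow_pos_of_pos hδ _
  have hY : 0 ≤ ‖h‖ ^ 2 / bracket v ^ 2 := by positivity
  rcases le_or_gt ‖h‖ (bracket v / 4) with hh | hh
  · have hx : |2 * inner ℝ v h| ≤ 2 * (bracket v * ‖h‖) := by
      rw [abs_mul, abs_of_pos (by norm_num : (0 : ℝ) < 2)]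
      have := (abs_real_inner_le_norm v h).trans
        (mul_le_mul_of_nonneg_right (norm_le_bracket v) (norm_nonneg h))
      linarith
    have hpair := bracket_rpow_add_bracket_rpow_le hm (v := v) (h := h)
      (by nlinarith [norm_nonneg h])
    have hX : (2 * inner ℝ v h / (bracket v ^ 2 + ‖h‖ ^ 2)) ^ 2 ≤ 4 * (‖h‖ ^ 2 / bracket v ^ 2) := by
      have h1 : (2 * inner ℝ v h) ^ 2 ≤ (2 * (bracket v * ‖h‖)) ^ 2 := sq_le_sq' (by
        linarith [(abs_le.1 hx).1]) (abs_le.1 hx).2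
      calc (2 * inner ℝ v h / (bracket v ^ 2 + ‖h‖ ^ 2)) ^ 2
          ≤ (2 * (bracket v * ‖h‖)) ^ 2 / (bracket v ^ 2) ^ 2 := by
            rw [div_pow]
            gcongr
            nlinarith [sq_nonneg ‖h‖]
        _ = _ := by
            field_simp
            ring
    have hS : (bracket v ^ 2 + ‖h‖ ^ 2) ^ (-(m / 2)) ≤ bracket v ^ (-m) := by
      calc (bracket v ^ 2 + ‖h‖ ^ 2) ^ (-(m / 2)) ≤ (bracket v ^ 2) ^ (-(m / 2)) :=
            Real.rpow_le_rpow_of_nonpos (by positivity) (by nlinarith [sq_nonneg ‖h‖])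
              (by linarith)
        _ = bracket v ^ (-m) := by
            rw [← Real.rpow_natCast, ← Real.rpow_mul hb.le]
            push_cast
            ring_nf
    have hsmall : c * (4 * (‖h‖ ^ 2 / bracket v ^ 2)) ≤ c := by
      have : ‖h‖ ^ 2 / bracket v ^ 2 ≤ 1 / 4 := by
        rw [div_le_iff₀ (by positivity)]
        nlinarith [norm_nonneg h]
      nlinarith
    have hexp := exp_le_one_add_mul_exp (by positivity) hsmall
    calc _ ≤ bracket (v + h) ^ (-m) + bracket (v - h) ^ (-m) :=
          add_le_add (farWeight_le _ _) (farWeight_le _ _)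
      _ ≤ 2 * bracket v ^ (-m) * Real.exp (c * (4 * (‖h‖ ^ 2 / bracket v ^ 2))) := by
          refine hpair.trans ?_
          gcongr
      _ ≤ 2 * bracket v ^ (-m) * (1 + c * (4 * (‖h‖ ^ 2 / bracket v ^ 2)) * Real.exp c) := by
          gcongr
      _ ≤ _ := by
          gcongr ?_ * (1 + ?_)
          rw [add_mul (c * 4 * Real.exp c)]
          have : 0 ≤ 16 * δ ^ (-m) * (‖h‖ ^ 2 / bracket v ^ 2) := by positivity
          linarith
  · have h1 : 1 ≤ 16 * (‖h‖ ^ 2 / bracket v ^ 2) := by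
      rw [← mul_div_assoc, one_le_div (by positivity)]
      nlinarith
    calc _ ≤ δ ^ (-m) * bracket v ^ (-m) + δ ^ (-m) * bracket v ^ (-m) :=
          add_le_add (farWeight_le_rpow hm hδ _ _) (farWeight_le_rpow hm hδ _ _)
      _ = 2 * bracket v ^ (-m) * (δ ^ (-m) * 1) := by ring
      _ ≤ 2 * bracket v ^ (-m) * (δ ^ (-m) * (16 * (‖h‖ ^ 2 / bracket v ^ 2))) := by gcongr
      _ ≤ _ := by
          gcongr
          have : 0 ≤ c * 4 * Real.exp c * (‖h‖ ^ 2 / bracket v ^ 2) := by positivity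
          linarith

/-- For `κ² ≥ 1/2`, both `‖h‖²` relative to `‖y‖²` and the price `κ ^ (-p) - 1` of extracting `κ ^
p` are `O(1 - κ²)`. The excess over the loss term thus carries `sin²(θ/2)`, the factor that the
assumption on `b` makes integrable. -/
theorem exists_far_pair_le {p m δ : ℝ} (hp : 0 ≤ p) (hm : 0 ≤ m) (hδ : 0 < δ) :
    ∃ C : ℝ, 0 ≤ C ∧ ∀ v y σ : E d, ‖σ‖ = 1 → 0 < inner ℝ y σ → 1 / 2 ≤ cosAng y σ ^ 2 →
      farWeight m δ v (v + deviation σ y) + farWeight m δ v (v - deviation σ y) ≤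
        2 * (cosAng y σ ^ p * (bracket v ^ (-m) *
          (1 + C * (1 - cosAng y σ ^ 2) * (1 + ‖y‖ ^ 2 / bracket v ^ 2)))) := by
  set C₁ := (m + m ^ 2 / 8) * 4 * Real.exp (m + m ^ 2 / 8) + 16 * δ ^ (-m) with hC₁
  have hC₁0 : 0 ≤ C₁ := by positivity
  refine ⟨p * Real.exp p + (1 + p * Real.exp p) * (2 * C₁), by positivity, ?_⟩
  intro v y σ hσ hy hκ2
  have hκ := cosAng_pos hy
  have hκ1 := cosAng_le_one hσ y
  have hb := bracket_pos v
  have haux := farWeight_add_farWeight_le hm hδ (v := v) (h := deviation σ y)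
  rw [← hC₁, norm_sq_deviation hσ hy] at haux
  set κ := cosAng y σ with hκd
  have hk : κ ^ 2 ≤ 1 := pow_le_one₀ hκ.le hκ1
  have hW : 0 < bracket v ^ (-m) := Real.rpow_pos_of_pos hb _
  have hrp := rpow_neg_le_one_add hp hκ hκ1 hκ2
  set P := p * Real.exp p with hP
  have hP0 : 0 ≤ P := by positivity
  set Y := ‖y‖ ^ 2 / bracket v ^ 2 with hY
  have hY0 : 0 ≤ Y := by positivity
  have hs : (κ ^ 2)⁻¹ - 1 ≤ 2 * (1 - κ ^ 2) := by
    have : (κ ^ 2)⁻¹ ≤ 2 := inv_le_of_inv_le₀ (by norm_num) (by linarith)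
    have h3 : (κ ^ 2)⁻¹ - 1 = (κ ^ 2)⁻¹ * (1 - κ ^ 2) := by field_simp
    rw [h3]
    exact mul_le_mul_of_nonneg_right this (by linarith)
  have hs0 : 0 ≤ 1 - κ ^ 2 := by linarith
  have h1 : 1 + C₁ * (‖y‖ ^ 2 * ((κ ^ 2)⁻¹ - 1) / bracket v ^ 2) ≤
      1 + C₁ * (2 * (1 - κ ^ 2) * Y) := by
    have : ‖y‖ ^ 2 * ((κ ^ 2)⁻¹ - 1) / bracket v ^ 2 = ((κ ^ 2)⁻¹ - 1) * Y := by
      rw [hY]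
      ring
    rw [this]
    gcongr
  have hκp : κ ^ p * κ ^ (-p) = 1 := by
    rw [← Real.rpow_add hκ, add_neg_cancel, Real.rpow_zero]
  have h2 : κ ^ (-p) * (1 + C₁ * (2 * (1 - κ ^ 2) * Y)) ≤
      1 + (P + (1 + P) * (2 * C₁)) * (1 - κ ^ 2) * (1 + Y) := by
    have hle : 1 + P * (1 - κ ^ 2) ≤ 1 + P := by nlinarith [sq_nonneg κ]
    calc κ ^ (-p) * (1 + C₁ * (2 * (1 - κ ^ 2) * Y))
        ≤ (1 + P * (1 - κ ^ 2)) * (1 + C₁ * (2 * (1 - κ ^ 2) * Y)) := by gcongr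
      _ = 1 + P * (1 - κ ^ 2) + (1 + P * (1 - κ ^ 2)) * (C₁ * (2 * (1 - κ ^ 2) * Y)) := by ring
      _ ≤ 1 + P * (1 - κ ^ 2) + (1 + P) * (C₁ * (2 * (1 - κ ^ 2) * Y)) := by gcongr
      _ ≤ _ := by
        have h3 : 0 ≤ P * (1 - κ ^ 2) * Y := by positivity
        have h4 : 0 ≤ (1 + P) * (2 * C₁) * (1 - κ ^ 2) := by positivity
        nlinarith
  calc _ ≤ _ := haux
    _ ≤ 2 * bracket v ^ (-m) * (1 + C₁ * (2 * (1 - κ ^ 2) * Y)) := by gcongr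
    _ = 2 * (κ ^ p * (bracket v ^ (-m) * (κ ^ (-p) * (1 + C₁ * (2 * (1 - κ ^ 2) * Y))))) := by
        linear_combination -(2 * bracket v ^ (-m) * (1 + C₁ * (2 * (1 - κ ^ 2) * Y))) * hκp
    _ ≤ _ := by gcongr

end SymmetricPairs

/-! ### Near and far contributions to the gain term. -/

section GainSplitting

variable {d : ℕ}

theorem collisionMap_neg (σ z : E d) : collisionMap (-σ) z = z - collisionMap σ z := by
  rw [collisionMap, collisionMap]
  module

/-- The map `σ ↦ -σ` exchanges `v'` with `v_*'` and `cos²(θ/2)` with `sin²(θ/2)`. -/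
theorem gainIntegrand_flip (γ : ℝ) (k : ℝ → ENNReal) (g ψ : E d → ENNReal) (v z σ : E d) :
    gainIntegrand γ (fun q => k (1 - q)) g ψ v z (-σ) =
      ENNReal.ofReal (‖z‖ ^ γ) * k (cosSqHalf z σ) *
        (g (v - z + collisionMap σ z) * ψ (v - collisionMap σ z)) := by
  have h1 : v - (z - collisionMap σ z) = v - z + collisionMap σ z := by abel
  have h2 : v - z + (z - collisionMap σ z) = v - collisionMap σ z := by abel
  rw [gainIntegrand, cosSqHalf_neg, collisionMap_neg, sub_sub_cancel, h1, h2]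

theorem measurable_slice {α : Type*} [MeasurableSpace α] {F : E d × E d → α}
    (h : Measurable F) (y : E d) : Measurable fun σ : E d => F (y, σ) := by
  have h2 : Measurable fun σ : E d => (y, σ) := measurable_const.prodMk measurable_id
  exact h.comp h2

theorem lintegral_gainIntegrand_neg (γ : ℝ) {k : ℝ → ENNReal} (hk : Measurable k)
    {g ψ : E d → ENNReal} (hg : Measurable g) (hψ : Measurable ψ) (v z : E d) :
    ∫⁻ σ : Metric.sphere (0 : E d) 1, gainIntegrand γ k g ψ v z (-σ) ∂sphereMeasure d =
      ∫⁻ σ : Metric.sphere (0 : E d) 1, gainIntegrand γ k g ψ v z σ ∂sphereMeasure d := by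
  have h := measurable_gainIntegrand γ hk hg hψ v
  have h2 : Measurable fun σ : E d => gainIntegrand γ k g ψ v z σ :=
    measurable_slice h z
  exact lintegral_sphere_neg h2

/-- The gain integrand is bounded by four terms, according to whether `v_*'` or `v'` lie outside
of `S`, and, if both are in `S`, to the sign of `cos θ`. -/
theorem gain_split_le (γ : ℝ) (k : ℝ → ENNReal) {F ψ : E d → ENNReal} {N : ENNReal}
    (S : Set (E d)) (hF : ∀ u, F u ≤ N * ψ u) (v z σ : E d) :
    gainIntegrand γ k F F v z σ ≤
      N * (gainIntegrand γ k (Sᶜ.indicator F) ψ v z σ +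
        gainIntegrand γ (fun q => k (1 - q)) (Sᶜ.indicator F) ψ v z (-σ) +
        (gainIntegrand γ ((Set.Ici (1 / 2)).indicator k) (S.indicator F) (S.indicator ψ) v z σ +
        gainIntegrand γ (fun q => (Set.Iio (1 / 2)).indicator k (1 - q)) (S.indicator F)
          (S.indicator ψ) v z (-σ))) := by
  rw [gainIntegrand_flip, gainIntegrand_flip γ ((Set.Iio (1 / 2)).indicator k)]
  simp only [gainIntegrand]
  set a := v - collisionMap σ z
  set a' := v - z + collisionMap σ z
  set c := ENNReal.ofReal (‖z‖ ^ γ)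
  set q := cosSqHalf z σ
  have h1 : c * k q * (F a * F a') ≤ N * (c * k q * (F a * ψ a')) :=
    calc c * k q * (F a * F a') ≤ c * k q * (F a * (N * ψ a')) := by
          gcongr
          exact hF a'
      _ = _ := by ring
  have h2 : c * k q * (F a * F a') ≤ N * (c * k q * (F a' * ψ a)) :=
    calc c * k q * (F a * F a') ≤ c * k q * (N * ψ a * F a') := by
          gcongr
          exact hF a
      _ = _ := by ring
  by_cases ha : a ∈ S
  · by_cases ha' : a' ∈ S
    · by_cases hq : 1 / 2 ≤ q
      · refine h1.trans (mul_le_mul_right ?_ N)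
        rw [Set.indicator_of_mem (s := Set.Ici (1 / 2 : ℝ)) hq,
          Set.indicator_of_mem (s := S) ha, Set.indicator_of_mem (s := S) ha']
        exact le_add_left (le_add_right le_rfl)
      · refine h2.trans (mul_le_mul_right ?_ N)
        rw [Set.indicator_of_mem (s := Set.Iio (1 / 2 : ℝ)) (not_le.1 hq),
          Set.indicator_of_mem (s := S) (f := F) ha', Set.indicator_of_mem (s := S) (f := ψ) ha]
        exact le_add_left (le_add_left le_rfl)
    · refine h2.trans (mul_le_mul_right ?_ N)
      rw [Set.indicator_of_mem (s := Sᶜ) ha']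
      exact le_add_right le_add_self
  · refine h1.trans (mul_le_mul_right ?_ N)
    rw [Set.indicator_of_mem (s := Sᶜ) ha]
    exact le_add_right le_self_add

theorem lintegral_cosSqHalf_const {e y : E d} (he : e ≠ 0) (hy : y ≠ 0) {H : ℝ → ENNReal}
    (hH : Measurable H) :
    ∫⁻ σ : Metric.sphere (0 : E d) 1, H (cosSqHalf y σ) ∂sphereMeasure d =
      ∫⁻ σ : Metric.sphere (0 : E d) 1, H (cosSqHalf e σ) ∂sphereMeasure d :=
  lintegral_sphere_cosAng_eq hy he (φ := fun c => H ((1 + c) / 2)) (by fun_prop)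

theorem lintegral_cosSqHalf_flip (e : E d) {H : ℝ → ENNReal} (hH : Measurable H) :
    ∫⁻ σ : Metric.sphere (0 : E d) 1, H (1 - cosSqHalf e σ) ∂sphereMeasure d =
      ∫⁻ σ : Metric.sphere (0 : E d) 1, H (cosSqHalf e σ) ∂sphereMeasure d := by
  have h := measurable_cosSqHalf (d := d)
  have h2 : Measurable fun σ : E d => cosSqHalf e σ := measurable_slice h e
  rw [← lintegral_sphere_neg (F := fun σ => H (cosSqHalf e σ)) (hH.comp h2)]
  simp only [cosSqHalf_neg]

/-- Of the exponent `d + γ + 2` in `hnear`, the part `d + γ` is spent on the change of variables;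
the remaining `κ²` survives as the weight `cosSqHalf` in the angular integral. -/
theorem lintegral_gain_near_le (hd : 2 ≤ d) (γ : ℝ) {k : ℝ → ENNReal} (hk : Measurable k)
    {F : E d → ENNReal} (hF : Measurable F) {m δ : ℝ} {v e : E d} (he : e ≠ 0)
    (hnear : ∀ y σ : E d, ‖σ‖ = 1 → 0 < inner ℝ y σ → v - y ∉ farZone δ v →
      bracket (v + deviation σ y) ^ (-m) + bracket (v - deviation σ y) ^ (-m) ≤
        2 * (cosAng y σ ^ (d + γ + 2) * bracket v ^ (-m))) :
    ∫⁻ z : E d, ∫⁻ σ : Metric.sphere (0 : E d) 1,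
      gainIntegrand γ k ((farZone δ v)ᶜ.indicator F)
        (fun u => ENNReal.ofReal (bracket u ^ (-m))) v z σ ∂sphereMeasure d ≤
      ENNReal.ofReal (bracket v ^ (-m)) * ((∫⁻ σ : Metric.sphere (0 : E d) 1,
        k (cosSqHalf e σ) * ENNReal.ofReal (cosSqHalf e σ) ∂sphereMeasure d) *
        ∫⁻ y : E d, (farZone δ v)ᶜ.indicator F (v - y) * ENNReal.ofReal (‖y‖ ^ γ)) := by
  have hψ : Measurable fun u : E d => ENNReal.ofReal (bracket u ^ (-m)) :=
    (continuous_bracket_rpow (-m)).measurable.ennreal_ofReal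
  have hg : Measurable ((farZone δ v)ᶜ.indicator F) :=
    hF.indicator (measurableSet_farZone δ v).compl
  have hb := bracket_pos v
  have hW : 0 < bracket v ^ (-m) := Real.rpow_pos_of_pos hb _
  refine (lintegral_gain_le hd γ hk hg hψ v
    (M := fun q _ => ENNReal.ofReal (bracket v ^ (-m)) * ENNReal.ofReal q) (fun _ => by fun_prop)
    ?_).trans ?_
  · intro y σ hσ hy hgy _
    have hy' : v - y ∉ farZone δ v := fun h => hgy (Set.indicator_of_notMem (s := (farZone δ v)ᶜ)
      (fun h' => h' h) F)
    have hκ := cosAng_pos hy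
    have h := hnear y σ hσ hy hy'
    rw [← ENNReal.ofReal_add (Real.rpow_nonneg (bracket_pos _).le _)
      (Real.rpow_nonneg (bracket_pos _).le _)]
    refine (ENNReal.ofReal_le_ofReal h).trans (le_of_eq ?_)
    rw [Real.rpow_add hκ, ENNReal.ofReal_mul zero_le_two, ENNReal.ofReal_mul (by positivity),
      ENNReal.ofReal_mul (by positivity), ENNReal.ofReal_ofNat]
    norm_num
    ring
  · have hH : Measurable fun q => k q * (ENNReal.ofReal (bracket v ^ (-m)) * ENNReal.ofReal q) := by
      fun_prop
    have hH2 : Measurable fun q => k q * ENNReal.ofReal q := by fun_prop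
    have hconst := fun y (hy : y ≠ 0) => lintegral_cosSqHalf_const he hy hH
    have hH3 : Measurable fun σ : Metric.sphere (0 : E d) 1 =>
        k (cosSqHalf e σ) * ENNReal.ofReal (cosSqHalf e σ) :=
      hH2.comp (measurable_cosSqHalf_right e)
    have hpull : ∫⁻ σ : Metric.sphere (0 : E d) 1, k (cosSqHalf e σ) *
        (ENNReal.ofReal (bracket v ^ (-m)) * ENNReal.ofReal (cosSqHalf e σ)) ∂sphereMeasure d =
        ENNReal.ofReal (bracket v ^ (-m)) * ∫⁻ σ : Metric.sphere (0 : E d) 1,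
        k (cosSqHalf e σ) * ENNReal.ofReal (cosSqHalf e σ) ∂sphereMeasure d := by
      rw [← lintegral_const_mul _ hH3]
      refine lintegral_congr fun σ => ?_
      ring
    rw [← mul_assoc, ← hpull, ← lintegral_const_mul _ (by fun_prop)]
    refine (lintegral_congr_ae ?_).le
    filter_upwards [ae_ne_zero hd] with y hy
    rw [hconst y hy]
    ring

/-- The summand `1` in the pair bound gives the far-zone share of the loss term; the other summand
gives the remainder with finite angular integral. -/
theorem lintegral_gain_far_le (hd : 2 ≤ d) (γ : ℝ) {k : ℝ → ENNReal} (hk : Measurable k)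
    (hk0 : ∀ q, k q ≠ 0 → 1 / 2 ≤ q)
    {F : E d → ENNReal} (hF : Measurable F) {m δ C : ℝ} (hC : 0 ≤ C) {v e : E d} (he : e ≠ 0)
    (hfar : ∀ y σ : E d, ‖σ‖ = 1 → 0 < inner ℝ y σ → 1 / 2 ≤ cosAng y σ ^ 2 →
      farWeight m δ v (v + deviation σ y) + farWeight m δ v (v - deviation σ y) ≤
        2 * (cosAng y σ ^ (d + γ) * (bracket v ^ (-m) *
          (1 + C * (1 - cosAng y σ ^ 2) * (1 + ‖y‖ ^ 2 / bracket v ^ 2))))) :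
    ∫⁻ z : E d, ∫⁻ σ : Metric.sphere (0 : E d) 1,
      gainIntegrand γ k ((farZone δ v).indicator F)
        ((farZone δ v).indicator fun u => ENNReal.ofReal (bracket u ^ (-m))) v z σ
          ∂sphereMeasure d ≤
      ENNReal.ofReal (bracket v ^ (-m)) * ((∫⁻ σ : Metric.sphere (0 : E d) 1,
        k (cosSqHalf e σ) ∂sphereMeasure d) *
        (∫⁻ y : E d, (farZone δ v).indicator F (v - y) * ENNReal.ofReal (‖y‖ ^ γ)) +
        (∫⁻ σ : Metric.sphere (0 : E d) 1,
        k (cosSqHalf e σ) * ENNReal.ofReal (1 - cosSqHalf e σ) ∂sphereMeasure d) *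
        (ENNReal.ofReal C * ∫⁻ y : E d, (farZone δ v).indicator F (v - y) *
          ENNReal.ofReal (‖y‖ ^ γ * (1 + ‖y‖ ^ 2 / bracket v ^ 2)))) := by
  have hψ : Measurable fun u : E d => ENNReal.ofReal (bracket u ^ (-m)) :=
    (continuous_bracket_rpow (-m)).measurable.ennreal_ofReal
  have hS := measurableSet_farZone δ v
  have hg : Measurable ((farZone δ v).indicator F) := hF.indicator hS
  have hb := bracket_pos v
  have hW : 0 < bracket v ^ (-m) := Real.rpow_pos_of_pos hb _
  have hind : ∀ u, (farZone δ v).indicator (fun u => ENNReal.ofReal (bracket u ^ (-m))) u =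
      ENNReal.ofReal (farWeight m δ v u) := by
    intro u
    by_cases hu : u ∈ farZone δ v
    · rw [Set.indicator_of_mem hu, farWeight, Set.indicator_of_mem hu]
    · rw [Set.indicator_of_notMem hu, farWeight, Set.indicator_of_notMem hu, ENNReal.ofReal_zero]
  have hfw : ∀ u, 0 ≤ farWeight m δ v u := fun u =>
    Set.indicator_nonneg (fun u _ => Real.rpow_nonneg (bracket_pos u).le _) u
  refine (lintegral_gain_le hd γ hk hg (hψ.indicator hS) v
    (M := fun q y => ENNReal.ofReal (bracket v ^ (-m)) * (1 + ENNReal.ofReal C *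
      ENNReal.ofReal (1 - q) * ENNReal.ofReal (1 + ‖y‖ ^ 2 / bracket v ^ 2)))
      (fun _ => by fun_prop) ?_).trans ?_
  · intro y σ hσ hy _ hky
    have hκ := cosAng_pos hy
    have hκ1 : cosAng y σ ^ 2 ≤ 1 := pow_le_one₀ hκ.le (cosAng_le_one hσ y)
    have h := hfar y σ hσ hy (hk0 _ hky)
    have h1 : 0 ≤ 1 - cosAng y σ ^ 2 := by linarith
    rw [hind, hind, ← ENNReal.ofReal_add (hfw _) (hfw _)]
    refine (ENNReal.ofReal_le_ofReal h).trans (le_of_eq ?_)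
    rw [ENNReal.ofReal_mul zero_le_two, ENNReal.ofReal_mul (by positivity),
      ENNReal.ofReal_mul (by positivity), ENNReal.ofReal_add zero_le_one (by positivity),
      ENNReal.ofReal_mul (by positivity), ENNReal.ofReal_mul hC, ENNReal.ofReal_ofNat,
      ENNReal.ofReal_one]
  · have hH2 : Measurable fun q => k q * ENNReal.ofReal (1 - q) := by fun_prop
    have hm1 : Measurable fun σ : Metric.sphere (0 : E d) 1 => k (cosSqHalf e σ) :=
      hk.comp (measurable_cosSqHalf_right e)
    have hm2 : Measurable fun σ : Metric.sphere (0 : E d) 1 =>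
        k (cosSqHalf e σ) * ENNReal.ofReal (1 - cosSqHalf e σ) :=
      hH2.comp (measurable_cosSqHalf_right e)
    set I₁ := ∫⁻ σ : Metric.sphere (0 : E d) 1, k (cosSqHalf e σ) ∂sphereMeasure d
    set I₂ := ∫⁻ σ : Metric.sphere (0 : E d) 1,
      k (cosSqHalf e σ) * ENNReal.ofReal (1 - cosSqHalf e σ) ∂sphereMeasure d with hI₂
    have hinner : ∀ y : E d, y ≠ 0 → ∫⁻ σ : Metric.sphere (0 : E d) 1, k (cosSqHalf y σ) *
        (ENNReal.ofReal (bracket v ^ (-m)) * (1 + ENNReal.ofReal C *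
          ENNReal.ofReal (1 - cosSqHalf y σ) * ENNReal.ofReal (1 + ‖y‖ ^ 2 / bracket v ^ 2)))
          ∂sphereMeasure d = ENNReal.ofReal (bracket v ^ (-m)) * (I₁ + ENNReal.ofReal C *
          ENNReal.ofReal (1 + ‖y‖ ^ 2 / bracket v ^ 2) * I₂) := by
      intro y hy
      have hH : Measurable fun q => k q * (ENNReal.ofReal (bracket v ^ (-m)) *
          (1 + ENNReal.ofReal C * ENNReal.ofReal (1 - q) *
            ENNReal.ofReal (1 + ‖y‖ ^ 2 / bracket v ^ 2))) := by fun_prop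
      rw [lintegral_cosSqHalf_const he hy hH, hI₂, ← lintegral_const_mul _ hm2,
        ← lintegral_add_left hm1, ← lintegral_const_mul' _ _ ENNReal.ofReal_ne_top]
      refine lintegral_congr fun σ => ?_
      ring
    have hA : Measurable fun y : E d =>
        (farZone δ v).indicator F (v - y) * ENNReal.ofReal (‖y‖ ^ γ) := by fun_prop
    have hB : Measurable fun y : E d => (farZone δ v).indicator F (v - y) *
        ENNReal.ofReal (‖y‖ ^ γ * (1 + ‖y‖ ^ 2 / bracket v ^ 2)) := by fun_prop
    rw [← mul_assoc I₂, ← lintegral_const_mul _ hA, ← lintegral_const_mul _ hB,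
      ← lintegral_add_left (hA.const_mul _),
      ← lintegral_const_mul' _ _ ENNReal.ofReal_ne_top]
    refine (lintegral_congr_ae ?_).le
    filter_upwards [ae_ne_zero hd] with y hy
    rw [hinner y hy, ENNReal.ofReal_mul (Real.rpow_nonneg (norm_nonneg y) γ)]
    ring

/-- After the flip the second integral has weight `q` on `q < 1/2`, where `q ≤ 1 - q`. -/
theorem indicator_mul_ofReal_flip_le (e : E d) {k : ℝ → ENNReal} (hk : Measurable k) :
    (∫⁻ σ : Metric.sphere (0 : E d) 1, (Set.Ici (1 / 2)).indicator k (cosSqHalf e σ) *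
        ENNReal.ofReal (1 - cosSqHalf e σ) ∂sphereMeasure d) +
      (∫⁻ σ : Metric.sphere (0 : E d) 1, (Set.Iio (1 / 2)).indicator k (1 - cosSqHalf e σ) *
        ENNReal.ofReal (1 - cosSqHalf e σ) ∂sphereMeasure d) ≤
      ∫⁻ σ : Metric.sphere (0 : E d) 1, k (cosSqHalf e σ) * ENNReal.ofReal (1 - cosSqHalf e σ)
        ∂sphereMeasure d := by
  have hk1 : Measurable fun q => (Set.Ici (1 / 2 : ℝ)).indicator k q * ENNReal.ofReal (1 - q) :=
    (hk.indicator measurableSet_Ici).mul (by fun_prop)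
  have hk2 : Measurable fun q => (Set.Iio (1 / 2 : ℝ)).indicator k q * ENNReal.ofReal q :=
    (hk.indicator measurableSet_Iio).mul (by fun_prop)
  have hm1 : Measurable fun σ : Metric.sphere (0 : E d) 1 =>
      (Set.Ici (1 / 2 : ℝ)).indicator k (cosSqHalf e σ) * ENNReal.ofReal (1 - cosSqHalf e σ) :=
    hk1.comp (measurable_cosSqHalf_right e)
  rw [lintegral_cosSqHalf_flip e hk2, ← lintegral_add_left hm1]
  refine lintegral_mono fun σ => ?_
  by_cases hq : 1 / 2 ≤ cosSqHalf e σ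
  · rw [Set.indicator_of_mem (s := Set.Ici (1 / 2 : ℝ)) hq,
      Set.indicator_of_notMem (s := Set.Iio (1 / 2 : ℝ)) (not_lt.2 hq), zero_mul, add_zero]
  · rw [Set.indicator_of_notMem (s := Set.Ici (1 / 2 : ℝ)) hq,
      Set.indicator_of_mem (s := Set.Iio (1 / 2 : ℝ)) (not_le.1 hq), zero_mul, zero_add]
    gcongr
    linarith [not_le.1 hq]

theorem lintegral_indicator_flip (e : E d) {k : ℝ → ENNReal} (hk : Measurable k) :
    (∫⁻ σ : Metric.sphere (0 : E d) 1, (Set.Ici (1 / 2)).indicator k (cosSqHalf e σ)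
        ∂sphereMeasure d) +
      (∫⁻ σ : Metric.sphere (0 : E d) 1, (Set.Iio (1 / 2)).indicator k (1 - cosSqHalf e σ)
        ∂sphereMeasure d) =
      ∫⁻ σ : Metric.sphere (0 : E d) 1, k (cosSqHalf e σ) ∂sphereMeasure d := by
  have hk1 : Measurable ((Set.Ici (1 / 2 : ℝ)).indicator k) := hk.indicator measurableSet_Ici
  have hk2 : Measurable ((Set.Iio (1 / 2 : ℝ)).indicator k) := hk.indicator measurableSet_Iio
  have hm1 : Measurable fun σ : Metric.sphere (0 : E d) 1 =>
      (Set.Ici (1 / 2 : ℝ)).indicator k (cosSqHalf e σ) :=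
    hk1.comp (measurable_cosSqHalf_right e)
  rw [lintegral_cosSqHalf_flip e hk2, ← lintegral_add_left hm1]
  refine lintegral_congr fun σ => ?_
  by_cases hq : 1 / 2 ≤ cosSqHalf e σ
  · rw [Set.indicator_of_mem (s := Set.Ici (1 / 2 : ℝ)) hq,
      Set.indicator_of_notMem (s := Set.Iio (1 / 2 : ℝ)) (not_lt.2 hq), add_zero]
  · rw [Set.indicator_of_notMem (s := Set.Ici (1 / 2 : ℝ)) hq,
      Set.indicator_of_mem (s := Set.Iio (1 / 2 : ℝ)) (not_le.1 hq), zero_add]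

/-- Since `cos² + sin² = 1`, the two near contributions together carry exactly the angular mass of
the loss term, with no constant lost. -/
theorem lintegral_mul_ofReal_flip (e : E d) {k : ℝ → ENNReal} (hk : Measurable k) :
    (∫⁻ σ : Metric.sphere (0 : E d) 1, k (cosSqHalf e σ) * ENNReal.ofReal (cosSqHalf e σ)
        ∂sphereMeasure d) +
      (∫⁻ σ : Metric.sphere (0 : E d) 1, k (1 - cosSqHalf e σ) * ENNReal.ofReal (cosSqHalf e σ)
        ∂sphereMeasure d) =
      ∫⁻ σ : Metric.sphere (0 : E d) 1, k (cosSqHalf e σ) ∂sphereMeasure d := by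
  have hk1 : Measurable fun q => k q * ENNReal.ofReal q := by fun_prop
  have hk2 : Measurable fun q => k (1 - q) * ENNReal.ofReal q := by fun_prop
  have hm1 : Measurable fun σ : Metric.sphere (0 : E d) 1 =>
      k (cosSqHalf e σ) * ENNReal.ofReal (cosSqHalf e σ) :=
    hk1.comp (measurable_cosSqHalf_right e)
  rw [← lintegral_cosSqHalf_flip e hk2, ← lintegral_add_left hm1]
  refine lintegral_congr fun σ => ?_
  have hσ : ‖(σ : E d)‖ = 1 := by simp
  rw [sub_sub_cancel, ← mul_add, ← ENNReal.ofReal_add (cosSqHalf_nonneg hσ e)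
    (sub_nonneg.2 (cosSqHalf_le_one hσ e)), add_sub_cancel, ENNReal.ofReal_one, mul_one]

end GainSplitting

/-! ### The gain term bounded by the loss term plus a remainder. -/

section TotalGain

variable {d : ℕ}

theorem lintegral_sphere_add {F G : E d → E d → ENNReal}
    (hF : Measurable fun p : E d × E d => F p.1 p.2) :
    ∫⁻ z : E d, ∫⁻ σ : Metric.sphere (0 : E d) 1, F z σ + G z σ ∂sphereMeasure d =
      (∫⁻ z : E d, ∫⁻ σ : Metric.sphere (0 : E d) 1, F z σ ∂sphereMeasure d) +
        ∫⁻ z : E d, ∫⁻ σ : Metric.sphere (0 : E d) 1, G z σ ∂sphereMeasure d := by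
  have h1 : Measurable fun p : E d × Metric.sphere (0 : E d) 1 => F p.1 (p.2 : E d) :=
    measurable_restrict_prod hF
  have h2 : Measurable fun z : E d => ∫⁻ σ : Metric.sphere (0 : E d) 1, F z σ ∂sphereMeasure d :=
    h1.lintegral_prod_right'
  rw [← lintegral_add_left h2]
  refine lintegral_congr fun z => ?_
  have h3 : Measurable fun σ : Metric.sphere (0 : E d) 1 => F z (σ : E d) :=
    measurable_restrict_right hF z
  exact lintegral_add_left h3 _

theorem measurable_gainIntegrand_neg (γ : ℝ) {k : ℝ → ENNReal} (hk : Measurable k)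
    {g ψ : E d → ENNReal} (hg : Measurable g) (hψ : Measurable ψ) (v : E d) :
    Measurable fun p : E d × E d => gainIntegrand γ k g ψ v p.1 (-p.2) := by
  have h := measurable_gainIntegrand γ hk hg hψ v
  have h2 : Measurable fun p : E d × E d => (p.1, -p.2) := measurable_fst.prodMk measurable_snd.neg
  exact h.comp h2

theorem lintegral_gain_split_le (γ : ℝ) {k : ℝ → ENNReal} (hk : Measurable k)
    {F ψ : E d → ENNReal} (hFm : Measurable F) (hψ : Measurable ψ) {N : ENNReal} (hN : N ≠ ⊤)
    {S : Set (E d)} (hS : MeasurableSet S) (hF : ∀ u, F u ≤ N * ψ u) (v : E d) :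
    ∫⁻ z : E d, ∫⁻ σ : Metric.sphere (0 : E d) 1, gainIntegrand γ k F F v z σ ∂sphereMeasure d ≤
      N * ((∫⁻ z : E d, ∫⁻ σ : Metric.sphere (0 : E d) 1,
          gainIntegrand γ k (Sᶜ.indicator F) ψ v z σ ∂sphereMeasure d) +
        (∫⁻ z : E d, ∫⁻ σ : Metric.sphere (0 : E d) 1,
          gainIntegrand γ (fun q => k (1 - q)) (Sᶜ.indicator F) ψ v z σ ∂sphereMeasure d) +
        ((∫⁻ z : E d, ∫⁻ σ : Metric.sphere (0 : E d) 1,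
          gainIntegrand γ ((Set.Ici (1 / 2)).indicator k) (S.indicator F) (S.indicator ψ) v z σ
            ∂sphereMeasure d) +
        ∫⁻ z : E d, ∫⁻ σ : Metric.sphere (0 : E d) 1,
          gainIntegrand γ (fun q => (Set.Iio (1 / 2)).indicator k (1 - q)) (S.indicator F)
          (S.indicator ψ) v z σ ∂sphereMeasure d)) := by
  have hg1 := hFm.indicator hS.compl
  have hg2 := hFm.indicator hS
  have hψ2 := hψ.indicator hS
  have hk2 : Measurable fun q => k (1 - q) := by fun_prop
  have hk3 : Measurable ((Set.Ici (1 / 2 : ℝ)).indicator k) := hk.indicator measurableSet_Ici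
  have hk4' : Measurable ((Set.Iio (1 / 2 : ℝ)).indicator k) := hk.indicator measurableSet_Iio
  have hk4 : Measurable fun q => (Set.Iio (1 / 2 : ℝ)).indicator k (1 - q) := by fun_prop
  have m1 := measurable_gainIntegrand γ hk hg1 hψ v
  have m2 := measurable_gainIntegrand_neg γ hk2 hg1 hψ v
  have m3 := measurable_gainIntegrand γ hk3 hg2 hψ2 v
  have e2 := fun z => lintegral_gainIntegrand_neg γ hk2 hg1 hψ v z
  have e4 := fun z => lintegral_gainIntegrand_neg γ hk4 hg2 hψ2 v z
  have h := lintegral_mono (μ := (volume : Measure (E d))) fun z => lintegral_mono (μ := sphereMeasure d)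
    fun σ : Metric.sphere (0 : E d) 1 => gain_split_le γ k S hF v z (σ : E d)
  refine h.trans (le_of_eq ?_)
  simp only [lintegral_const_mul' _ _ hN]
  congr 1
  have s1 := lintegral_sphere_add (G := fun z σ =>
    gainIntegrand γ (fun q => k (1 - q)) (Sᶜ.indicator F) ψ v z (-σ)) m1
  have s2 := lintegral_sphere_add (G := fun z σ =>
    gainIntegrand γ (fun q => (Set.Iio (1 / 2 : ℝ)).indicator k (1 - q)) (S.indicator F)
      (S.indicator ψ) v z (-σ)) m3
  simp only [e2] at s1
  simp only [e4] at s2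
  have s := lintegral_sphere_add (F := fun z σ =>
      gainIntegrand γ k (Sᶜ.indicator F) ψ v z σ +
        gainIntegrand γ (fun q => k (1 - q)) (Sᶜ.indicator F) ψ v z (-σ))
    (G := fun z σ =>
      gainIntegrand γ ((Set.Ici (1 / 2)).indicator k) (S.indicator F) (S.indicator ψ) v z σ +
        gainIntegrand γ (fun q => (Set.Iio (1 / 2)).indicator k (1 - q)) (S.indicator F)
          (S.indicator ψ) v z (-σ)) (m1.add m2)
  rw [s, s1, s2]

/-- The angular mass of the kernel, which can blow up as the truncation is removed, multiplies
exactly the full convolution in the loss term and will cancel against it. The remainder involves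
only the kernel times `sin²(θ/2)`, and only far velocities. -/
theorem lintegral_gain_total_le (hd : 2 ≤ d) (γ : ℝ) {k : ℝ → ENNReal} (hk : Measurable k)
    {F : E d → ENNReal} (hF : Measurable F) {N : ENNReal} (hN : N ≠ ⊤) {m δ C : ℝ} (hC : 0 ≤ C)
    {v e : E d} (he : e ≠ 0) (hFN : ∀ u, F u ≤ N * ENNReal.ofReal (bracket u ^ (-m)))
    (hnear : ∀ y σ : E d, ‖σ‖ = 1 → 0 < inner ℝ y σ → v - y ∉ farZone δ v →
      bracket (v + deviation σ y) ^ (-m) + bracket (v - deviation σ y) ^ (-m) ≤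
        2 * (cosAng y σ ^ (d + γ + 2) * bracket v ^ (-m)))
    (hfar : ∀ y σ : E d, ‖σ‖ = 1 → 0 < inner ℝ y σ → 1 / 2 ≤ cosAng y σ ^ 2 →
      farWeight m δ v (v + deviation σ y) + farWeight m δ v (v - deviation σ y) ≤
        2 * (cosAng y σ ^ (d + γ) * (bracket v ^ (-m) *
          (1 + C * (1 - cosAng y σ ^ 2) * (1 + ‖y‖ ^ 2 / bracket v ^ 2))))) :
    ∫⁻ z : E d, ∫⁻ σ : Metric.sphere (0 : E d) 1, gainIntegrand γ k F F v z σ ∂sphereMeasure d ≤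
      N * (ENNReal.ofReal (bracket v ^ (-m)) * ((∫⁻ σ : Metric.sphere (0 : E d) 1,
        k (cosSqHalf e σ) ∂sphereMeasure d) *
        (∫⁻ y : E d, F (v - y) * ENNReal.ofReal (‖y‖ ^ γ)) +
        (∫⁻ σ : Metric.sphere (0 : E d) 1,
        k (cosSqHalf e σ) * ENNReal.ofReal (1 - cosSqHalf e σ) ∂sphereMeasure d) *
        (ENNReal.ofReal C * ∫⁻ y : E d, (farZone δ v).indicator F (v - y) *
          ENNReal.ofReal (‖y‖ ^ γ * (1 + ‖y‖ ^ 2 / bracket v ^ 2))))) := by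
  have hψ : Measurable fun u : E d => ENNReal.ofReal (bracket u ^ (-m)) :=
    (continuous_bracket_rpow (-m)).measurable.ennreal_ofReal
  have hS := measurableSet_farZone δ v
  have hk2 : Measurable fun q => k (1 - q) := by fun_prop
  have hk3 : Measurable ((Set.Ici (1 / 2 : ℝ)).indicator k) := hk.indicator measurableSet_Ici
  have hk4' : Measurable ((Set.Iio (1 / 2 : ℝ)).indicator k) := hk.indicator measurableSet_Iio
  have hk4 : Measurable fun q => (Set.Iio (1 / 2 : ℝ)).indicator k (1 - q) := by fun_prop
  refine (lintegral_gain_split_le γ hk hF hψ hN hS hFN v).trans (mul_le_mul_right ?_ N)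
  have n1 := lintegral_gain_near_le hd γ hk hF he hnear
  have n2 := lintegral_gain_near_le hd γ hk2 hF he hnear
  have f1 := lintegral_gain_far_le hd γ hk3 (fun q hq => by
    by_contra h
    exact hq (Set.indicator_of_notMem (s := Set.Ici (1 / 2 : ℝ)) h k)) hF hC he hfar
  have f2 := lintegral_gain_far_le hd γ hk4 (fun q hq => by
    by_contra! h
    refine hq (Set.indicator_of_notMem (s := Set.Iio (1 / 2 : ℝ)) 
      (show ¬ 1 - q < 1 / 2 by linarith) k)) hF hC he hfar
  refine (add_le_add (add_le_add n1 n2) (add_le_add f1 f2)).trans ?_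
  have c1 := lintegral_mul_ofReal_flip e hk
  have c2 := lintegral_indicator_flip e hk
  have c3 := indicator_mul_ofReal_flip_le e hk
  have hF' : ∫⁻ y : E d, F (v - y) * ENNReal.ofReal (‖y‖ ^ γ) =
      (∫⁻ y : E d, (farZone δ v)ᶜ.indicator F (v - y) * ENNReal.ofReal (‖y‖ ^ γ)) +
      ∫⁻ y : E d, (farZone δ v).indicator F (v - y) * ENNReal.ofReal (‖y‖ ^ γ) := by
    have hg := hF.indicator hS.compl
    rw [← lintegral_add_left (by fun_prop)]
    refine lintegral_congr fun y => ?_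
    rw [← add_mul, Set.indicator_compl_add_self_apply]
  rw [hF']
  set Λ := ∫⁻ σ : Metric.sphere (0 : E d) 1, k (cosSqHalf e σ) ∂sphereMeasure d
  set P := ∫⁻ y : E d, (farZone δ v)ᶜ.indicator F (v - y) * ENNReal.ofReal (‖y‖ ^ γ)
  set R := ∫⁻ y : E d, (farZone δ v).indicator F (v - y) * ENNReal.ofReal (‖y‖ ^ γ)
  set T := ENNReal.ofReal C * ∫⁻ y : E d, (farZone δ v).indicator F (v - y) *
          ENNReal.ofReal (‖y‖ ^ γ * (1 + ‖y‖ ^ 2 / bracket v ^ 2))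
  rw [← mul_add, ← mul_add, ← mul_add]
  refine mul_le_mul_right ?_ _
  rw [← add_mul, c1, mul_add Λ, add_assoc (Λ * P)]
  refine add_le_add le_rfl ?_
  rw [add_add_add_comm, ← add_mul, ← add_mul, c2]
  gcongr

end TotalGain

/-! ### Kernels without grazing angles, and the passage from nonnegative to signed integrals. -/

section TruncatedOperator

variable {d : ℕ}

theorem sinHalf_eq {σ : E d} (hσ : ‖σ‖ = 1) (z : E d) : sinHalf z σ = √(1 - cosSqHalf z σ) := by
  rw [sinHalf, Real.sin_half_eq_sqrt (InnerProductGeometry.angle_nonneg _ _)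
    (by linarith [InnerProductGeometry.angle_le_pi z σ, Real.pi_pos]),
    InnerProductGeometry.cos_angle, hσ, mul_one, cosSqHalf]
  ring_nf

theorem vPrime_eq (v vs σ : E d) : vPrime v vs σ = v - (v - vs) + collisionMap σ (v - vs) := by
  rw [vPrime, collisionMap]
  module

theorem vsPrime_eq (v vs σ : E d) : vsPrime v vs σ = v - collisionMap σ (v - vs) := by
  rw [vsPrime, collisionMap]
  module

/-- The angular function with grazing angles removed, as a function of `cos(θ/2)^2`. -/
def truncatedKernel (b : ℝ → ℝ) (ε q : ℝ) : ENNReal :=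
  {q : ℝ | ε < √(1 - q)}.indicator (fun q => ENNReal.ofReal (b (√(1 - q)))) q

theorem measurable_truncatedKernel {b : ℝ → ℝ} (hb : Measurable b) (ε : ℝ) :
    Measurable (truncatedKernel b ε) := by
  have h : Measurable fun q : ℝ => √(1 - q) := by fun_prop
  have h2 : Measurable fun q : ℝ => ENNReal.ofReal (b (√(1 - q))) := (hb.comp h).ennreal_ofReal
  exact h2.indicator (measurableSet_lt measurable_const h)

theorem truncatedKernel_mul_le (b : ℝ → ℝ) (ε : ℝ)
    (e : E d) {σ : E d} (hσ : ‖σ‖ = 1) :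
    truncatedKernel b ε (cosSqHalf e σ) * ENNReal.ofReal (1 - cosSqHalf e σ) ≤
      ENNReal.ofReal (sinHalf e σ ^ 2 * b (sinHalf e σ)) := by
  have h1 := cosSqHalf_le_one hσ e
  rw [sinHalf_eq hσ, Real.sq_sqrt (by linarith), ENNReal.ofReal_mul (by linarith), mul_comm]
  gcongr
  exact Set.indicator_le_self _ _ _

/-- Gives finite angular mass for each fixed `ε`, so that gain and loss can be subtracted; the size
of this bound does not enter the final constant. -/
theorem truncatedKernel_le {b : ℝ → ℝ} (hb : ∀ s ∈ Set.Icc (0 : ℝ) 1, 0 ≤ b s) {ε : ℝ}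
    (hε : 0 < ε) (e : E d) {σ : E d} (hσ : ‖σ‖ = 1) :
    truncatedKernel b ε (cosSqHalf e σ) ≤
      ENNReal.ofReal ((ε ^ 2)⁻¹) * ENNReal.ofReal (sinHalf e σ ^ 2 * b (sinHalf e σ)) := by
  have h1 := cosSqHalf_le_one hσ e
  have h0 := cosSqHalf_nonneg hσ e
  rw [← ENNReal.ofReal_mul (by positivity), sinHalf_eq hσ]
  by_cases h : ε < √(1 - cosSqHalf e σ)
  · rw [truncatedKernel, Set.indicator_of_mem (by exact h)]
    refine ENNReal.ofReal_le_ofReal ?_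
    have hbn := hb (√(1 - cosSqHalf e σ)) ⟨Real.sqrt_nonneg _, Real.sqrt_le_one.2 (by linarith)⟩
    rw [← mul_assoc]
    refine le_mul_of_one_le_left hbn ?_
    rw [inv_mul_eq_div, one_le_div (by positivity)]
    gcongr
  · rw [truncatedKernel, Set.indicator_of_notMem (by exact h)]
    exact zero_le

/-- Finiteness of the loss makes the gain integrable through the hypothesis itself, after which
Fubini permits subtracting the two. -/
theorem integral_sub_le_of_lintegral_le {α β : Type*} [MeasurableSpace α] [MeasurableSpace β]
    {μ : Measure α} {ν : Measure β} [SFinite μ] [SFinite ν] {G L : α → β → ℝ}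
    (hG : Measurable fun p : α × β => G p.1 p.2) (hL : Measurable fun p : α × β => L p.1 p.2)
    (hG0 : ∀ x y, 0 ≤ G x y) (hL0 : ∀ x y, 0 ≤ L x y) {B : ℝ} (hB : 0 ≤ B)
    (hLfin : ∫⁻ x, ∫⁻ y, ENNReal.ofReal (L x y) ∂ν ∂μ ≠ ⊤)
    (h : ∫⁻ x, ∫⁻ y, ENNReal.ofReal (G x y) ∂ν ∂μ ≤
      (∫⁻ x, ∫⁻ y, ENNReal.ofReal (L x y) ∂ν ∂μ) + ENNReal.ofReal B) :
    ∫ x, ∫ y, (G x y - L x y) ∂ν ∂μ ≤ B := by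
  have eG : ∫⁻ p, ENNReal.ofReal (G p.1 p.2) ∂μ.prod ν = ∫⁻ x, ∫⁻ y, ENNReal.ofReal (G x y) ∂ν ∂μ :=
    lintegral_prod _ hG.ennreal_ofReal.aemeasurable
  have eL : ∫⁻ p, ENNReal.ofReal (L p.1 p.2) ∂μ.prod ν = ∫⁻ x, ∫⁻ y, ENNReal.ofReal (L x y) ∂ν ∂μ :=
    lintegral_prod _ hL.ennreal_ofReal.aemeasurable
  rw [← eL] at hLfin
  rw [← eG, ← eL] at h
  have hfinsum := ENNReal.add_ne_top.2 ⟨hLfin, ENNReal.ofReal_ne_top (r := B)⟩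
  have iG : Integrable (fun p : α × β => G p.1 p.2) (μ.prod ν) :=
    (lintegral_ofReal_ne_top_iff_integrable hG.aestronglyMeasurable
      (Eventually.of_forall fun p => hG0 p.1 p.2)).1 (ne_top_of_le_ne_top hfinsum h)
  have iL : Integrable (fun p : α × β => L p.1 p.2) (μ.prod ν) :=
    (lintegral_ofReal_ne_top_iff_integrable hL.aestronglyMeasurable
      (Eventually.of_forall fun p => hL0 p.1 p.2)).1 hLfin
  have hsub := integral_prod _ (iG.sub iL)
  have hsub' : ∫ p, (G p.1 p.2 - L p.1 p.2) ∂μ.prod ν = ∫ x, ∫ y, (G x y - L x y) ∂ν ∂μ := hsub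
  rw [← hsub', integral_sub iG iL,
    integral_eq_lintegral_of_nonneg_ae (f := fun p : α × β => G p.1 p.2)
      (Eventually.of_forall fun p => hG0 p.1 p.2) hG.aestronglyMeasurable,
    integral_eq_lintegral_of_nonneg_ae (f := fun p : α × β => L p.1 p.2)
      (Eventually.of_forall fun p => hL0 p.1 p.2) hL.aestronglyMeasurable]
  have := ENNReal.toReal_mono hfinsum h
  rw [ENNReal.toReal_add hLfin ENNReal.ofReal_ne_top, ENNReal.toReal_ofReal hB] at this
  linarith

/-- The far-zone bound with the exponents `γ` and `γ + 2`; the second is where `d + γ + 2 < m` is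
needed, and the division by `bracket v ^ 2` restores the same power of `bracket v`. -/
theorem exists_lintegral_far_le (hd : 2 ≤ d) {γ m δ : ℝ} (hγ : -(d : ℝ) < γ) (hm : d + γ + 2 < m)
    (hδ : 0 < δ) :
    ∃ C : ℝ, 0 < C ∧ ∀ (v : E d) (N : ℝ) (f : E d → ℝ), 0 ≤ N →
      (∀ u, f u ≤ N * bracket u ^ (-m)) →
      ∫⁻ y : E d, (farZone δ v).indicator (fun u => ENNReal.ofReal (f u)) (v - y) *
        ENNReal.ofReal (‖y‖ ^ γ * (1 + ‖y‖ ^ 2 / bracket v ^ 2)) ≤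
      ENNReal.ofReal (N * C * bracket v ^ (d + γ - m)) := by
  obtain ⟨C₁, hC₁, h₁⟩ := exists_integral_farZone_le (d := d) (m := m) (by omega) hγ (by linarith) hδ
  obtain ⟨C₂, hC₂, h₂⟩ := exists_integral_farZone_le (d := d) (p := γ + 2) (m := m) (by omega)
    (by linarith) (by linarith) hδ
  refine ⟨C₁ + C₂, by positivity, fun v N f hN hf => ?_⟩
  have hb := bracket_pos v
  obtain ⟨i₁, e₁⟩ := h₁ v
  obtain ⟨i₂, e₂⟩ := h₂ v
  have hsub := lintegral_sub_left_eq_self (μ := (volume : Measure (E d)))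
    (fun w => (farZone δ v).indicator (fun u => ENNReal.ofReal (f u)) w *
      ENNReal.ofReal (‖v - w‖ ^ γ * (1 + ‖v - w‖ ^ 2 / bracket v ^ 2))) v
  simp only [sub_sub_cancel] at hsub
  rw [hsub]
  have hS := measurableSet_farZone δ v
  set Φ : E d → ℝ := fun w => N * (‖v - w‖ ^ γ * bracket w ^ (-m) +
    (bracket v ^ 2)⁻¹ * (‖v - w‖ ^ (γ + 2) * bracket w ^ (-m))) with hΦ
  have iΦ : IntegrableOn Φ (farZone δ v) := (i₁.add (i₂.const_mul _)).const_mul N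
  have hΦ0 : ∀ w, 0 ≤ Φ w := fun w => by
    have := bracket_pos w
    simp only [hΦ]
    positivity
  calc _ ≤ ∫⁻ w, (farZone δ v).indicator (fun w => ENNReal.ofReal (Φ w)) w := by
        refine lintegral_mono fun w => ?_
        by_cases hw : w ∈ farZone δ v
        · simp only [Set.indicator_of_mem hw]
          have hbw := bracket_pos w
          have hpow : ‖v - w‖ ^ γ * ‖v - w‖ ^ 2 ≤ ‖v - w‖ ^ (γ + 2) := by
            rcases (norm_nonneg (v - w)).eq_or_lt with h0 | h0
            · rw [← h0]
              norm_num
              positivity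
            · rw [Real.rpow_add h0, Real.rpow_two]
          rw [← ENNReal.ofReal_mul' (by positivity)]
          refine ENNReal.ofReal_le_ofReal ?_
          calc f w * (‖v - w‖ ^ γ * (1 + ‖v - w‖ ^ 2 / bracket v ^ 2))
              ≤ N * bracket w ^ (-m) * (‖v - w‖ ^ γ * (1 + ‖v - w‖ ^ 2 / bracket v ^ 2)) := by
                gcongr
                exact hf w
            _ = N * (‖v - w‖ ^ γ * bracket w ^ (-m) +
                (bracket v ^ 2)⁻¹ * (‖v - w‖ ^ γ * ‖v - w‖ ^ 2 * bracket w ^ (-m))) := by ring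
            _ ≤ Φ w := by
                simp only [hΦ]
                gcongr
        · simp only [Set.indicator_of_notMem hw, zero_mul, le_refl]
    _ = ENNReal.ofReal (∫ w in farZone δ v, Φ w) := by
        rw [lintegral_indicator hS, ofReal_integral_eq_lintegral_ofReal iΦ
          (Eventually.of_forall hΦ0)]
    _ ≤ _ := by
        refine ENNReal.ofReal_le_ofReal ?_
        have e : ∫ w in farZone δ v, Φ w = N * ((∫ w in farZone δ v, ‖v - w‖ ^ γ * bracket w ^ (-m)) +
            (bracket v ^ 2)⁻¹ * ∫ w in farZone δ v, ‖v - w‖ ^ (γ + 2) * bracket w ^ (-m)) := by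
          simp only [hΦ]
          rw [integral_const_mul, integral_add i₁ (i₂.const_mul _), integral_const_mul]
        have hp : (bracket v ^ 2)⁻¹ * bracket v ^ (d + (γ + 2) - m) = bracket v ^ (d + γ - m) := by
          rw [← Real.rpow_natCast, ← Real.rpow_neg hb.le, ← Real.rpow_add hb]
          congr 1
          push_cast
          ring
        rw [e, mul_assoc]
        refine mul_le_mul_of_nonneg_left ?_ hN
        calc _ ≤ C₁ * bracket v ^ (d + γ - m) +
              (bracket v ^ 2)⁻¹ * (C₂ * bracket v ^ (d + (γ + 2) - m)) := by gcongr
          _ = C₁ * bracket v ^ (d + γ - m) +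
              C₂ * ((bracket v ^ 2)⁻¹ * bracket v ^ (d + (γ + 2) - m)) := by ring
          _ = _ := by
              rw [hp]
              ring

end TruncatedOperator

/-! ### The touching estimate for the Boltzmann operator. -/

section BoltzmannEstimate

variable {d : ℕ}

theorem ofReal_boltzmannGain {γ : ℝ} {b : ℝ → ℝ} (hb : ∀ s ∈ Set.Icc (0 : ℝ) 1, 0 ≤ b s)
    {f : E d → ℝ} (hf : ∀ u, 0 ≤ f u) (ε : ℝ) (v vs : E d) {σ : E d} (hσ : ‖σ‖ = 1) :
    ENNReal.ofReal (if ε < sinHalf (v - vs) σ then collisionKernel γ b (v - vs) σ *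
      (f (vPrime v vs σ) * f (vsPrime v vs σ)) else 0) =
      gainIntegrand γ (truncatedKernel b ε) (fun u => ENNReal.ofReal (f u))
        (fun u => ENNReal.ofReal (f u)) v (v - vs) σ := by
  have h0 := cosSqHalf_nonneg hσ (v - vs)
  have hbn := hb (√(1 - cosSqHalf (v - vs) σ))
    ⟨Real.sqrt_nonneg _, Real.sqrt_le_one.2 (by linarith)⟩
  rw [sinHalf_eq hσ, collisionKernel, sinHalf_eq hσ, vPrime_eq, vsPrime_eq, gainIntegrand,
    truncatedKernel]
  split_ifs with h
  · rw [Set.indicator_of_mem (by exact h), mul_comm (f _) (f _), ENNReal.ofReal_mul (by positivity),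
      ENNReal.ofReal_mul (by positivity), ENNReal.ofReal_mul (hf _)]
  · rw [Set.indicator_of_notMem (by exact h), mul_zero, zero_mul, ENNReal.ofReal_zero]

theorem ofReal_boltzmannLoss {γ : ℝ} {b : ℝ → ℝ} (hb : ∀ s ∈ Set.Icc (0 : ℝ) 1, 0 ≤ b s)
    {f : E d → ℝ} (hf : ∀ u, 0 ≤ f u) (ε : ℝ) (v vs : E d) {σ : E d} (hσ : ‖σ‖ = 1) :
    ENNReal.ofReal (if ε < sinHalf (v - vs) σ then collisionKernel γ b (v - vs) σ *
      (f v * f vs) else 0) =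
      ENNReal.ofReal (f v) * (ENNReal.ofReal (f vs) * ENNReal.ofReal (‖v - vs‖ ^ γ)) *
        truncatedKernel b ε (cosSqHalf (v - vs) σ) := by
  have h0 := cosSqHalf_nonneg hσ (v - vs)
  have hbn := hb (√(1 - cosSqHalf (v - vs) σ))
    ⟨Real.sqrt_nonneg _, Real.sqrt_le_one.2 (by linarith)⟩
  rw [sinHalf_eq hσ, collisionKernel, sinHalf_eq hσ, truncatedKernel]
  split_ifs with h
  · rw [Set.indicator_of_mem (by exact h), ENNReal.ofReal_mul (by positivity),
      ENNReal.ofReal_mul (by positivity), ENNReal.ofReal_mul (hf _)]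
    ring
  · rw [Set.indicator_of_notMem (by exact h), mul_zero, ENNReal.ofReal_zero]

theorem lintegral_boltzmannLoss (hd : 2 ≤ d) (γ : ℝ) {k : ℝ → ENNReal} (hk : Measurable k)
    {f : E d → ℝ} (v : E d) {e : E d} (he : e ≠ 0)
    (hΛ : ∫⁻ σ : Metric.sphere (0 : E d) 1, k (cosSqHalf e σ) ∂sphereMeasure d ≠ ⊤) :
    ∫⁻ vs : E d, ∫⁻ σ : Metric.sphere (0 : E d) 1,
      ENNReal.ofReal (f v) * (ENNReal.ofReal (f vs) * ENNReal.ofReal (‖v - vs‖ ^ γ)) *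
        k (cosSqHalf (v - vs) σ) ∂sphereMeasure d =
      ENNReal.ofReal (f v) * ((∫⁻ σ : Metric.sphere (0 : E d) 1, k (cosSqHalf e σ)
        ∂sphereMeasure d) *
        ∫⁻ y : E d, ENNReal.ofReal (f (v - y)) * ENNReal.ofReal (‖y‖ ^ γ)) := by
  have hsub := lintegral_sub_left_eq_self (μ := (volume : Measure (E d)))
    (fun vs => ∫⁻ σ : Metric.sphere (0 : E d) 1,
      ENNReal.ofReal (f v) * (ENNReal.ofReal (f vs) * ENNReal.ofReal (‖v - vs‖ ^ γ)) *
        k (cosSqHalf (v - vs) σ) ∂sphereMeasure d) v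
  simp only [sub_sub_cancel] at hsub
  rw [← hsub, ← lintegral_const_mul' _ _ hΛ, ← lintegral_const_mul' _ _ ENNReal.ofReal_ne_top]
  refine lintegral_congr_ae ?_
  filter_upwards [ae_ne_zero hd] with y hy
  rw [lintegral_const_mul' _ _ (by finiteness), lintegral_cosSqHalf_const he hy hk]
  ring

theorem measurable_sub_left_fst {α : Type*} [MeasurableSpace α] {F : E d × E d → α}
    (h : Measurable F) (v : E d) : Measurable fun p : E d × E d => F (v - p.1, p.2) := by
  have h2 : Measurable fun p : E d × E d => (v - p.1, p.2) :=
    (measurable_fst.const_sub v).prodMk measurable_snd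
  exact h.comp h2

theorem measurable_sinHalf : Measurable fun p : E d × E d => sinHalf p.1 p.2 := by
  unfold sinHalf InnerProductGeometry.angle
  fun_prop

theorem measurable_boltzmann_factor {γ : ℝ} {b : ℝ → ℝ} (hb : Measurable b) (ε : ℝ) (v : E d)
    {Φ : E d × E d → ℝ} (hΦ : Measurable Φ) :
    Measurable fun p : E d × E d => if ε < sinHalf (v - p.1) p.2 then
      collisionKernel γ b (v - p.1) p.2 * Φ p else 0 := by
  have h := measurable_sinHalf (d := d)
  have hs : Measurable fun p : E d × E d => sinHalf (v - p.1) p.2 :=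
    measurable_sub_left_fst h v
  have hbs : Measurable fun p : E d × E d => b (sinHalf (v - p.1) p.2) := hb.comp hs
  unfold collisionKernel
  refine Measurable.ite (measurableSet_lt measurable_const hs) ?_ measurable_const
  fun_prop

theorem boltzmannTrunc_le (hd : 2 ≤ d) {γ : ℝ} {b : ℝ → ℝ} (hb : IsAngularKernel d b)
    {f : E d → ℝ} (hf : Continuous f) (hf0 : ∀ u, 0 ≤ f u) {ε : ℝ} {v e : E d} (he : e ≠ 0)
    {B : ℝ} (hB : 0 ≤ B)
    (hΛ : ∫⁻ σ : Metric.sphere (0 : E d) 1, truncatedKernel b ε (cosSqHalf e σ)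
      ∂sphereMeasure d ≠ ⊤)
    (hI : ∫⁻ y : E d, ENNReal.ofReal (f (v - y)) * ENNReal.ofReal (‖y‖ ^ γ) ≠ ⊤)
    (hgain : ∫⁻ z : E d, ∫⁻ σ : Metric.sphere (0 : E d) 1,
      gainIntegrand γ (truncatedKernel b ε) (fun u => ENNReal.ofReal (f u))
        (fun u => ENNReal.ofReal (f u)) v z σ ∂sphereMeasure d ≤
      ENNReal.ofReal (f v) * ((∫⁻ σ : Metric.sphere (0 : E d) 1, truncatedKernel b ε (cosSqHalf e σ)
        ∂sphereMeasure d) *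
        ∫⁻ y : E d, ENNReal.ofReal (f (v - y)) * ENNReal.ofReal (‖y‖ ^ γ)) + ENNReal.ofReal B) :
    boltzmannTrunc γ b f f ε v ≤ B := by
  have hk := measurable_truncatedKernel hb.measurable ε
  set G : E d → E d → ℝ := fun vs σ => if ε < sinHalf (v - vs) σ then
    collisionKernel γ b (v - vs) σ * (f (vPrime v vs σ) * f (vsPrime v vs σ)) else 0 with hG
  set L : E d → E d → ℝ := fun vs σ => if ε < sinHalf (v - vs) σ then
    collisionKernel γ b (v - vs) σ * (f v * f vs) else 0 with hL
  have hGm : Measurable fun p : E d × E d => G p.1 p.2 := by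
    refine measurable_boltzmann_factor hb.measurable ε v
      (Φ := fun p => f (vPrime v p.1 p.2) * f (vsPrime v p.1 p.2)) ?_
    unfold vPrime vsPrime
    fun_prop
  have hLm : Measurable fun p : E d × E d => L p.1 p.2 :=
    measurable_boltzmann_factor hb.measurable ε v (Φ := fun p => f v * f p.1) (by fun_prop)
  have hker : ∀ vs σ : E d, ‖σ‖ = 1 → 0 ≤ collisionKernel γ b (v - vs) σ := by
    intro vs σ hσ
    have h0 := cosSqHalf_nonneg hσ (v - vs)
    rw [collisionKernel, sinHalf_eq hσ]
    exact mul_nonneg (by positivity)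
      (hb.nonneg _ ⟨Real.sqrt_nonneg _, Real.sqrt_le_one.2 (by linarith)⟩)
  have hsplit : boltzmannTrunc γ b f f ε v = ∫ vs : E d, ∫ σ : Metric.sphere (0 : E d) 1,
      (G vs σ - L vs σ) ∂sphereMeasure d := by
    rw [boltzmannTrunc]
    congr 1
    ext vs
    congr 1
    ext σ
    simp only [hG, hL]
    split_ifs
    · ring
    · ring
  have eL : ∫⁻ vs : E d, ∫⁻ σ : Metric.sphere (0 : E d) 1, ENNReal.ofReal (L vs σ)
      ∂sphereMeasure d = ENNReal.ofReal (f v) * ((∫⁻ σ : Metric.sphere (0 : E d) 1,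
        truncatedKernel b ε (cosSqHalf e σ) ∂sphereMeasure d) *
        ∫⁻ y : E d, ENNReal.ofReal (f (v - y)) * ENNReal.ofReal (‖y‖ ^ γ)) := by
    rw [← lintegral_boltzmannLoss hd γ hk v he hΛ]
    exact lintegral_congr fun vs => lintegral_congr fun σ =>
      ofReal_boltzmannLoss hb.nonneg hf0 ε v vs (by simp)
  have eG : ∫⁻ vs : E d, ∫⁻ σ : Metric.sphere (0 : E d) 1, ENNReal.ofReal (G vs σ)
      ∂sphereMeasure d = ∫⁻ z : E d, ∫⁻ σ : Metric.sphere (0 : E d) 1,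
      gainIntegrand γ (truncatedKernel b ε) (fun u => ENNReal.ofReal (f u))
        (fun u => ENNReal.ofReal (f u)) v z σ ∂sphereMeasure d := by
    have hsub := lintegral_sub_left_eq_self (μ := (volume : Measure (E d)))
      (fun z => ∫⁻ σ : Metric.sphere (0 : E d) 1,
        gainIntegrand γ (truncatedKernel b ε) (fun u => ENNReal.ofReal (f u))
          (fun u => ENNReal.ofReal (f u)) v z σ ∂sphereMeasure d) v
    rw [← hsub]
    refine lintegral_congr fun vs => lintegral_congr fun σ => ?_
    have hσ : ‖(σ : E d)‖ = 1 := by simp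
    exact ofReal_boltzmannGain hb.nonneg hf0 ε v vs hσ
  have hG0 : ∀ (vs : E d) (σ : Metric.sphere (0 : E d) 1), 0 ≤ G vs σ := fun vs σ => by
    simp only [hG]
    split_ifs
    · exact mul_nonneg (hker vs σ (by simp)) (mul_nonneg (hf0 _) (hf0 _))
    · exact le_rfl
  have hL0 : ∀ (vs : E d) (σ : Metric.sphere (0 : E d) 1), 0 ≤ L vs σ := fun vs σ => by
    simp only [hL]
    split_ifs
    · exact mul_nonneg (hker vs σ (by simp)) (mul_nonneg (hf0 _) (hf0 _))
    · exact le_rfl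
  rw [← eG, ← eL] at hgain
  have hLfin : ∫⁻ vs : E d, ∫⁻ σ : Metric.sphere (0 : E d) 1, ENNReal.ofReal (L vs σ)
      ∂sphereMeasure d ≠ ⊤ := by
    rw [eL]
    exact ENNReal.mul_ne_top ENNReal.ofReal_ne_top (ENNReal.mul_ne_top hΛ hI)
  rw [hsplit]
  clear_value G L
  have hGm' : Measurable fun p : E d × Metric.sphere (0 : E d) 1 => G p.1 (p.2 : E d) :=
    measurable_restrict_prod hGm
  have hLm' : Measurable fun p : E d × Metric.sphere (0 : E d) 1 => L p.1 (p.2 : E d) :=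
    measurable_restrict_prod hLm
  exact integral_sub_le_of_lintegral_le hGm' hLm' hG0 hL0 hB hLfin hgain

/-- The bound holds for every truncated operator with a constant independent of `ε`, hence for the
limit. -/
theorem exists_touchingEstimate_boltzmann (hd : 2 ≤ d) {γ m : ℝ} {b : ℝ → ℝ}
    (hγ : -(d : ℝ) < γ) (hb : IsAngularKernel d b) (hm : d + γ + 2 < m) :
    ∃ C : ℝ, 0 < C ∧ TouchingEstimate (d := d) (IsBoltzmannValue γ b) γ m C := by
  have hm0 : 0 ≤ m := by linarith
  obtain ⟨δ, hδ, hδ1, hpδ⟩ := exists_near_parameter hm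
  obtain ⟨C₁, hC₁, hfar⟩ := exists_far_pair_le (d := d) (p := d + γ) (by linarith) hm0 hδ
  obtain ⟨C₂, hC₂, hT⟩ := exists_lintegral_far_le hd hγ hm hδ
  set e : E d := EuclideanSpace.single ⟨0, by omega⟩ 1 with he
  have hen : ‖e‖ = 1 := by simp [he]
  have he0 : e ≠ 0 := norm_ne_zero_iff.1 (by rw [hen]; exact one_ne_zero)
  set s := ∫⁻ σ : Metric.sphere (0 : E d) 1,
    ENNReal.ofReal (sinHalf e σ ^ 2 * b (sinHalf e σ)) ∂sphereMeasure d with hs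
  have hst : s ≠ ⊤ := (hb.integrable e hen).lintegral_lt_top.ne
  -- `s` is the integral of `sin²(θ/2) b` for the polar axis `e`; adding `1` only ensures
  -- positivity.
  refine ⟨s.toReal * C₁ * C₂ + 1, by positivity, ?_⟩
  intro g N v q hg hg0 hN hgN hgv hq
  have hbv := bracket_pos v
  have hgv0 := hg0 v
  refine le_of_tendsto hq ?_
  filter_upwards [self_mem_nhdsWithin] with ε hε
  have hε0 : 0 < ε := hε
  have hk := measurable_truncatedKernel hb.measurable ε
  have hΛ : ∫⁻ σ : Metric.sphere (0 : E d) 1, truncatedKernel b ε (cosSqHalf e σ)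
      ∂sphereMeasure d ≠ ⊤ := by
    refine ne_top_of_le_ne_top (ENNReal.mul_ne_top (ENNReal.ofReal_ne_top (r := (ε ^ 2)⁻¹)) hst) ?_
    rw [hs, ← lintegral_const_mul' _ _ ENNReal.ofReal_ne_top]
    exact lintegral_mono fun σ => truncatedKernel_le hb.nonneg hε0 e (by simp)
  have hs2 : ∫⁻ σ : Metric.sphere (0 : E d) 1, truncatedKernel b ε (cosSqHalf e σ) *
      ENNReal.ofReal (1 - cosSqHalf e σ) ∂sphereMeasure d ≤ s :=
    lintegral_mono fun σ => truncatedKernel_mul_le b ε e (by simp)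
  have hI : ∫⁻ y : E d, ENNReal.ofReal (g (v - y)) * ENNReal.ofReal (‖y‖ ^ γ) ≠ ⊤ := by
    have hsub := lintegral_sub_left_eq_self (μ := (volume : Measure (E d)))
      (fun w => ENNReal.ofReal (g w) * ENNReal.ofReal (‖v - w‖ ^ γ)) v
    simp only [sub_sub_cancel] at hsub
    rw [hsub]
    have hint := (integrable_norm_sub_rpow_mul_bracket (m := m) hd hγ (by linarith) v).const_mul N
    refine ne_top_of_le_ne_top hint.lintegral_lt_top.ne (lintegral_mono fun w => ?_)
    rw [← ENNReal.ofReal_mul (hg0 w)]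
    refine ENNReal.ofReal_le_ofReal ?_
    calc g w * ‖v - w‖ ^ γ ≤ N * bracket w ^ (-m) * ‖v - w‖ ^ γ := by
          gcongr
          exact hgN w
      _ = _ := by ring
  set B := g v * (s.toReal * (C₁ * (N * C₂ * bracket v ^ (d + γ - m)))) with hBdef
  have hB : 0 ≤ B := by positivity
  have hBle : B ≤ (s.toReal * C₁ * C₂ + 1) * bracket v ^ (d + γ) * g v ^ 2 := by
    have hpow : bracket v ^ (d + γ - m) = bracket v ^ (d + γ) * bracket v ^ (-m) := by
      rw [← Real.rpow_add hbv, sub_eq_add_neg]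
    have : B = s.toReal * C₁ * C₂ * bracket v ^ (d + γ) * g v ^ 2 := by
      rw [hBdef, hpow, sq]
      nth_rewrite 3 [hgv]
      ring
    rw [this]
    have h1 : 0 ≤ bracket v ^ (d + γ) := by positivity
    nlinarith [mul_nonneg h1 (sq_nonneg (g v))]
  refine (boltzmannTrunc_le hd hb hg.continuous hg0 he0 hB hΛ hI ?_).trans hBle
  have htotal := lintegral_gain_total_le hd γ hk (F := fun u => ENNReal.ofReal (g u))
    hg.continuous.measurable.ennreal_ofReal (N := ENNReal.ofReal N) ENNReal.ofReal_ne_top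
    (m := m) (δ := δ) hC₁ (v := v) he0 (fun u => by
      rw [← ENNReal.ofReal_mul hN.le]
      exact ENNReal.ofReal_le_ofReal (hgN u))
    (fun y σ hσ hy hw => near_pair_le (by linarith) hm0 hδ hδ1 hpδ hσ hy hw) (hfar v)
  refine htotal.trans ?_
  -- The touching condition replaces `N * bracket v ^ (-m)` by `g v`, so the leading term of the
  -- gain bound becomes the loss term itself.
  rw [← mul_assoc, ← ENNReal.ofReal_mul hN.le, ← hgv, mul_add]
  refine add_le_add_right ?_ _
  rw [hBdef, ENNReal.ofReal_mul hgv0, ENNReal.ofReal_mul ENNReal.toReal_nonneg,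
    ENNReal.ofReal_toReal hst, ENNReal.ofReal_mul hC₁]
  gcongr
  exact hT v N g hN.le hgN

end BoltzmannEstimate

/-! ### The two spatial domains. -/

section Shifts

variable {d : ℕ}

theorem spaceShift_zero (x : E d) : spaceShift d x 0 = x :=
  add_zero x

theorem torusShift_zero {L : ℝ} (x : Torus d L) : torusShift d L x 0 = x := by
  funext i
  simp [torusShift]

end Shifts

end Kinetic

end

theorem theorem1p1 (d : ℕ) (hd : 2 ≤ d) :
    -- Landau, with the threshold `m₀ = d + 2 + γ`
    (∀ γ : ℝ, -(d : ℝ) ≤ γ → γ ≤ 1 → (d = 2 → -2 < γ) →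
      ∀ m : ℝ, d + 2 + γ < m →
        ∃ C : ℝ, 0 < C ∧
          Kinetic.AprioriEstimate (Kinetic.spaceShift d) (Kinetic.IsLandauValue γ) γ m C ∧
          ∀ L : ℝ, 0 < L →
            Kinetic.AprioriEstimate (Kinetic.torusShift d L) (Kinetic.IsLandauValue γ) γ m C) ∧
    -- Boltzmann, cutoff or non-cutoff
    (∀ (γ : ℝ) (b : ℝ → ℝ), -(d : ℝ) < γ → Kinetic.IsAngularKernel d b →
      ∃ m₀ : ℝ, ∀ m : ℝ, m₀ < m →
        ∃ C : ℝ, 0 < C ∧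
          Kinetic.AprioriEstimate (Kinetic.spaceShift d) (Kinetic.IsBoltzmannValue γ b) γ m C ∧
          ∀ L : ℝ, 0 < L →
            Kinetic.AprioriEstimate (Kinetic.torusShift d L)
              (Kinetic.IsBoltzmannValue γ b) γ m C) := by
  -- The Boltzmann threshold is the same number as for Landau and does not depend on `b`. The
  -- touching estimate involves velocity only, so one constant serves the whole space and all tori.
  refine ⟨fun γ hγ _ _ m hm => ?_, fun γ b hγ hb => ⟨d + γ + 2, fun m hm => ?_⟩⟩
  · obtain ⟨C, hC, hQ⟩ := Kinetic.exists_touchingEstimate_landau hd hγ hm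
    have hm' : d + γ ≤ m := by linarith
    exact ⟨C, hC, Kinetic.aprioriEstimate_of_touchingEstimate Kinetic.spaceShift_zero hC hm' hQ,
      fun L _ => Kinetic.aprioriEstimate_of_touchingEstimate Kinetic.torusShift_zero hC hm' hQ⟩
  · obtain ⟨C, hC, hQ⟩ := Kinetic.exists_touchingEstimate_boltzmann hd hγ hb hm
    have hm' : d + γ ≤ m := by linarith
    exact ⟨C, hC, Kinetic.aprioriEstimate_of_touchingEstimate Kinetic.spaceShift_zero hC hm' hQ,
      fun L _ => Kinetic.aprioriEstimate_of_touchingEstimate Kinetic.torusShift_zero hC hm' hQ⟩
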